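/- Let $\Delta\ge 3$ be an integer or $\Delta=\infty$. Let $\beta,\gamma,\lambda$ be real numbers with $0\le\beta\le\gamma$, $\gamma>0$, $\beta\gamma<1$ and $\lambda>0$ (anti-ferromagnetic parameters). The partition function of the two-state spin system with these parameters on a finite simple graph $G=(V,E)$ is $$Z(G)=\sum_{\sigma:V\to\{0,1\}}\ \prod_{\{u,v\}\in E}A_{\sigma(u),\sigma(v)}\prod_{v\in V}b_{\sigma(v)},\qquad A=\begin{pmatrix}\beta&1\\1&\gamma\end{pmatrix},\quad b=(\lambda,1).$$ For an integer $d\ge1$ let $f_d(x)=\lambda\left(\frac{\beta x+1}{x+\gamma}\right)^d$, the recursion on the infinite $(d+1)$-regular tree, and let $\hat x_d$ be its unique positive fixed point; the parameters lie in the interior of the uniqueness region of the infinite $(d+1)$-regular tree if $|f_d'(\hat x_d)|<1$. Suppose that $|f_d'(\hat x_d)|<1$ for all integers $1\le d<\Delta$, that is, the parameters lie in the interior of the uniqueness region of the infinite regular tree of every degree between $2$ and $\Delta$ (of every finite degree at least $2$ if $\Delta=\infty$). Then there is an FPTAS for the partition function on the graphs of maximum degree at most $\Delta$ (on all finite graphs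 if $\Delta=\infty$): there is a deterministic algorithm, which may depend on $\beta,\gamma,\lambda,\Delta$, that for every such graph $G$ with $n$ vertices and every rational $\varepsilon>0$ returns a rational number $\widehat Z$ with $$(1-\varepsilon)\,Z(G)\le\widehat Z\le(1+\varepsilon)\,Z(G)$$ in time polynomial in $n$, $1/\varepsilon$ and the bit length of $\varepsilon$. Time is bit complexity; the fixed real parameters are available to the algorithm through an oracle that, for each $k$, returns an approximation of a parameter by a multiple of $2^{-k}$ with error at most $2^{-k}$, where a query with precision $k$ costs at least $k$ steps. (If the parameters are computable to within $2^{-k}$ in time polynomial in $k$, for example if they are rational, no oracle is needed.) -/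

import Mathlib

namespace TwoSpin

/-! ## Two-state spin systems -/

/-- The parameters `(β, γ, lam)` are anti-ferromagnetic. -/
def AntiFerromagnetic (β γ lam : ℝ) : Prop :=
  0 ≤ β ∧ β ≤ γ ∧ 0 < γ ∧ β * γ < 1 ∧ 0 < lam

/-- Edge interaction matrix; spin `0` is blue and spin `1` is green. -/
def edgeMatrix (β γ : ℝ) : Matrix (Fin 2) (Fin 2) ℝ := !![β, 1; 1, γ]

/-- Vertex contributions. -/
def vertexWeight (lam : ℝ) : Fin 2 → ℝ := ![lam, 1]

theorem edgeMatrix_symm (β γ : ℝ) (i j : Fin 2) : edgeMatrix β γ i j = edgeMatrix β γ j i := by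
  fin_cases i <;> fin_cases j <;> simp [edgeMatrix]

/-- The weight of a configuration: the product over all (undirected) edges of the entry of the
interaction matrix at the spins of the two end points, times the product of the vertex
contributions. -/
noncomputable def weight {V : Type*} [Fintype V] (G : SimpleGraph V) [Fintype G.edgeSet]
    (β γ lam : ℝ) (σ : V → Fin 2) : ℝ :=
  (∏ e ∈ G.edgeFinset,
    Sym2.lift ⟨fun u v => edgeMatrix β γ (σ u) (σ v),
      fun u v => edgeMatrix_symm β γ (σ u) (σ v)⟩ e) * ∏ v, vertexWeight lam (σ v)

/-- The partition function. -/
noncomputable def partitionFunction {V : Type*} [Fintype V] [DecidableEq V] (G : SimpleGraph V)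
    [Fintype G.edgeSet] (β γ lam : ℝ) : ℝ :=
  ∑ σ : V → Fin 2, weight G β γ lam σ

/-! ## Uniqueness on infinite regular trees -/

/-- The recursion on the infinite `(d + 1)`-regular tree. -/
noncomputable def treeRecursion (β γ lam : ℝ) (d : ℕ) (x : ℝ) : ℝ :=
  lam * ((β * x + 1) / (x + γ)) ^ d

/-- The parameters lie in the interior of the uniqueness region of the infinite
`(d + 1)`-regular tree: at the positive fixed point of the tree recursion the derivative is
smaller than one in absolute value. For anti-ferromagnetic parameters the recursion is continuous,
positive and antitone on the positive half-line, so it has exactly one positive fixed point. -/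
def InteriorUnique (β γ lam : ℝ) (d : ℕ) : Prop :=
  ∃ x : ℝ, 0 < x ∧ treeRecursion β γ lam d x = x ∧ |deriv (treeRecursion β γ lam d) x| < 1

/-- Uniqueness (strictly inside the uniqueness region) on the infinite regular trees of all
degrees `d + 1` with `2 ≤ d + 1 ≤ Δ`; for `Δ = ⊤` on all of them. -/
def UpToUnique (β γ lam : ℝ) (Δ : ℕ∞) : Prop :=
  ∀ d : ℕ, 1 ≤ d → (d : ℕ∞) < Δ → InteriorUnique β γ lam d

/-! ## The model of computation

A first-order call-by-value language with recursive functions. Data are binary trees whose leaves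
are natural numbers, arithmetic is charged by the number of bits of the operands and every other
operation is charged one unit. A computation of cost `t` is simulated, in time polynomial in `t` and
the size of the input, by a Turing machine or by a random access machine with logarithmic cost (the
pairs live on a heap and are passed by reference). -/

/-- Data. The empty list is the number `0`. -/
inductive Val : Type
  | num (n : ℕ) : Val
  | pair (a b : Val) : Val

namespace Val

/-- The number at a leaf. -/
def toNat : Val → ℕ
  | num n => n
  | pair _ _ => 0

/-- First component. -/
def fst : Val → Val
  | num _ => num 0
  | pair a _ => a

/-- Second component. -/
def snd : Val → Val
  | num _ => num 0
  | pair _ b => b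

/-- Everything except the number `0` counts as true. -/
def IsTrue (v : Val) : Prop := v ≠ num 0

/-- A list as nested pairs. -/
def ofList : List Val → Val
  | [] => num 0
  | a :: l => pair a (ofList l)

/-- The number denoted by a pair of natural numbers, numerator and denominator. -/
noncomputable def toReal (v : Val) : ℝ := (v.fst.toNat : ℝ) / (v.snd.toNat : ℝ)

end Val

/-- The arithmetic operations (truncated subtraction, division with remainder discarded). -/
inductive Arith : Type
  | plus | minus | times | quot

/-- The value of an arithmetic operation. -/
def Arith.apply : Arith → ℕ → ℕ → ℕ
  | plus, m, n => m + n
  | minus, m, n => m - n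
  | times, m, n => m * n
  | quot, m, n => m / n

/-- Terms. `var i` is the `i`-th entry of the environment, `bind a b` evaluates `b` with the value
of `a` put in front of the environment, `call f a` calls the `f`-th function of the program with the
value of `a` as its only argument, and `query i a` asks for a dyadic approximation of the `i`-th
parameter of the spin system with as many fractional bits as the value of `a` says. -/
inductive Term : Type
  | var (i : ℕ) : Term
  | lit (n : ℕ) : Term
  | arith (o : Arith) (a b : Term) : Term
  | pair (a b : Term) : Term
  | fst (a : Term) : Term
  | snd (a : Term) : Term
  | cond (c a b : Term) : Term
  | bind (a b : Term) : Term
  | call (f : ℕ) (a : Term) : Term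
  | query (i : Fin 3) (a : Term) : Term

/-- A program is a list of function bodies, which may call each other. -/
abbrev Program : Type := List Term

/-- Answers to the queries for the parameters. -/
abbrev Oracle : Type := Fin 3 → ℕ → ℕ

/-- `Eval P O ρ a v t`: in the program `P`, with the oracle `O` and the environment `ρ`, the
evaluation of the term `a` terminates with value `v` at cost `t`. -/
inductive Eval (P : Program) (O : Oracle) : List Val → Term → Val → ℕ → Prop
  | var (ρ : List Val) (i : ℕ) : Eval P O ρ (.var i) (ρ.getD i (.num 0)) 1
  | lit (ρ : List Val) (n : ℕ) : Eval P O ρ (.lit n) (.num n) 1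
  | arith {ρ : List Val} (o : Arith) {a b : Term} {v w : Val} {s t : ℕ} :
      Eval P O ρ a v s → Eval P O ρ b w t →
      Eval P O ρ (.arith o a b) (.num (o.apply v.toNat w.toNat))
        (s + t + 1 + v.toNat.size + w.toNat.size)
  | pair {ρ : List Val} {a b : Term} {v w : Val} {s t : ℕ} :
      Eval P O ρ a v s → Eval P O ρ b w t → Eval P O ρ (.pair a b) (.pair v w) (s + t + 1)
  | fst {ρ : List Val} {a : Term} {v : Val} {s : ℕ} :
      Eval P O ρ a v s → Eval P O ρ (.fst a) v.fst (s + 1)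
  | snd {ρ : List Val} {a : Term} {v : Val} {s : ℕ} :
      Eval P O ρ a v s → Eval P O ρ (.snd a) v.snd (s + 1)
  | condTrue {ρ : List Val} {c a b : Term} {u v : Val} {s t : ℕ} :
      Eval P O ρ c u s → u.IsTrue → Eval P O ρ a v t → Eval P O ρ (.cond c a b) v (s + t + 1)
  | condFalse {ρ : List Val} {c a b : Term} {u v : Val} {s t : ℕ} :
      Eval P O ρ c u s → ¬ u.IsTrue → Eval P O ρ b v t → Eval P O ρ (.cond c a b) v (s + t + 1)
  | bind {ρ : List Val} {a b : Term} {v w : Val} {s t : ℕ} :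
      Eval P O ρ a v s → Eval P O (v :: ρ) b w t → Eval P O ρ (.bind a b) w (s + t + 1)
  | call {ρ : List Val} {f : ℕ} {body a : Term} {v w : Val} {s t : ℕ} :
      P[f]? = some body → Eval P O ρ a v s → Eval P O [v] body w t →
      Eval P O ρ (.call f a) w (s + t + 1)
  | query {ρ : List Val} (i : Fin 3) {a : Term} {v : Val} {s : ℕ} :
      Eval P O ρ a v s →
      Eval P O ρ (.query i a) (.num (O i v.toNat)) (s + 1 + v.toNat + (O i v.toNat).size)

/-- The language is deterministic: value and cost are functions of program and input. -/
theorem Eval.deterministic {P : Program} {O : Oracle} {ρ : List Val} {a : Term} {v : Val} {t : ℕ}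
    (h : Eval P O ρ a v t) : ∀ {v' : Val} {t' : ℕ}, Eval P O ρ a v' t' → v = v' ∧ t = t' := by
  induction h with
  | var | lit => intro _ _ h'; cases h'; exact ⟨rfl, rfl⟩
  | arith o _ _ ih₁ ih₂ =>
    intro _ _ h'
    cases h' with
    | arith o h₁ h₂ =>
      obtain ⟨rfl, rfl⟩ := ih₁ h₁
      obtain ⟨rfl, rfl⟩ := ih₂ h₂
      exact ⟨rfl, rfl⟩
  | pair _ _ ih₁ ih₂ =>
    intro _ _ h'
    cases h' with
    | pair h₁ h₂ =>
      obtain ⟨rfl, rfl⟩ := ih₁ h₁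
      obtain ⟨rfl, rfl⟩ := ih₂ h₂
      exact ⟨rfl, rfl⟩
  | bind _ _ ih₁ ih₂ =>
    intro _ _ h'
    cases h' with
    | bind h₁ h₂ =>
      obtain ⟨rfl, rfl⟩ := ih₁ h₁
      obtain ⟨rfl, rfl⟩ := ih₂ h₂
      exact ⟨rfl, rfl⟩
  | fst _ ih =>
    intro _ _ h'
    cases h' with
    | fst h₁ => obtain ⟨rfl, rfl⟩ := ih h₁; exact ⟨rfl, rfl⟩
  | snd _ ih =>
    intro _ _ h'
    cases h' with
    | snd h₁ => obtain ⟨rfl, rfl⟩ := ih h₁; exact ⟨rfl, rfl⟩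
  | query i _ ih =>
    intro _ _ h'
    cases h' with
    | query i h₁ => obtain ⟨rfl, rfl⟩ := ih h₁; exact ⟨rfl, rfl⟩
  | condTrue _ hu _ ih₁ ih₂ =>
    intro _ _ h'
    cases h' with
    | condTrue h₁ _ h₂ =>
      obtain ⟨rfl, rfl⟩ := ih₁ h₁
      obtain ⟨rfl, rfl⟩ := ih₂ h₂
      exact ⟨rfl, rfl⟩
    | condFalse h₁ hu' _ => exact absurd hu ((ih₁ h₁).1 ▸ hu')
  | condFalse _ hu _ ih₁ ih₂ =>
    intro _ _ h'
    cases h' with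
    | condTrue h₁ hu' _ => exact absurd ((ih₁ h₁).1 ▸ hu') hu
    | condFalse h₁ _ h₂ =>
      obtain ⟨rfl, rfl⟩ := ih₁ h₁
      obtain ⟨rfl, rfl⟩ := ih₂ h₂
      exact ⟨rfl, rfl⟩
  | call hP _ _ ih₁ ih₂ =>
    intro _ _ h'
    cases h' with
    | call hP' h₁ h₂ =>
      obtain ⟨rfl, rfl⟩ := ih₁ h₁
      cases hP.symm.trans hP'
      obtain ⟨rfl, rfl⟩ := ih₂ h₂
      exact ⟨rfl, rfl⟩

/-- Running a program: its function number `0` is called with the input as argument. -/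
def Runs (P : Program) (O : Oracle) (input output : Val) (cost : ℕ) : Prop :=
  Eval P O [input] (.call 0 (.var 0)) output cost

/-- The answers of the oracle approximate the real numbers `θ i`: the answer to a query with
precision `k` is a numerator over the denominator `2 ^ k`, with error at most `2 ^ (-k)`. -/
def Approximates (O : Oracle) (θ : Fin 3 → ℝ) : Prop :=
  ∀ (i : Fin 3) (k : ℕ), |(O i k : ℝ) - 2 ^ k * θ i| ≤ 1

/-! ## Fully polynomial-time approximation schemes -/

/-- A graph on `{0, …, n - 1}` as its adjacency matrix, the list of its rows. -/
def encodeGraph {n : ℕ} (G : SimpleGraph (Fin n)) [DecidableRel G.Adj] : Val :=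
  Val.ofList (List.ofFn fun i : Fin n =>
    Val.ofList (List.ofFn fun j : Fin n => Val.num (if G.Adj i j then 1 else 0)))

/-- The input: the graph and the relative error, a positive rational in lowest terms. -/
def encodeInput {n : ℕ} (G : SimpleGraph (Fin n)) [DecidableRel G.Adj] (ε : ℚ) : Val :=
  .pair (encodeGraph G) (.pair (.num ε.num.toNat) (.num ε.den))

/-- The number of bits of a positive rational number. -/
def bitLength (ε : ℚ) : ℕ := ε.num.toNat.size + ε.den.size

/-- There is an FPTAS for the partition function of the two-state spin system with the fixed real
parameters `(β, γ, lam)` on the graphs of maximum degree at most `Δ` (all graphs if `Δ = ⊤`). The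
program may depend on the parameters and has access to the exact real parameters through arbitrary
approximations of them. On every such graph and for every rational `ε > 0` it returns a rational
number that is correct up to a factor in `[1 - ε, 1 + ε]`, and its running time is bounded by a
polynomial in the number of vertices, the length of `ε` and `1 / ε`. -/
def HasFPTAS (β γ lam : ℝ) (Δ : ℕ∞) : Prop :=
  ∃ (P : Program) (c : ℕ), ∀ O : Oracle, Approximates O ![β, γ, lam] →
    ∀ (n : ℕ) (G : SimpleGraph (Fin n)) [DecidableRel G.Adj],
      (∀ v, (G.degree v : ℕ∞) ≤ Δ) →
      ∀ ε : ℚ, 0 < ε →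
        ∃ (out : Val) (t : ℕ), Runs P O (encodeInput G ε) out t ∧
          (t : ℝ) ≤ c * ((n : ℝ) + bitLength ε + 1 / ε) ^ c ∧
          (1 - ε) * partitionFunction G β γ lam ≤ out.toReal ∧
          out.toReal ≤ (1 + ε) * partitionFunction G β γ lam

end TwoSpin

/-!
The scheme is the correlation decay algorithm on self-avoiding walks, with a potential function.

*Recursion.* Let `R` be the ratio of the weights of the configurations in which a vertex `v` is blue
and green. Changing the spin seen by the neighbours of `v` one neighbour at a time writes `R` as
`lam * ∏ h (R i)`, where `h x = (β x + 1) / (x + γ)` is `edgeFactor` and `R i` is the ratio at a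
neighbour after the removal of `v`, in which the earlier and later neighbours see `v` with different
spins (`exactRatio`, `exactRatio_eq`). The partition function is a product of a power of `γ` and of
numbers `1 + R` (`partitionFunction_eq`).

*Decay.* The logarithmic sensitivity of `h` at `x` is `sens x = (1 - βγ) x / ((βx + 1)(x + γ))`. In
the potential whose derivative is proportional to `1 / √(x (βx + 1)(x + γ))`, one step of the
recursion contracts the maximum of the errors by the factor `√(sens R) * ∑ √(sens (R i))`
(`potential_contraction`). The sensitivity of a child, as a function of `log (h (R i))`, allows a
Jensen type estimate (`exists_sum_factorSens_le`), so that for `d` children the worst case has all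
`R i` equal to some `x`, and the square of the factor is `d² * sens x * sens (f_d x)`. Where this is
largest its value is at most `d * sens x̂ = |f_d' x̂| < 1` (`twoStep_le_fixedPoint`,
`decayRate_sq_le`). If the degrees are unbounded, uniqueness forces `γ > 1`
(`one_lt_of_interiorUnique`), and then the factor is exponentially small in `d`. In either case there
is one exponent `k` such that the factor `a` at every node with `d` children satisfies
`a ^ k * (d + 3) ≤ 1` (`exists_decay_exponent`).

*Truncation.* Instead of a depth the algorithm uses a budget: a node with budget `L` and degree `d`
gives `L / (d + 2)` to each child and returns `0` if its budget is zero (`approxRatio`). The number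
of calls is then linear in `L` times the number of vertices, and by the choice of `k` the error at
budget `L` is of order `L ^ (-1 / k)`, whatever the degrees are (`exists_budget`). A polynomial
budget suffices.

*Arithmetic.* All ratios are computed exactly as fractions of natural numbers, from dyadic
approximations of the parameters. Each call contributes boundedly many arithmetic operations, so the
relative error caused by the approximations (`approxRatio_logClose`) and the bit lengths of the
fractions (`returns_tree`) are both linear in the number of calls. The only parameter that may vanish
is `β`; whether it does is a property of the parameters and is built into the program (`betaTerm`).
-/

namespace TwoSpin

/-! ### The tree recursion and its logarithmic sensitivity -/

/-- The factor which a child with ratio `x` contributes to the ratio of its parent. -/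
noncomputable def edgeFactor (β γ x : ℝ) : ℝ := (β * x + 1) / (x + γ)

/-- The logarithmic sensitivity `|x h'(x) / h(x)|` of `h = edgeFactor β γ` at `x`. -/
noncomputable def sens (β γ x : ℝ) : ℝ := (1 - β * γ) * x / ((β * x + 1) * (x + γ))

/-- The logarithmic derivative `x s'(x) / s(x)` of the sensitivity `s = sens β γ`. -/
noncomputable def sensSlope (β γ x : ℝ) : ℝ := 1 / (β * x + 1) - x / (x + γ)

variable {β γ lam : ℝ}

theorem edgeFactor_pos (hβ : 0 ≤ β) (hγ : 0 < γ) {x : ℝ} (hx : 0 ≤ x) :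
    0 < edgeFactor β γ x := by
  unfold edgeFactor; positivity

theorem sens_nonneg (hβ : 0 ≤ β) (hγ : 0 < γ) (hβγ : β * γ < 1) {x : ℝ} (hx : 0 ≤ x) :
    0 ≤ sens β γ x := by
  have : 0 < 1 - β * γ := by linarith
  unfold sens; positivity

theorem sens_pos (hβ : 0 ≤ β) (hγ : 0 < γ) (hβγ : β * γ < 1) {x : ℝ} (hx : 0 < x) :
    0 < sens β γ x := by
  have : 0 < 1 - β * γ := by linarith
  unfold sens; positivity

theorem sens_le_one (hβ : 0 ≤ β) (hγ : 0 < γ) {x : ℝ} (hx : 0 ≤ x) :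
    sens β γ x ≤ 1 := by
  unfold sens
  rw [div_le_one (by positivity)]
  have : 0 ≤ β * γ * x := by positivity
  have : 0 ≤ β * x * x := by positivity
  nlinarith

theorem edgeFactor_le (hγ : 0 < γ) (hβγ : β * γ < 1) {x : ℝ} (hx : 0 ≤ x) :
    edgeFactor β γ x ≤ 1 / γ := by
  unfold edgeFactor
  rw [div_le_div_iff₀ (by positivity) hγ]
  nlinarith

theorem le_edgeFactor (hγ : 0 < γ) (hβγ : β * γ < 1) {x : ℝ} (hx : 0 ≤ x) :
    β ≤ edgeFactor β γ x := by
  unfold edgeFactor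
  rw [le_div_iff₀ (by positivity)]
  nlinarith

theorem hasDerivAt_edgeFactor (hγ : 0 < γ) {x : ℝ} (hx : 0 ≤ x) :
    HasDerivAt (edgeFactor β γ) (-(1 - β * γ) / (x + γ) ^ 2) x := by
  have h1 : HasDerivAt (fun x : ℝ => β * x + 1) β x := by
    simpa using ((hasDerivAt_id x).const_mul β).add_const 1
  have h2 : HasDerivAt (fun x : ℝ => x + γ) 1 x := (hasDerivAt_id x).add_const γ
  have := h1.div h2 (by positivity)
  refine this.congr_deriv ?_
  congr 1; ring

theorem edgeFactor_antitoneOn (hβγ : β * γ < 1) (hγ : 0 < γ) {x y : ℝ} (hx : 0 ≤ x) (hxy : x ≤ y) :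
    edgeFactor β γ y ≤ edgeFactor β γ x := by
  unfold edgeFactor
  rw [div_le_div_iff₀ (by linarith) (by linarith)]
  nlinarith

theorem hasDerivAt_treeRecursion (hβ : 0 ≤ β) (hγ : 0 < γ) (d : ℕ) {x : ℝ} (hx : 0 < x) :
    HasDerivAt (treeRecursion β γ lam d)
      (-(treeRecursion β γ lam d x * (d * sens β γ x)) / x) x := by
  have h := ((hasDerivAt_edgeFactor (β := β) hγ hx.le).pow d).const_mul lam
  have hE : treeRecursion β γ lam d = fun x => lam * edgeFactor β γ x ^ d := rfl
  rw [hE]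
  refine h.congr_deriv ?_
  have h1 : 0 < β * x + 1 := by positivity
  have h2 : 0 < x + γ := by positivity
  rcases d with _ | d
  · simp
  · simp only [Nat.add_sub_cancel, pow_succ, edgeFactor, sens]
    push_cast
    field_simp

theorem exists_fixedPoint_of_interiorUnique (hβ : 0 ≤ β) (hγ : 0 < γ) (hβγ : β * γ < 1) {d : ℕ}
    (h : InteriorUnique β γ lam d) :
    ∃ x : ℝ, 0 < x ∧ treeRecursion β γ lam d x = x ∧ d * sens β γ x < 1 := by
  obtain ⟨x, hx, hfix, hd⟩ := h
  refine ⟨x, hx, hfix, ?_⟩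
  rw [(hasDerivAt_treeRecursion hβ hγ d hx).deriv, hfix] at hd
  have hs := sens_nonneg hβ hγ hβγ hx.le
  rw [neg_div, abs_neg, mul_div_assoc, mul_div_cancel₀ _ hx.ne', abs_of_nonneg (by positivity)] at hd
  exact hd

theorem hasDerivAt_sens (hβ : 0 ≤ β) (hγ : 0 < γ) {x : ℝ} (hx : 0 < x) :
    HasDerivAt (sens β γ) (sens β γ x * sensSlope β γ x / x) x := by
  have h1 : HasDerivAt (fun x : ℝ => β * x + 1) β x := by
    simpa using ((hasDerivAt_id x).const_mul β).add_const 1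
  have h2 : HasDerivAt (fun x : ℝ => x + γ) 1 x := (hasDerivAt_id x).add_const γ
  have h0 : HasDerivAt (fun x : ℝ => (1 - β * γ) * x) (1 - β * γ) x := by
    simpa using (hasDerivAt_id x).const_mul (1 - β * γ)
  have p1 : 0 < β * x + 1 := by positivity
  have p2 : 0 < x + γ := by positivity
  refine (h0.div (h1.mul h2) (mul_pos p1 p2).ne').congr_deriv ?_
  simp only [sens, sensSlope, Pi.mul_apply]
  field_simp
  ring

theorem sensSlope_antitoneOn (hβ : 0 ≤ β) (hγ : 0 < γ) {x y : ℝ} (hx : 0 ≤ x) (hxy : x ≤ y) :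
    sensSlope β γ y ≤ sensSlope β γ x := by
  have h1 : 1 / (β * y + 1) ≤ 1 / (β * x + 1) := by gcongr
  have h2 : x / (x + γ) ≤ y / (y + γ) := by
    rw [div_le_div_iff₀ (by linarith) (by linarith)]; nlinarith
  unfold sensSlope; linarith

/-- The quotient of the slope of the sensitivity and the sensitivity is `(γ / x - β x) / (1 - β γ)`
and hence decreasing. -/
theorem sensSlope_mul_sens_le (hβ : 0 ≤ β) (hγ : 0 < γ) (hβγ : β * γ < 1) {x y : ℝ} (hx : 0 < x)
    (hxy : x ≤ y) : sensSlope β γ y * sens β γ x ≤ sensSlope β γ x * sens β γ y := by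
  have hy : 0 < y := hx.trans_le hxy
  have key : ∀ z : ℝ, 0 < z →
      sensSlope β γ z = sens β γ z * ((γ / z - β * z) / (1 - β * γ)) := by
    intro z hz
    have p0 : 0 < 1 - β * γ := by linarith
    have p1 : 0 < β * z + 1 := by positivity
    have p2 : 0 < z + γ := by positivity
    simp only [sens, sensSlope]
    field_simp
    ring
  have hm : (γ / y - β * y) / (1 - β * γ) ≤ (γ / x - β * x) / (1 - β * γ) := by
    have p0 : 0 < 1 - β * γ := by linarith
    gcongr
  rw [key x hx, key y hy]
  have := sens_pos hβ hγ hβγ hx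
  have := sens_pos hβ hγ hβγ hy
  have := mul_le_mul_of_nonneg_left hm (mul_nonneg (sens_pos hβ hγ hβγ hx).le
    (sens_pos hβ hγ hβγ hy).le)
  linarith

theorem treeRecursion_pos (hβ : 0 ≤ β) (hγ : 0 < γ) (hlam : 0 < lam) (d : ℕ) {x : ℝ} (hx : 0 ≤ x) :
    0 < treeRecursion β γ lam d x := by
  unfold treeRecursion; positivity

theorem treeRecursion_antitoneOn (hβ : 0 ≤ β) (hγ : 0 < γ) (hβγ : β * γ < 1) (hlam : 0 < lam)
    (d : ℕ) {x y : ℝ} (hx : 0 ≤ x) (hxy : x ≤ y) :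
    treeRecursion β γ lam d y ≤ treeRecursion β γ lam d x := by
  have h1 := edgeFactor_antitoneOn hβγ hγ hx hxy
  have h2 := edgeFactor_pos hβ hγ (hx.trans hxy)
  exact mul_le_mul_of_nonneg_left (pow_le_pow_left₀ h2.le h1 d) hlam.le

/-- The sign of this function is the sign of the derivative of the two-step sensitivity
`x ↦ sens x * sens (f_d x)`. -/
noncomputable def twoStepSlope (β γ lam : ℝ) (d : ℕ) (x : ℝ) : ℝ :=
  (γ / x - β * x) / (d * (1 - β * γ)) - sensSlope β γ (treeRecursion β γ lam d x)

theorem hasDerivAt_twoStep (hβ : 0 ≤ β) (hγ : 0 < γ) (hβγ : β * γ < 1) (hlam : 0 < lam) {d : ℕ}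
    (hd : 1 ≤ d) {x : ℝ} (hx : 0 < x) :
    HasDerivAt (fun x => sens β γ x * sens β γ (treeRecursion β γ lam d x))
      (d * sens β γ x ^ 2 * sens β γ (treeRecursion β γ lam d x) / x *
        twoStepSlope β γ lam d x) x := by
  have hf := treeRecursion_pos hβ hγ hlam d hx.le
  have h := (hasDerivAt_sens hβ hγ hx).mul
    ((hasDerivAt_sens hβ hγ hf).comp x (hasDerivAt_treeRecursion hβ hγ d hx))
  refine h.congr_deriv ?_
  have key : sensSlope β γ x = d * sens β γ x * ((γ / x - β * x) / (d * (1 - β * γ))) := by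
    have p0 : 0 < 1 - β * γ := by linarith
    have p1 : 0 < β * x + 1 := by positivity
    have p2 : 0 < x + γ := by positivity
    have p3 : (0 : ℝ) < d := by exact_mod_cast hd
    simp only [sens, sensSlope]
    field_simp
    ring
  simp only [Function.comp, twoStepSlope]
  rw [key]
  field_simp
  ring

theorem twoStepSlope_antitoneOn (hβ : 0 ≤ β) (hγ : 0 < γ) (hβγ : β * γ < 1) (hlam : 0 < lam)
    (d : ℕ) {x y : ℝ} (hx : 0 < x) (hxy : x ≤ y) :
    twoStepSlope β γ lam d y ≤ twoStepSlope β γ lam d x := by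
  have p0 : 0 < 1 - β * γ := by linarith
  have hy : 0 < y := hx.trans_le hxy
  have h1 : (γ / y - β * y) / (d * (1 - β * γ)) ≤ (γ / x - β * x) / (d * (1 - β * γ)) := by
    gcongr
  have h2 := sensSlope_antitoneOn hβ hγ (treeRecursion_pos hβ hγ hlam d hy.le).le
    (treeRecursion_antitoneOn hβ hγ hβγ hlam d hx.le hxy)
  unfold twoStepSlope; linarith

theorem twoStep_le_of_slope_eq_zero (hβ : 0 ≤ β) (hγ : 0 < γ) (hβγ : β * γ < 1) (hlam : 0 < lam)
    {d : ℕ} (hd : 1 ≤ d) {z x : ℝ} (hz : 0 < z) (hx : 0 < x)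
    (h0 : twoStepSlope β γ lam d z = 0) :
    sens β γ x * sens β γ (treeRecursion β γ lam d x) ≤
      sens β γ z * sens β γ (treeRecursion β γ lam d z) := by
  have hc : ∀ x : ℝ, 0 < x → ContinuousAt
      (fun x => sens β γ x * sens β γ (treeRecursion β γ lam d x)) x := fun x hx =>
    (hasDerivAt_twoStep hβ hγ hβγ hlam hd hx).continuousAt
  have hp : ∀ x : ℝ, 0 < x →
      0 ≤ d * sens β γ x ^ 2 * sens β γ (treeRecursion β γ lam d x) / x := fun x hx => by
    have := sens_pos hβ hγ hβγ (treeRecursion_pos hβ hγ hlam d hx.le)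
    positivity
  rcases le_total x z with hxz | hxz
  · have hm : MonotoneOn (fun x => sens β γ x * sens β γ (treeRecursion β γ lam d x))
        (Set.Icc x z) := by
      refine monotoneOn_of_deriv_nonneg (convex_Icc x z)
        (fun u hu => (hc u (hx.trans_le hu.1)).continuousWithinAt) ?_ ?_
      · intro u hu
        rw [interior_Icc] at hu
        exact (hasDerivAt_twoStep hβ hγ hβγ hlam hd
          (hx.trans hu.1)).differentiableAt.differentiableWithinAt
      · intro u hu
        rw [interior_Icc] at hu
        have hu0 := hx.trans hu.1
        rw [(hasDerivAt_twoStep hβ hγ hβγ hlam hd hu0).deriv]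
        refine mul_nonneg (hp u hu0) ?_
        rw [← h0]
        exact twoStepSlope_antitoneOn hβ hγ hβγ hlam d hu0 hu.2.le
    exact hm ⟨le_rfl, hxz⟩ ⟨hxz, le_rfl⟩ hxz
  · have hm : AntitoneOn (fun x => sens β γ x * sens β γ (treeRecursion β γ lam d x))
        (Set.Icc z x) := by
      refine antitoneOn_of_deriv_nonpos (convex_Icc z x)
        (fun u hu => (hc u (hz.trans_le hu.1)).continuousWithinAt) ?_ ?_
      · intro u hu
        rw [interior_Icc] at hu
        exact (hasDerivAt_twoStep hβ hγ hβγ hlam hd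
          (hz.trans hu.1)).differentiableAt.differentiableWithinAt
      · intro u hu
        rw [interior_Icc] at hu
        have hu0 := hz.trans hu.1
        rw [(hasDerivAt_twoStep hβ hγ hβγ hlam hd hu0).deriv]
        refine mul_nonpos_of_nonneg_of_nonpos (hp u hu0) ?_
        rw [← h0]
        exact twoStepSlope_antitoneOn hβ hγ hβγ hlam d hz hu.1.le
    exact hm ⟨le_rfl, hxz⟩ ⟨hxz, le_rfl⟩ hxz

theorem continuousAt_twoStepSlope (hβ : 0 ≤ β) (hγ : 0 < γ) (hlam : 0 < lam)
    (d : ℕ) {x : ℝ} (hx : 0 < x) : ContinuousAt (twoStepSlope β γ lam d) x := by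
  have hf := treeRecursion_pos hβ hγ hlam d hx.le
  have hfc := (hasDerivAt_treeRecursion (lam := lam) hβ hγ d hx).continuousAt
  have h1 : ContinuousAt (fun x => (γ / x - β * x) / (d * (1 - β * γ))) x := by
    have := hx.ne'
    fun_prop (disch := assumption)
  have h2 : ContinuousAt (sensSlope β γ) (treeRecursion β γ lam d x) := by
    set y := treeRecursion β γ lam d x
    have e1 : β * y + 1 ≠ 0 := by positivity
    have e2 : y + γ ≠ 0 := by positivity
    have : sensSlope β γ = fun x => 1 / (β * x + 1) - x / (x + γ) := rfl
    rw [this]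
    fun_prop (disch := assumption)
  exact h1.sub (ContinuousAt.comp h2 hfc)

theorem twoStepSlope_eq (hβ : 0 ≤ β) (hγ : 0 < γ) (hβγ : β * γ < 1) {d : ℕ} (hd : 1 ≤ d) {x : ℝ}
    (hx : 0 < x) : d * sens β γ x * twoStepSlope β γ lam d x =
      sensSlope β γ x - d * sens β γ x * sensSlope β γ (treeRecursion β γ lam d x) := by
  have p0 : 0 < 1 - β * γ := by linarith
  have p1 : 0 < β * x + 1 := by positivity
  have p2 : 0 < x + γ := by positivity
  have p3 : (0 : ℝ) < d := by exact_mod_cast hd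
  have key : sensSlope β γ x = d * sens β γ x * ((γ / x - β * x) / (d * (1 - β * γ))) := by
    simp only [sens, sensSlope]
    field_simp
    ring
  unfold twoStepSlope
  rw [mul_sub, ← key]

/-- The product of the decay rates at `x` and at `f_d x` is at most the decay rate at the fixed
point. The maximum over `x` is attained at a critical point, which lies to the right or to the left
of the fixed point according to the sign of `sensSlope` there; at the critical point one of the two
decay rates is a quotient of slopes. -/
theorem twoStep_le_fixedPoint (hβ : 0 ≤ β) (hγ : 0 < γ) (hβγ : β * γ < 1) (hlam : 0 < lam) {d : ℕ}
    (hd : 1 ≤ d) {p : ℝ} (hp : 0 < p) (hfix : treeRecursion β γ lam d p = p)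
    (hlt : d * sens β γ p < 1) {x : ℝ} (hx : 0 < x) :
    (d * sens β γ x) * (d * sens β γ (treeRecursion β γ lam d x)) ≤ d * sens β γ p := by
  have hd0 : (0 : ℝ) < d := by exact_mod_cast hd
  have p0 : 0 < 1 - β * γ := by linarith
  have hsp := sens_pos hβ hγ hβγ hp
  have hgp : 0 < d * sens β γ p := by positivity
  have hKp := twoStepSlope_eq (lam := lam) hβ hγ hβγ hd hp
  rw [hfix] at hKp
  suffices h : ∃ z, 0 < z ∧ twoStepSlope β γ lam d z = 0 ∧
      (d * sens β γ z) * (d * sens β γ (treeRecursion β γ lam d z)) ≤ d * sens β γ p by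
    obtain ⟨z, hz, h0, hle⟩ := h
    have := twoStep_le_of_slope_eq_zero hβ hγ hβγ hlam hd hz hx h0
    have h3 := mul_le_mul_of_nonneg_left this (by positivity : (0:ℝ) ≤ d * d)
    nlinarith
  have hcont : ∀ a b : ℝ, 0 < a → ContinuousOn (twoStepSlope β γ lam d) (Set.Icc a b) :=
    fun a b ha u hu =>
      (continuousAt_twoStepSlope hβ hγ hlam d (ha.trans_le hu.1)).continuousWithinAt
  rcases lt_trichotomy (sensSlope β γ p) 0 with hG | hG | hG
  · -- the critical point lies between the zero of `sensSlope` and the fixed point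
    have hKneg : twoStepSlope β γ lam d p ≤ 0 := by
      by_contra hcon
      push Not at hcon
      have : 0 < d * sens β γ p * twoStepSlope β γ lam d p := by positivity
      nlinarith
    have hβ' : 0 < β := by
      rcases hβ.eq_or_lt with h | h
      · subst h
        have : sensSlope 0 γ p = γ / (p + γ) := by
          unfold sensSlope; field_simp; ring
        rw [this] at hG
        have : 0 < γ / (p + γ) := by positivity
        linarith
      · exact h
    set r := √(γ / β) with hr
    have hr0 : 0 < r := Real.sqrt_pos.2 (by positivity)
    have hr2 : β * r ^ 2 = γ := by rw [hr, Real.sq_sqrt (by positivity)]; field_simp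
    have hGr : sensSlope β γ r = 0 := by
      have e1 : 0 < β * r + 1 := by positivity
      have e2 : 0 < r + γ := by positivity
      unfold sensSlope; field_simp; linarith
    have hrp : r ≤ p := by
      by_contra hcon
      push Not at hcon
      have := sensSlope_antitoneOn hβ hγ hp.le hcon.le
      linarith
    have hKr : 0 ≤ twoStepSlope β γ lam d r := by
      have h1 := twoStepSlope_eq (lam := lam) hβ hγ hβγ hd hr0
      have h2 := treeRecursion_antitoneOn hβ hγ hβγ hlam d hr0.le hrp
      rw [hfix] at h2
      have h3 := sensSlope_antitoneOn hβ hγ hp.le h2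
      have h4 := sens_pos hβ hγ hβγ hr0
      by_contra hcon
      push Not at hcon
      have h5 : 0 < d * sens β γ r := by positivity
      nlinarith [mul_pos h5 (neg_pos.2 hcon), mul_pos h5 (neg_pos.2 (h3.trans_lt hG))]
    obtain ⟨z, hzm, hz0⟩ := intermediate_value_Icc' hrp (hcont r p hr0) ⟨hKneg, hKr⟩
    have hz : 0 < z := hr0.trans_le hzm.1
    refine ⟨z, hz, hz0, ?_⟩
    have hKz := twoStepSlope_eq (lam := lam) hβ hγ hβγ hd hz
    rw [hz0, mul_zero] at hKz
    set y := treeRecursion β γ lam d z with hy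
    have hpy : p ≤ y := by
      have := treeRecursion_antitoneOn hβ hγ hβγ hlam d hz.le hzm.2
      rwa [hfix] at this
    have h1 := sensSlope_antitoneOn hβ hγ hp.le hpy
    have h2 := sensSlope_antitoneOn hβ hγ hz.le hzm.2
    have h3 := sensSlope_mul_sens_le hβ hγ hβγ hp hpy
    have hsy := sens_pos hβ hγ hβγ (hp.trans_le hpy)
    have hsz := sens_pos hβ hγ hβγ hz
    have hGy : 0 < -sensSlope β γ y := by linarith
    -- `sens z * sens y * (-G y) = (-G z) * sens y ≤ (-G p) * sens y ≤ (-G y) * sens p`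
    have h4 : (d * sens β γ z) * sens β γ y * (-sensSlope β γ y) ≤
        sens β γ p * (-sensSlope β γ y) := by
      have : sensSlope β γ z = d * sens β γ z * sensSlope β γ y := by linarith
      nlinarith [mul_le_mul_of_nonneg_right h2 hsy.le]
    have h5 := le_of_mul_le_mul_right h4 hGy
    nlinarith
  · refine ⟨p, hp, ?_, ?_⟩
    · rw [hG] at hKp
      have : d * sens β γ p * twoStepSlope β γ lam d p = 0 := by rw [hKp]; ring
      exact (mul_eq_zero.1 this).resolve_left hgp.ne'
    · rw [hfix]; nlinarith
  · have hKpos : 0 ≤ twoStepSlope β γ lam d p := by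
      by_contra hcon
      push Not at hcon
      have : 0 < d * sens β γ p * (-twoStepSlope β γ lam d p) := mul_pos hgp (by linarith)
      nlinarith
    -- far to the right the first term of the slope is smaller than `sensSlope p`
    set r := max p (γ / (d * (1 - β * γ) * sensSlope β γ p)) with hr
    have hpr : p ≤ r := le_max_left _ _
    have hr0 : 0 < r := hp.trans_le hpr
    have hKr : twoStepSlope β γ lam d r ≤ 0 := by
      have h2 := treeRecursion_antitoneOn hβ hγ hβγ hlam d hp.le hpr
      rw [hfix] at h2
      have h3 := sensSlope_antitoneOn hβ hγ (treeRecursion_pos hβ hγ hlam d hr0.le).le h2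
      have h4 : γ / (d * (1 - β * γ) * sensSlope β γ p) ≤ r := le_max_right _ _
      have h5 : (γ / r - β * r) / (d * (1 - β * γ)) ≤ sensSlope β γ p := by
        rw [div_le_iff₀ (by positivity)] at h4 ⊢
        have : γ / r ≤ sensSlope β γ p * (d * (1 - β * γ)) := by
          rw [div_le_iff₀ hr0]; linarith
        have : 0 ≤ β * r := by positivity
        linarith
      unfold twoStepSlope; linarith
    obtain ⟨z, hzm, hz0⟩ := intermediate_value_Icc' hpr (hcont p r hp) ⟨hKr, hKpos⟩
    have hz : 0 < z := hp.trans_le hzm.1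
    refine ⟨z, hz, hz0, ?_⟩
    have hKz := twoStepSlope_eq (lam := lam) hβ hγ hβγ hd hz
    rw [hz0, mul_zero] at hKz
    have hy0 := treeRecursion_pos hβ hγ hlam d hz.le
    have hpy : treeRecursion β γ lam d z ≤ p := by
      have := treeRecursion_antitoneOn hβ hγ hβγ hlam d hp.le hzm.1
      rwa [hfix] at this
    set y := treeRecursion β γ lam d z with hy
    have h1 := sensSlope_antitoneOn hβ hγ hy0.le hpy
    have h2 := sensSlope_antitoneOn hβ hγ hp.le hzm.1
    have h3 := sensSlope_mul_sens_le hβ hγ hβγ hy0 hpy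
    have hsy := sens_pos hβ hγ hβγ hy0
    have hsz := sens_pos hβ hγ hβγ hz
    have hGy : 0 < sensSlope β γ y := by linarith
    have h4 : (d * sens β γ z) * sens β γ y * sensSlope β γ y ≤
        sens β γ p * sensSlope β γ y := by
      have : sensSlope β γ z = d * sens β γ z * sensSlope β γ y := by linarith
      nlinarith [mul_le_mul_of_nonneg_right h2 hsy.le]
    have h5 := le_of_mul_le_mul_right h4 hGy
    nlinarith

end TwoSpin

namespace TwoSpin
variable {β γ lam : ℝ}

/-! ### The decay rate of the recursion with several children -/

/-- The sensitivity as a function of the edge factor instead of the ratio. -/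
noncomputable def factorSens (β γ y : ℝ) : ℝ := (1 - γ * y) * (y - β) / ((1 - β * γ) * y)

theorem factorSens_edgeFactor (hβ : 0 ≤ β) (hγ : 0 < γ) (hβγ : β * γ < 1) {x : ℝ} (hx : 0 ≤ x) :
    factorSens β γ (edgeFactor β γ x) = sens β γ x := by
  have p0 : 0 < 1 - β * γ := by linarith
  have p1 : 0 < β * x + 1 := by positivity
  have p2 : 0 < x + γ := by positivity
  have e1 : 1 - γ * edgeFactor β γ x = (1 - β * γ) * x / (x + γ) := by
    unfold edgeFactor; field_simp; ring
  have e2 : edgeFactor β γ x - β = (1 - β * γ) / (x + γ) := by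
    unfold edgeFactor; field_simp; ring
  unfold factorSens
  rw [e1, e2]
  unfold edgeFactor sens
  field_simp

theorem factorSens_nonneg (hβγ : β * γ < 1) (hγ : 0 < γ) {y : ℝ} (hy : 0 < y) (h1 : β ≤ y)
    (h2 : y ≤ 1 / γ) : 0 ≤ factorSens β γ y := by
  have p0 : 0 < 1 - β * γ := by linarith
  rw [le_div_iff₀ hγ] at h2
  have : 0 ≤ 1 - γ * y := by linarith
  have : 0 ≤ y - β := by linarith
  unfold factorSens; positivity

theorem factorSens_le_one (hβ : 0 ≤ β) (hβγ : β * γ < 1) (hγ : 0 < γ) {y : ℝ} (hy : 0 < y)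
    (h1 : β ≤ y) : factorSens β γ y ≤ 1 := by
  have p0 : 0 < 1 - β * γ := by linarith
  unfold factorSens
  rw [div_le_one (by positivity)]
  apply mul_le_mul <;> nlinarith

/-- The sensitivity is a concave function of the logarithm of the edge factor; this is Jensen's
inequality with equal weights. -/
theorem exists_sum_factorSens_le (hβ : 0 ≤ β) (hγ : 0 < γ) (hβγ : β * γ < 1) {ι : Type*}
    (s : Finset ι) (hs : 1 ≤ s.card) (y : ι → ℝ) (hy : ∀ i ∈ s, 0 < y i) :
    ∃ Y : ℝ, 0 < Y ∧ Y ^ s.card = ∏ i ∈ s, y i ∧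
      ∑ i ∈ s, factorSens β γ (y i) ≤ s.card * factorSens β γ Y := by
  have p0 : 0 < 1 - β * γ := by linarith
  have hd : (0 : ℝ) < s.card := by exact_mod_cast hs
  set T := (∑ i ∈ s, Real.log (y i)) / s.card with hT
  have hTs : ∑ i ∈ s, (Real.log (y i) - T) = 0 := by
    rw [Finset.sum_sub_distrib, Finset.sum_const, nsmul_eq_mul, hT]
    field_simp
    ring
  have form : ∀ z : ℝ, 0 < z →
      factorSens β γ z = (1 + β * γ - γ * z - β * z⁻¹) / (1 - β * γ) := by
    intro z hz; unfold factorSens; field_simp; ring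
  refine ⟨Real.exp T, Real.exp_pos T, ?_, ?_⟩
  · rw [← Real.exp_nat_mul, hT, mul_div_cancel₀ _ hd.ne', Real.exp_sum]
    exact Finset.prod_congr rfl fun i hi => Real.exp_log (hy i hi)
  · have tangent : ∀ i ∈ s, factorSens β γ (y i) ≤ factorSens β γ (Real.exp T) +
        (β * (Real.exp T)⁻¹ - γ * Real.exp T) / (1 - β * γ) * (Real.log (y i) - T) := by
      intro i hi
      have h1 : Real.exp T * (Real.log (y i) - T + 1) ≤ y i := by
        have := Real.add_one_le_exp (Real.log (y i) - T)
        have h := mul_le_mul_of_nonneg_left this (Real.exp_pos T).le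
        rwa [← Real.exp_add, add_sub_cancel, Real.exp_log (hy i hi)] at h
      have h2 : (Real.exp T)⁻¹ * (-(Real.log (y i) - T) + 1) ≤ (y i)⁻¹ := by
        have := Real.add_one_le_exp (-(Real.log (y i) - T))
        have h := mul_le_mul_of_nonneg_left this (inv_pos.2 (Real.exp_pos T)).le
        rw [← Real.exp_neg T, ← Real.exp_add,
          show -T + -(Real.log (y i) - T) = -Real.log (y i) by ring,
          Real.exp_neg (Real.log (y i)), Real.exp_log (hy i hi)] at h
        rwa [← Real.exp_neg T]
      rw [form _ (hy i hi), form _ (Real.exp_pos T), div_mul_eq_mul_div, ← add_div]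
      apply div_le_div_of_nonneg_right _ p0.le
      nlinarith [mul_le_mul_of_nonneg_left h1 hγ.le, mul_le_mul_of_nonneg_left h2 hβ]
    calc _ ≤ ∑ i ∈ s, _ := Finset.sum_le_sum tangent
      _ = _ := by
        rw [Finset.sum_add_distrib, ← Finset.mul_sum, hTs, mul_zero, add_zero, Finset.sum_const,
          nsmul_eq_mul]

/-- The amortized decay rate with arbitrary children is bounded by its value at the fixed point of
the symmetric recursion. -/
theorem decayRate_sq_le (hβ : 0 ≤ β) (hγ : 0 < γ) (hβγ : β * γ < 1) (hlam : 0 < lam) {ι : Type*}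
    (s : Finset ι) (hs : 1 ≤ s.card) (y : ι → ℝ) (hy : ∀ i ∈ s, 0 < y i ∧ β ≤ y i ∧ y i ≤ 1 / γ)
    {p : ℝ} (hp : 0 < p) (hfix : treeRecursion β γ lam s.card p = p)
    (hlt : s.card * sens β γ p < 1) :
    (√(sens β γ (lam * ∏ i ∈ s, y i)) * ∑ i ∈ s, √(factorSens β γ (y i))) ^ 2 ≤
      s.card * sens β γ p := by
  have p0 : 0 < 1 - β * γ := by linarith
  have hd : (0 : ℝ) < s.card := by exact_mod_cast hs
  have hprod : 0 < ∏ i ∈ s, y i := Finset.prod_pos fun i hi => (hy i hi).1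
  have hS := sens_nonneg hβ hγ hβγ (by positivity : 0 ≤ lam * ∏ i ∈ s, y i)
  obtain ⟨Y, hY, hYp, hYs⟩ := exists_sum_factorSens_le hβ hγ hβγ s hs y fun i hi => (hy i hi).1
  have hcs : (∑ i ∈ s, √(factorSens β γ (y i))) ^ 2 ≤ s.card * (s.card * factorSens β γ Y) := by
    refine (sq_sum_le_card_mul_sum_sq).trans (mul_le_mul_of_nonneg_left ?_ hd.le)
    refine le_trans (le_of_eq (Finset.sum_congr rfl fun i hi => ?_)) hYs
    exact Real.sq_sqrt (factorSens_nonneg hβγ hγ (hy i hi).1 (hy i hi).2.1 (hy i hi).2.2)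
  rw [mul_pow, Real.sq_sqrt hS]
  refine (mul_le_mul_of_nonneg_left hcs hS).trans ?_
  have hR : 0 ≤ s.card * sens β γ p := mul_nonneg hd.le (sens_nonneg hβ hγ hβγ hp.le)
  rcases le_or_gt (factorSens β γ Y) 0 with hneg | hpos
  · refine le_trans (mul_nonpos_of_nonneg_of_nonpos hS ?_) hR
    exact mul_nonpos_of_nonneg_of_nonpos hd.le (mul_nonpos_of_nonneg_of_nonpos hd.le hneg)
  · have hnum : 0 < (1 - γ * Y) * (Y - β) := by
      unfold factorSens at hpos
      by_contra hcon
      push Not at hcon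
      exact absurd (div_nonpos_of_nonpos_of_nonneg hcon (by positivity)) (not_le.2 hpos)
    have h12 : 0 < 1 - γ * Y ∧ 0 < Y - β := by
      rcases pos_and_pos_or_neg_and_neg_of_mul_pos hnum with h | ⟨h1, h2⟩
      · exact h
      · nlinarith
    set x := (1 - γ * Y) / (Y - β) with hx
    have hx0 : 0 < x := div_pos h12.1 h12.2
    have hYx : edgeFactor β γ x = Y := by
      have e := h12.2.ne'
      have e1 : β * x + 1 = (1 - β * γ) * Y / (Y - β) := by rw [hx]; field_simp; ring
      have e2 : x + γ = (1 - β * γ) / (Y - β) := by rw [hx]; field_simp; ring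
      unfold edgeFactor
      rw [e1, e2]
      field_simp
    have h := twoStep_le_fixedPoint hβ hγ hβγ hlam hs hp hfix hlt hx0
    have hf : treeRecursion β γ lam s.card x = lam * ∏ i ∈ s, y i := by
      rw [← hYp, ← hYx]; rfl
    rw [hf, ← factorSens_edgeFactor hβ hγ hβγ hx0.le, hYx] at h
    calc _ = _ := by ring
      _ ≤ _ := h

theorem sens_le_div (hβ : 0 ≤ β) (hγ : 0 < γ) {x : ℝ} (hx : 0 ≤ x) :
    sens β γ x ≤ x / γ := by
  unfold sens
  rw [div_le_div_iff₀ (by positivity) hγ]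
  have h1 : 0 ≤ β * γ * γ * x := by positivity
  have h2 : 0 ≤ β * x * x * x := by positivity
  have h3 : 0 ≤ β * x * x * γ := by positivity
  nlinarith [mul_nonneg hx hx]

/-- A decay rate for nodes with many children, useful when `γ > 1`. -/
theorem decayRate_le_of_card (hβ : 0 ≤ β) (hγ : 0 < γ) (hβγ : β * γ < 1) (hlam : 0 < lam)
    {ι : Type*} (s : Finset ι) (y : ι → ℝ) (hy : ∀ i ∈ s, 0 < y i ∧ β ≤ y i ∧ y i ≤ 1 / γ) :
    √(sens β γ (lam * ∏ i ∈ s, y i)) * ∑ i ∈ s, √(factorSens β γ (y i)) ≤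
      √(lam / γ) * √(1 / γ) ^ s.card * s.card := by
  have hprod : 0 < ∏ i ∈ s, y i := Finset.prod_pos fun i hi => (hy i hi).1
  have h1 : ∏ i ∈ s, y i ≤ (1 / γ) ^ s.card := by
    rw [← Finset.prod_const]
    exact Finset.prod_le_prod (fun i hi => (hy i hi).1.le) fun i hi => (hy i hi).2.2
  have h2 : √(sens β γ (lam * ∏ i ∈ s, y i)) ≤ √(lam / γ) * √(1 / γ) ^ s.card := by
    rw [Real.sqrt_le_left (by positivity)]
    rw [mul_pow, ← pow_mul, mul_comm s.card 2, pow_mul, Real.sq_sqrt (by positivity),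
      Real.sq_sqrt (by positivity)]
    refine (sens_le_div hβ hγ (by positivity)).trans ?_
    rw [div_mul_eq_mul_div]
    gcongr
  have h3 : ∑ i ∈ s, √(factorSens β γ (y i)) ≤ s.card := by
    calc _ ≤ ∑ i ∈ s, (1 : ℝ) := Finset.sum_le_sum fun i hi => by
          rw [Real.sqrt_le_one]
          exact factorSens_le_one hβ hβγ hγ (hy i hi).1 (hy i hi).2.1
      _ = _ := by simp
  exact mul_le_mul h2 h3 (Finset.sum_nonneg fun i _ => Real.sqrt_nonneg _) (by positivity)

/-- Uniqueness for all degrees forces `1 < γ`: otherwise the fixed points `x_d` satisfy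
`x_d = O(1 / d)` by uniqueness, and then `x_d = lam * h(x_d) ^ d` is bounded away from zero. -/
theorem one_lt_of_interiorUnique (hβ : 0 ≤ β) (hγ : 0 < γ) (hle : β ≤ γ) (hβγ : β * γ < 1)
    (hlam : 0 < lam) (h : ∀ d : ℕ, 1 ≤ d → InteriorUnique β γ lam d) : 1 < γ := by
  by_contra hcon
  push Not at hcon
  have p0 : 0 < 1 - β * γ := by linarith
  have hβ1 : β < 1 := by
    by_contra h1
    push Not at h1
    nlinarith
  set x1 := (1 - γ) / (1 - β) with hx1
  have hx10 : 0 ≤ x1 := div_nonneg (by linarith) (by linarith)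
  set B := max x1 lam with hB
  have hB0 : 0 < B := hlam.trans_le (le_max_right _ _)
  set C := (B + 1) ^ 2 / (1 - β * γ) with hC
  have hC0 : 0 < C := by positivity
  obtain ⟨d, hd⟩ := exists_nat_gt (C / (lam * Real.exp (-C)) + 1)
  have hd1 : (1 : ℝ) < d := by
    have : 0 < C / (lam * Real.exp (-C)) := by positivity
    linarith
  have hd0 : (0 : ℝ) < d := by linarith
  obtain ⟨x, hx, hfix, hlt⟩ := exists_fixedPoint_of_interiorUnique hβ hγ hβγ
    (h d (by exact_mod_cast hd1.le))
  have hxB : x ≤ B := by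
    by_contra hxB
    push Not at hxB
    have h1 : x1 < x := (le_max_left _ _).trans_lt hxB
    have h2 : lam < x := (le_max_right _ _).trans_lt hxB
    have h3 : edgeFactor β γ x ≤ 1 := by
      unfold edgeFactor
      rw [div_le_one (by positivity)]
      rw [hx1, div_lt_iff₀ (by linarith)] at h1
      linarith
    have h4 : edgeFactor β γ x ^ d ≤ 1 := pow_le_one₀ (edgeFactor_pos hβ hγ hx.le).le h3
    have h5 : treeRecursion β γ lam d x ≤ lam := by
      have := mul_le_mul_of_nonneg_left h4 hlam.le
      rw [mul_one] at this
      exact this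
    linarith
  have hxd : d * x ≤ C := by
    have e : d * sens β γ x = d * x * (1 - β * γ) / ((β * x + 1) * (x + γ)) := by
      unfold sens; ring
    rw [e, div_lt_one (by positivity)] at hlt
    rw [hC, le_div_iff₀ p0]
    refine hlt.le.trans ?_
    rw [sq]
    apply mul_le_mul <;> nlinarith
  have hexp : Real.exp (-x) ≤ edgeFactor β γ x := by
    unfold edgeFactor
    rw [Real.exp_neg, inv_le_comm₀ (Real.exp_pos x) (by positivity), inv_div]
    refine le_trans ?_ (Real.add_one_le_exp x)
    rw [div_le_iff₀ (by positivity)]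
    nlinarith [mul_nonneg hβ hx.le, mul_nonneg (mul_nonneg hβ hx.le) hx.le]
  have hlow : lam * Real.exp (-C) ≤ x := by
    conv_rhs => rw [← hfix]
    unfold treeRecursion
    apply mul_le_mul_of_nonneg_left _ hlam.le
    calc Real.exp (-C) ≤ Real.exp (-(d * x)) := Real.exp_le_exp.2 (by linarith)
      _ = Real.exp (-x) ^ d := by rw [← Real.exp_nat_mul]; ring_nf
      _ ≤ _ := pow_le_pow_left₀ (Real.exp_pos _).le hexp d
  have hpos : 0 < lam * Real.exp (-C) := by positivity
  have : d * (lam * Real.exp (-C)) ≤ C := (mul_le_mul_of_nonneg_left hlow hd0.le).trans hxd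
  rw [← lt_sub_iff_add_lt, div_lt_iff₀ hpos] at hd
  nlinarith

/-- One exponent `k` for which the decay rate `a` at every node with `d` children beats the
shrinking of the budget: `a ^ k * (d + 3) ≤ 1`. -/
theorem exists_decay_exponent {Δ : ℕ∞} (hanti : AntiFerromagnetic β γ lam)
    (huniq : UpToUnique β γ lam Δ) :
    ∃ k : ℕ, 1 ≤ k ∧ ∀ d : ℕ, 1 ≤ d → (d : ℕ∞) < Δ → ∃ a : ℝ, 0 ≤ a ∧ a ≤ 1 ∧
      a ^ k * (d + 3) ≤ 1 ∧ ∀ {ι : Type} (s : Finset ι) (y : ι → ℝ), s.card = d →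
        (∀ i ∈ s, 0 < y i ∧ β ≤ y i ∧ y i ≤ 1 / γ) →
        √(sens β γ (lam * ∏ i ∈ s, y i)) * ∑ i ∈ s, √(factorSens β γ (y i)) ≤ a := by
  obtain ⟨hβ, hle, hγ, hβγ, hlam⟩ := hanti
  have small : ∀ d : ℕ, 1 ≤ d → (d : ℕ∞) < Δ → ∃ k : ℕ, ∃ a : ℝ, 0 ≤ a ∧ a ≤ 1 ∧
      a ^ k * (d + 3) ≤ 1 ∧ ∀ {ι : Type} (s : Finset ι) (y : ι → ℝ), s.card = d →
        (∀ i ∈ s, 0 < y i ∧ β ≤ y i ∧ y i ≤ 1 / γ) →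
        √(sens β γ (lam * ∏ i ∈ s, y i)) * ∑ i ∈ s, √(factorSens β γ (y i)) ≤ a := by
    intro d hd hdΔ
    obtain ⟨p, hp, hfix, hlt⟩ := exists_fixedPoint_of_interiorUnique hβ hγ hβγ (huniq d hd hdΔ)
    have ha1 : √(d * sens β γ p) < 1 := by
      rw [Real.sqrt_lt' one_pos]; linarith
    obtain ⟨k, hk⟩ := exists_pow_lt_of_lt_one (by positivity : (0 : ℝ) < 1 / (d + 3)) ha1
    refine ⟨k, _, Real.sqrt_nonneg _, ha1.le, ?_, ?_⟩
    · rw [lt_div_iff₀ (by positivity)] at hk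
      exact hk.le
    · intro ι s y hs hy
      subst hs
      exact Real.le_sqrt_of_sq_le (decayRate_sq_le hβ hγ hβγ hlam s hd y hy hp hfix hlt)
  have large : ∃ D : ℕ, ∀ d : ℕ, D ≤ d → (d : ℕ∞) < Δ → ∃ a : ℝ, 0 ≤ a ∧ a ≤ 1 ∧
      a ^ 1 * (d + 3) ≤ 1 ∧ ∀ {ι : Type} (s : Finset ι) (y : ι → ℝ), s.card = d →
        (∀ i ∈ s, 0 < y i ∧ β ≤ y i ∧ y i ≤ 1 / γ) →
        √(sens β γ (lam * ∏ i ∈ s, y i)) * ∑ i ∈ s, √(factorSens β γ (y i)) ≤ a := by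
    rcases eq_or_ne Δ ⊤ with rfl | hΔ
    · have hγ1 := one_lt_of_interiorUnique hβ hγ hle hβγ hlam
        fun d hd => huniq d hd (WithTop.coe_lt_top d)
      set r := √(1 / γ) with hr
      have hr0 : 0 ≤ r := Real.sqrt_nonneg _
      have hr1 : |r| < 1 := by
        rw [abs_of_nonneg hr0, hr, Real.sqrt_lt' one_pos, one_pow, div_lt_one hγ]
        exact hγ1
      have t2 := tendsto_pow_const_mul_const_pow_of_abs_lt_one 2 hr1
      have t1 := tendsto_pow_const_mul_const_pow_of_abs_lt_one 1 hr1
      have t : Filter.Tendsto (fun d : ℕ => √(lam / γ) * r ^ d * d * (d + 3)) Filter.atTop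
          (nhds 0) := by
        have := (t2.add (t1.const_mul 3)).const_mul √(lam / γ)
        simp only [mul_zero, add_zero] at this
        refine this.congr fun d => ?_
        ring
      obtain ⟨D, hD⟩ := Filter.eventually_atTop.1 (t.eventually (gt_mem_nhds one_pos))
      refine ⟨D, fun d hd _ => ⟨√(lam / γ) * r ^ d * d, by positivity, ?_, ?_, ?_⟩⟩
      · have h := (hD d hd).le
        have h0 : 0 ≤ √(lam / γ) * r ^ d * d := by positivity
        have hd0 : (0 : ℝ) ≤ d := by positivity
        nlinarith
      · rw [pow_one]; exact (hD d hd).le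
      · intro ι s y hs hy
        subst hs
        exact decayRate_le_of_card hβ hγ hβγ hlam s y hy
    · lift Δ to ℕ using hΔ
      exact ⟨Δ, fun d hd hlt => absurd hlt (not_lt.2 (by exact_mod_cast hd))⟩
  obtain ⟨D, hD⟩ := large
  choose! K hK using small
  refine ⟨1 + ∑ d ∈ Finset.range D, K d, by omega, fun d hd hdΔ => ?_⟩
  have lift_exp : ∀ {j k : ℕ} {a : ℝ}, j ≤ k → 0 ≤ a → a ≤ 1 → a ^ j * ((d : ℝ) + 3) ≤ 1 →
      a ^ k * ((d : ℝ) + 3) ≤ 1 := fun hjk h0 h1 h =>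
    le_trans (mul_le_mul_of_nonneg_right (pow_le_pow_of_le_one h0 h1 hjk) (by positivity)) h
  rcases lt_or_ge d D with h | h
  · obtain ⟨a, h0, h1, h2, h3⟩ := hK d hd hdΔ
    refine ⟨a, h0, h1, lift_exp ?_ h0 h1 h2, h3⟩
    have := Finset.single_le_sum (f := K) (fun i _ => Nat.zero_le _) (Finset.mem_range.2 h)
    omega
  · obtain ⟨a, h0, h1, h2, h3⟩ := hD d h hdΔ
    exact ⟨a, h0, h1, lift_exp (by omega) h0 h1 h2, h3⟩

/-- The ratios that occur are bounded uniformly in the graph. -/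
theorem exists_ratio_bound {Δ : ℕ∞} (hanti : AntiFerromagnetic β γ lam)
    (huniq : UpToUnique β γ lam Δ) :
    ∃ B : ℝ, 0 < B ∧ ∀ d : ℕ, (d : ℕ∞) ≤ Δ → lam * (max 1 (1 / γ)) ^ d ≤ B := by
  obtain ⟨hβ, hle, hγ, hβγ, hlam⟩ := hanti
  rcases eq_or_ne Δ ⊤ with rfl | hΔ
  · have hγ1 := one_lt_of_interiorUnique hβ hγ hle hβγ hlam
      fun d hd => huniq d hd (WithTop.coe_lt_top d)
    refine ⟨lam, hlam, fun d _ => ?_⟩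
    rw [max_eq_left (by rw [div_le_one hγ]; exact hγ1.le)]
    simp
  · lift Δ to ℕ using hΔ
    refine ⟨lam * (max 1 (1 / γ)) ^ Δ, by positivity, fun d hd => ?_⟩
    have hd' : d ≤ Δ := by exact_mod_cast hd
    gcongr
    exact le_max_left _ _

end TwoSpin

namespace TwoSpin
variable {β γ lam : ℝ}

/-! ### The potential function and the contraction of the recursion -/

/-- The derivative of `rootPotential`. -/
noncomputable def potentialDensity (β γ v : ℝ) : ℝ := 1 / √((β * v ^ 2 + 1) * (v ^ 2 + γ))

/-- The potential as a function of the square root of the ratio. In this coordinate it is smooth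
and strictly increasing on the whole line, so that the ratio `0` needs no special treatment. -/
noncomputable def rootPotential (β γ u : ℝ) : ℝ := ∫ v in (0 : ℝ)..u, potentialDensity β γ v

/-- The potential of a ratio `x`, up to a factor the integral of `1 / √(x (β x + 1) (x + γ))`. -/
noncomputable def potential (β γ x : ℝ) : ℝ := rootPotential β γ √x

theorem potentialDensity_pos (hβ : 0 ≤ β) (hγ : 0 < γ) (v : ℝ) : 0 < potentialDensity β γ v := by
  unfold potentialDensity; positivity

theorem continuous_potentialDensity (hβ : 0 ≤ β) (hγ : 0 < γ) :
    Continuous (potentialDensity β γ) := by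
  have h : ∀ v : ℝ, √((β * v ^ 2 + 1) * (v ^ 2 + γ)) ≠ 0 := fun v => by positivity
  have : potentialDensity β γ = fun v => 1 / √((β * v ^ 2 + 1) * (v ^ 2 + γ)) := rfl
  rw [this]
  fun_prop (disch := assumption)

theorem hasStrictDerivAt_rootPotential (hβ : 0 ≤ β) (hγ : 0 < γ) (u : ℝ) :
    HasStrictDerivAt (rootPotential β γ) (potentialDensity β γ u) u :=
  (continuous_potentialDensity hβ hγ).integral_hasStrictDerivAt 0 u

theorem strictMono_rootPotential (hβ : 0 ≤ β) (hγ : 0 < γ) : StrictMono (rootPotential β γ) := by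
  refine strictMono_of_deriv_pos fun u => ?_
  rw [(hasStrictDerivAt_rootPotential hβ hγ u).hasDerivAt.deriv]
  exact potentialDensity_pos hβ hγ u

theorem sqrt_sens_sq (hβγ : β * γ < 1) (u : ℝ) :
    √(sens β γ (u ^ 2)) = √(1 - β * γ) * |u| * potentialDensity β γ u := by
  have p0 : 0 < 1 - β * γ := by linarith
  unfold sens potentialDensity
  rw [Real.sqrt_div (by positivity), Real.sqrt_mul p0.le, Real.sqrt_sq_eq_abs]
  ring

/-- Along a curve on which the potential of every child changes at a constant rate, the potential
of the parent changes at most `a` times as fast, `a` being a bound for the amortized decay rate. -/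
theorem potential_contraction (hβ : 0 ≤ β) (hγ : 0 < γ) (hβγ : β * γ < 1) {ι : Type*}
    (s : Finset ι) {w a e : ℝ} (hw : 0 ≤ w) (ha : 0 ≤ a)
    (hdecay : 0 < w → ∀ x : ι → ℝ, (∀ i ∈ s, 0 ≤ x i) →
      √(sens β γ (w * ∏ i ∈ s, edgeFactor β γ (x i))) * ∑ i ∈ s, √(sens β γ (x i)) ≤ a)
    (x y : ι → ℝ) (hx : ∀ i ∈ s, 0 ≤ x i) (hy : ∀ i ∈ s, 0 ≤ y i) (he : 0 ≤ e)
    (hxy : ∀ i ∈ s, |potential β γ (y i) - potential β γ (x i)| ≤ e) :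
    |potential β γ (w * ∏ i ∈ s, edgeFactor β γ (y i)) -
      potential β γ (w * ∏ i ∈ s, edgeFactor β γ (x i))| ≤ a * e := by
  rcases hw.eq_or_lt with rfl | hw
  · simpa using mul_nonneg ha he
  have p0 : 0 < 1 - β * γ := by linarith
  set ψ := rootPotential β γ with hψ
  have hψd := hasStrictDerivAt_rootPotential hβ hγ
  have hψc : Continuous ψ :=
    continuous_iff_continuousAt.2 fun u => (hψd u).hasDerivAt.continuousAt
  set χ := Function.invFun ψ with hχ
  have hleft : ∀ u, χ (ψ u) = u := Function.leftInverse_invFun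
    (strictMono_rootPotential hβ hγ).injective
  -- the curve
  set c : ι → ℝ → ℝ := fun i t => potential β γ (x i) +
    t * (potential β γ (y i) - potential β γ (x i)) with hc
  set U : ι → ℝ → ℝ := fun i t => χ (c i t) with hU
  have hrange : ∀ i, ∀ t ∈ Set.Icc (0 : ℝ) 1, ∃ u, ψ u = c i t := by
    intro i t ht
    rcases le_total (potential β γ (x i)) (potential β γ (y i)) with h | h
    · refine mem_range_of_exists_le_of_exists_ge hψc ⟨√(x i), ?_⟩ ⟨√(y i), ?_⟩
      · change potential β γ (x i) ≤ _
        simp only [hc]; nlinarith [ht.1]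
      · change _ ≤ potential β γ (y i)
        simp only [hc]; nlinarith [ht.2]
    · refine mem_range_of_exists_le_of_exists_ge hψc ⟨√(y i), ?_⟩ ⟨√(x i), ?_⟩
      · change potential β γ (y i) ≤ _
        simp only [hc]; nlinarith [ht.2]
      · change _ ≤ potential β γ (x i)
        simp only [hc]; nlinarith [ht.1]
  have hUd : ∀ i, ∀ t ∈ Set.Icc (0 : ℝ) 1, HasDerivAt (U i)
      ((potential β γ (y i) - potential β γ (x i)) / potentialDensity β γ (U i t)) t := by
    intro i t ht
    obtain ⟨u, hu⟩ := hrange i t ht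
    have h1 : HasDerivAt χ (potentialDensity β γ u)⁻¹ (c i t) := by
      rw [← hu]
      exact ((hψd u).to_local_left_inverse (potentialDensity_pos hβ hγ u).ne'
        (Filter.Eventually.of_forall hleft)).hasDerivAt
    have h2 : HasDerivAt (c i) (potential β γ (y i) - potential β γ (x i)) t := by
      refine (((hasDerivAt_id t).mul_const
        (potential β γ (y i) - potential β γ (x i))).const_add
          (potential β γ (x i))).congr_deriv ?_
      ring
    have hUt : U i t = u := by simp only [hU]; rw [← hu, hleft]
    refine (h1.comp t h2).congr_deriv ?_
    rw [hUt]; ring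
  have hU0 : ∀ i ∈ s, U i 0 ^ 2 = x i := by
    intro i hi
    have : c i 0 = ψ √(x i) := by simp [hc, potential, hψ]
    simp only [hU, this, hleft]
    exact Real.sq_sqrt (hx i hi)
  have hU1 : ∀ i ∈ s, U i 1 ^ 2 = y i := by
    intro i hi
    have : c i 1 = ψ √(y i) := by simp [hc, potential, hψ]
    simp only [hU, this, hleft]
    exact Real.sq_sqrt (hy i hi)
  -- the parent, as the exponential of half the logarithm of the ratio
  set E : ℝ → ℝ := fun t => Real.exp ((Real.log w +
    ∑ i ∈ s, Real.log (edgeFactor β γ (U i t ^ 2))) / 2) with hE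
  have hEsq : ∀ t, E t ^ 2 = w * ∏ i ∈ s, edgeFactor β γ (U i t ^ 2) := by
    intro t
    have : ∀ i ∈ s, edgeFactor β γ (U i t ^ 2) ≠ 0 := fun i _ =>
      (edgeFactor_pos hβ hγ (sq_nonneg _)).ne'
    rw [hE, ← Real.exp_nat_mul]
    push_cast
    rw [mul_div_cancel₀ _ (two_ne_zero), Real.exp_add, Real.exp_log hw,
      ← Real.log_prod this,
      Real.exp_log (Finset.prod_pos fun i _ => edgeFactor_pos hβ hγ (sq_nonneg _))]
  have hEpos : ∀ t, 0 < E t := fun t => Real.exp_pos _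
  have hpot : ∀ t, potential β γ (w * ∏ i ∈ s, edgeFactor β γ (U i t ^ 2)) = ψ (E t) := by
    intro t
    rw [← hEsq, potential, Real.sqrt_sq (hEpos t).le]
  have hlog : ∀ i, ∀ t ∈ Set.Icc (0 : ℝ) 1,
      HasDerivAt (fun t => Real.log (edgeFactor β γ (U i t ^ 2)))
        (-(1 - β * γ) * (2 * U i t) * potentialDensity β γ (U i t) *
          (potential β γ (y i) - potential β γ (x i))) t := by
    intro i t ht
    have h1 : HasDerivAt (fun t => U i t ^ 2) _ t := (hUd i t ht).pow 2
    have h2 := hasDerivAt_edgeFactor (β := β) hγ (sq_nonneg (U i t))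
    have h2' : HasDerivAt (fun t => edgeFactor β γ (U i t ^ 2)) _ t :=
      HasDerivAt.comp (h₂ := edgeFactor β γ) t h2 h1
    have h3 := h2'.log (edgeFactor_pos hβ hγ (sq_nonneg (U i t))).ne'
    refine h3.congr_deriv ?_
    have q1 : 0 < β * U i t ^ 2 + 1 := by positivity
    have q2 : 0 < U i t ^ 2 + γ := by positivity
    have hk : potentialDensity β γ (U i t) ^ 2 = 1 / ((β * U i t ^ 2 + 1) * (U i t ^ 2 + γ)) := by
      unfold potentialDensity
      rw [div_pow, Real.sq_sqrt (by positivity), one_pow]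
    have hk0 := (potentialDensity_pos hβ hγ (U i t)).ne'
    simp only [edgeFactor]
    rw [div_eq_iff (by positivity)]
    have : -(1 - β * γ) * (2 * U i t) * potentialDensity β γ (U i t) *
        (potential β γ (y i) - potential β γ (x i)) =
        -(1 - β * γ) * (2 * U i t) * potentialDensity β γ (U i t) ^ 2 *
        ((potential β γ (y i) - potential β γ (x i)) / potentialDensity β γ (U i t)) := by
      field_simp
    rw [this, hk]
    push_cast
    field_simp
  set D : ℝ → ℝ := fun t => potentialDensity β γ (E t) * (E t * (∑ i ∈ s,
      (-(1 - β * γ) * (2 * U i t) * potentialDensity β γ (U i t) *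
          (potential β γ (y i) - potential β γ (x i))) / 2)) with hD
  have hder : ∀ t ∈ Set.Icc (0 : ℝ) 1, HasDerivAt (fun t => ψ (E t)) (D t) t := by
    intro t ht
    have h1 : HasDerivAt (fun t => ∑ i ∈ s, Real.log (edgeFactor β γ (U i t ^ 2)))
        (∑ i ∈ s, (-(1 - β * γ) * (2 * U i t) * potentialDensity β γ (U i t) *
          (potential β γ (y i) - potential β γ (x i)))) t :=
      HasDerivAt.fun_sum fun i _ => hlog i t ht
    have h2 : HasDerivAt E _ t := ((h1.const_add (Real.log w)).div_const 2).exp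
    refine (((hψd (E t)).hasDerivAt).comp t h2).congr_deriv ?_
    simp only [hD, ← Finset.sum_div]
    rfl
  have hbound : ∀ t ∈ Set.Ico (0 : ℝ) 1, ‖D t‖ ≤ a * e := by
    intro t ht
    have hdec := hdecay hw (fun i => U i t ^ 2) fun i _ => sq_nonneg _
    rw [← hEsq, sqrt_sens_sq hβγ, abs_of_pos (hEpos t)] at hdec
    have hk := potentialDensity_pos hβ hγ (E t)
    have hs : |∑ i ∈ s, (-(1 - β * γ) * (2 * U i t) * potentialDensity β γ (U i t) *
          (potential β γ (y i) - potential β γ (x i))) / 2| ≤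
        √(1 - β * γ) * (∑ i ∈ s, √(sens β γ (U i t ^ 2))) * e := by
      rw [Finset.mul_sum, Finset.sum_mul]
      refine (Finset.abs_sum_le_sum_abs _ _).trans (Finset.sum_le_sum fun i hi => ?_)
      have hki := potentialDensity_pos hβ hγ (U i t)
      have e1 : |(-(1 - β * γ) * (2 * U i t) * potentialDensity β γ (U i t) *
          (potential β γ (y i) - potential β γ (x i))) / 2| =
          √(1 - β * γ) * √(sens β γ (U i t ^ 2)) *
            |potential β γ (y i) - potential β γ (x i)| := by
        rw [sqrt_sens_sq hβγ, abs_div, abs_mul, abs_mul, abs_mul, abs_mul, abs_neg, abs_of_pos p0, abs_of_pos hki,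
          abs_of_pos (two_pos : (0 : ℝ) < 2)]
        conv_lhs => rw [← Real.mul_self_sqrt p0.le]
        ring
      rw [e1]
      exact mul_le_mul_of_nonneg_left (hxy i hi) (by positivity)
    rw [Real.norm_eq_abs, hD, abs_mul, abs_mul, abs_of_pos hk, abs_of_pos (hEpos t)]
    calc _ ≤ potentialDensity β γ (E t) *
          (E t * (√(1 - β * γ) * (∑ i ∈ s, √(sens β γ (U i t ^ 2))) * e)) := by
          gcongr
      _ = (√(1 - β * γ) * E t * potentialDensity β γ (E t) *
          ∑ i ∈ s, √(sens β γ (U i t ^ 2))) * e := by ring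
      _ ≤ a * e := mul_le_mul_of_nonneg_right hdec he
  have hmv := norm_image_sub_le_of_norm_deriv_le_segment_01' (f := fun t => ψ (E t)) (f' := D)
    (fun t ht => (hder t ht).hasDerivWithinAt) hbound
  simp only [← hpot, Real.norm_eq_abs] at hmv
  rw [Finset.prod_congr rfl fun i hi => by rw [hU1 i hi],
    Finset.prod_congr (s₁ := s) (f := fun i => edgeFactor β γ (U i 0 ^ 2)) rfl
      fun i hi => by rw [hU0 i hi]] at hmv
  exact hmv

theorem rootPotential_nonneg (hβ : 0 ≤ β) (hγ : 0 < γ) {u : ℝ} (hu : 0 ≤ u) :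
    0 ≤ rootPotential β γ u := by
  have := (strictMono_rootPotential hβ hγ).monotone hu
  simpa [rootPotential] using this

theorem potential_sub_le (hβ : 0 ≤ β) (hγ : 0 < γ) {B x y : ℝ} (hxB : x ≤ B) (hyB : y ≤ B) :
    |potential β γ y - potential β γ x| ≤ rootPotential β γ √B := by
  have hm := (strictMono_rootPotential hβ hγ).monotone
  have h1 := rootPotential_nonneg hβ hγ (Real.sqrt_nonneg x)
  have h2 := rootPotential_nonneg hβ hγ (Real.sqrt_nonneg y)
  have h3 := hm (Real.sqrt_le_sqrt hxB)
  have h4 := hm (Real.sqrt_le_sqrt hyB)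
  unfold potential
  rw [abs_le]
  constructor <;> linarith

/-- On a bounded interval the distance of two ratios is controlled by that of their potentials. -/
theorem exists_abs_sub_le_potential (hβ : 0 ≤ β) (hγ : 0 < γ) {B : ℝ} (hB : 0 < B) :
    ∃ C : ℝ, 0 < C ∧ ∀ x y : ℝ, 0 ≤ x → x ≤ B → 0 ≤ y → y ≤ B →
      |y - x| ≤ C * |potential β γ y - potential β γ x| := by
  have hkB := potentialDensity_pos hβ hγ √B
  set C := 2 * √B / potentialDensity β γ √B with hC
  have hC0 : 0 < C := by positivity
  refine ⟨C, hC0, ?_⟩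
  have hmono : MonotoneOn (fun u => C * rootPotential β γ u - u ^ 2) (Set.Icc 0 √B) := by
    have hd : ∀ u, HasDerivAt (fun u => C * rootPotential β γ u - u ^ 2)
        (C * potentialDensity β γ u - 2 * u) u := fun u => by
      refine (((hasStrictDerivAt_rootPotential hβ hγ u).hasDerivAt.const_mul C).sub
        ((hasDerivAt_id u).pow 2)).congr_deriv ?_
      simp
    refine monotoneOn_of_deriv_nonneg (convex_Icc _ _)
      (fun u _ => (hd u).continuousAt.continuousWithinAt)
      (fun u _ => (hd u).differentiableAt.differentiableWithinAt) fun u hu => ?_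
    rw [interior_Icc] at hu
    rw [(hd u).deriv]
    have h1 : potentialDensity β γ √B ≤ potentialDensity β γ u := by
      have := hu.1
      have := hu.2.le
      unfold potentialDensity
      gcongr
    have h2 : C * potentialDensity β γ √B = 2 * √B := by
      rw [hC]; field_simp
    have := mul_le_mul_of_nonneg_left h1 hC0.le
    linarith [hu.2]
  have key : ∀ x y : ℝ, 0 ≤ x → x ≤ y → y ≤ B →
      |y - x| ≤ C * |potential β γ y - potential β γ x| := by
    intro x y hx hxy hy
    have h := hmono (a := √x) (b := √y) ⟨Real.sqrt_nonneg _, Real.sqrt_le_sqrt (hxy.trans hy)⟩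
      ⟨Real.sqrt_nonneg _, Real.sqrt_le_sqrt hy⟩ (Real.sqrt_le_sqrt hxy)
    simp only [Real.sq_sqrt hx, Real.sq_sqrt (hx.trans hxy)] at h
    have h2 := (strictMono_rootPotential hβ hγ).monotone (Real.sqrt_le_sqrt hxy)
    rw [abs_of_nonneg (by linarith), abs_of_nonneg (by unfold potential; linarith)]
    unfold potential
    linarith
  intro x y hx hxB hy hyB
  rcases le_total x y with h | h
  · exact key x y hx h hyB
  · rw [abs_sub_comm y, abs_sub_comm (potential β γ y)]
    exact key y x hy h hxB

end TwoSpin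

namespace TwoSpin

/-! ### The partition function with vertex dependent fields -/

section Fields

variable {n : ℕ} (G : SimpleGraph (Fin n)) [DecidableRel G.Adj] {β γ lam : ℝ}

/-- The configuration in which exactly the vertices in `T` are blue. -/
def spinOf (T : Finset (Fin n)) (v : Fin n) : Fin 2 := if v ∈ T then 0 else 1

/-- The contribution of an edge to the weight of the configuration `spinOf T`. -/
noncomputable def edgeWeight (β γ : ℝ) (T : Finset (Fin n)) : Sym2 (Fin n) → ℝ :=
  Sym2.lift ⟨fun u v => edgeMatrix β γ (spinOf T u) (spinOf T v),
    fun _ _ => edgeMatrix_symm β γ _ _⟩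

/-- The edges with both end points in `S`. -/
def edgesIn (S : Finset (Fin n)) : Finset (Sym2 (Fin n)) := G.edgeFinset.filter (· ∈ S.sym2)

/-- The partition function of the graph induced on `S` in which the field at the vertex `u` is
`(w u, 1)`. -/
noncomputable def fieldZ (β γ : ℝ) (S : Finset (Fin n)) (w : Fin n → ℝ) : ℝ :=
  ∑ T ∈ S.powerset, (∏ u ∈ T, w u) * ∏ e ∈ edgesIn G S, edgeWeight β γ T e

theorem prod_edgesIn_insert (F : Sym2 (Fin n) → ℝ) {S : Finset (Fin n)} {v : Fin n} (hv : v ∉ S) :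
    ∏ e ∈ edgesIn G (insert v S), F e =
      (∏ e ∈ edgesIn G S, F e) * ∏ u ∈ S.filter (G.Adj v), F s(v, u) := by
  have hinj : Set.InjOn (fun u => s(v, u)) (S.filter (G.Adj v) : Finset (Fin n)) := by
    intro a _ b _ hab
    exact (Sym2.congr_right).1 hab
  rw [← Finset.prod_image hinj, ← Finset.prod_union]
  · congr 1
    ext e
    induction e using Sym2.ind with
    | _ a b =>
      simp only [edgesIn, Finset.mem_filter, SimpleGraph.mem_edgeFinset, SimpleGraph.mem_edgeSet,
        Finset.mk_mem_sym2_iff, Finset.mem_insert, Finset.mem_union, Finset.mem_image,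
        Sym2.eq_iff]
      constructor
      · rintro ⟨hab, ha, hb⟩
        rcases ha with rfl | ha <;> rcases hb with rfl | hb
        · exact absurd hab (G.loopless.irrefl _)
        · exact Or.inr ⟨b, ⟨hb, hab⟩, Or.inl ⟨rfl, rfl⟩⟩
        · exact Or.inr ⟨a, ⟨ha, hab.symm⟩, Or.inr ⟨rfl, rfl⟩⟩
        · exact Or.inl ⟨hab, ha, hb⟩
      · rintro (⟨hab, ha, hb⟩ | ⟨u, ⟨hu, hvu⟩, ⟨rfl, rfl⟩ | ⟨rfl, rfl⟩⟩)
        · exact ⟨hab, Or.inr ha, Or.inr hb⟩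
        · exact ⟨hvu, Or.inl rfl, Or.inr hu⟩
        · exact ⟨hvu.symm, Or.inr hu, Or.inl rfl⟩
  · rw [Finset.disjoint_left]
    intro e he he'
    simp only [Finset.mem_image, Finset.mem_filter] at he'
    obtain ⟨u, _, rfl⟩ := he'
    simp only [edgesIn, Finset.mem_filter, Finset.mk_mem_sym2_iff] at he
    exact hv he.2.1

theorem card_edgesIn_insert {S : Finset (Fin n)} {v : Fin n} (hv : v ∉ S) :
    (edgesIn G (insert v S)).card = (edgesIn G S).card + (S.filter (G.Adj v)).card := by
  have h := prod_edgesIn_insert G (fun _ => (2 : ℝ)) hv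
  simp only [Finset.prod_const, ← pow_add] at h
  exact Nat.pow_right_injective le_rfl (by exact_mod_cast h)

theorem fieldZ_congr {S : Finset (Fin n)} {w w' : Fin n → ℝ} (h : ∀ u ∈ S, w u = w' u) :
    fieldZ G β γ S w = fieldZ G β γ S w' := by
  refine Finset.sum_congr rfl fun T hT => ?_
  rw [Finset.prod_congr rfl fun u hu => h u (Finset.mem_powerset.1 hT hu)]

theorem edgeWeight_nonneg (hβ : 0 ≤ β) (hγ : 0 < γ) (T : Finset (Fin n)) (e : Sym2 (Fin n)) :
    0 ≤ edgeWeight β γ T e := by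
  induction e using Sym2.ind with
  | _ a b =>
    by_cases ha : a ∈ T <;> by_cases hb : b ∈ T <;>
      simp [edgeWeight, edgeMatrix, spinOf, ha, hb, hβ, hγ.le]

/-- The configuration without blue vertices has positive weight. -/
theorem fieldZ_pos (hβ : 0 ≤ β) (hγ : 0 < γ) (S : Finset (Fin n)) {w : Fin n → ℝ}
    (hw : ∀ u, 0 ≤ w u) : 0 < fieldZ G β γ S w := by
  refine Finset.sum_pos' (fun T _ => ?_) ⟨∅, Finset.empty_mem_powerset S, ?_⟩
  · exact mul_nonneg (Finset.prod_nonneg fun u _ => hw u)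
      (Finset.prod_nonneg fun e _ => edgeWeight_nonneg hβ hγ T e)
  · rw [Finset.prod_empty, one_mul]
    refine Finset.prod_pos fun e _ => ?_
    induction e using Sym2.ind with
    | _ a b => simp [edgeWeight, edgeMatrix, spinOf, hγ]

/-- Multiply the fields on `N` by the factors `c`. -/
def mulOn (N : Finset (Fin n)) (c w : Fin n → ℝ) (u : Fin n) : ℝ :=
  if u ∈ N then c u * w u else w u

theorem mulOn_nonneg {N : Finset (Fin n)} {c w : Fin n → ℝ} (hc : ∀ u, 0 ≤ c u)
    (hw : ∀ u, 0 ≤ w u) (u : Fin n) : 0 ≤ mulOn N c w u := by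
  unfold mulOn; split_ifs
  · exact mul_nonneg (hc u) (hw u)
  · exact hw u

theorem prod_mulOn (N T : Finset (Fin n)) (c w : Fin n → ℝ) :
    ∏ u ∈ T, mulOn N c w u = (∏ u ∈ T.filter (· ∈ N), c u) * ∏ u ∈ T, w u := by
  rw [Finset.prod_filter, ← Finset.prod_mul_distrib]
  refine Finset.prod_congr rfl fun u _ => ?_
  unfold mulOn; split_ifs <;> simp

/-- Condition on the spin of `v`: its neighbours see a blue or a green vertex instead of it. -/
theorem fieldZ_insert (hγ : 0 < γ) {S : Finset (Fin n)} {v : Fin n} (hv : v ∉ S)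
    (w : Fin n → ℝ) :
    fieldZ G β γ (insert v S) w =
      γ ^ (S.filter (G.Adj v)).card *
          fieldZ G β γ S (mulOn (G.neighborFinset v) (fun _ => γ⁻¹) w) +
        w v * fieldZ G β γ S (mulOn (G.neighborFinset v) (fun _ => β) w) := by
  unfold fieldZ
  rw [Finset.sum_powerset_insert hv, Finset.mul_sum, Finset.mul_sum]
  refine congrArg₂ (· + ·) (Finset.sum_congr rfl fun T hT => ?_)
    (Finset.sum_congr rfl fun T hT => ?_)
  · have hT' := Finset.mem_powerset.1 hT
    have hvT : v ∉ T := fun h => hv (hT' h)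
    rw [prod_edgesIn_insert G _ hv, prod_mulOn]
    have h1 : ∏ u ∈ S.filter (G.Adj v), edgeWeight β γ T s(v, u) =
        γ ^ (S.filter (G.Adj v)).card * ∏ u ∈ T.filter (· ∈ G.neighborFinset v), γ⁻¹ := by
      have h2 : T.filter (· ∈ G.neighborFinset v) =
          (S.filter (G.Adj v)).filter (· ∈ T) := by
        ext u
        simp only [Finset.mem_filter, SimpleGraph.mem_neighborFinset]
        exact ⟨fun h => ⟨⟨hT' h.1, h.2⟩, h.1⟩, fun h => ⟨h.2, h.1.2⟩⟩
      rw [h2, ← Finset.prod_const, Finset.prod_filter (· ∈ T), ← Finset.prod_mul_distrib]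
      refine Finset.prod_congr rfl fun u _ => ?_
      by_cases hu : u ∈ T <;> simp [edgeWeight, edgeMatrix, spinOf, hvT, hu, hγ.ne']
    rw [h1]; ring
  · have hT' := Finset.mem_powerset.1 hT
    have hvT : v ∉ T := fun h => hv (hT' h)
    rw [prod_edgesIn_insert G _ hv, prod_mulOn, Finset.prod_insert hvT]
    have h1 : ∏ u ∈ S.filter (G.Adj v), edgeWeight β γ (insert v T) s(v, u) =
        ∏ u ∈ T.filter (· ∈ G.neighborFinset v), β := by
      have h2 : T.filter (· ∈ G.neighborFinset v) =
          (S.filter (G.Adj v)).filter (· ∈ T) := by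
        ext u
        simp only [Finset.mem_filter, SimpleGraph.mem_neighborFinset]
        exact ⟨fun h => ⟨⟨hT' h.1, h.2⟩, h.1⟩, fun h => ⟨h.2, h.1.2⟩⟩
      rw [h2, Finset.prod_filter (· ∈ T)]
      refine Finset.prod_congr rfl fun u hu => ?_
      have huv : u ≠ v := by
        rintro rfl; exact hv (Finset.mem_filter.1 hu).1
      by_cases hu : u ∈ T <;> simp [edgeWeight, edgeMatrix, spinOf, hu, huv]
    have h3 : ∏ e ∈ edgesIn G S, edgeWeight β γ (insert v T) e =
        ∏ e ∈ edgesIn G S, edgeWeight β γ T e := by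
      refine Finset.prod_congr rfl fun e he => ?_
      simp only [edgesIn, Finset.mem_filter] at he
      induction e using Sym2.ind with
      | _ a b =>
        have h4 := Finset.mk_mem_sym2_iff.1 he.2
        have ha : a ≠ v := by rintro rfl; exact hv h4.1
        have hb : b ≠ v := by rintro rfl; exact hv h4.2
        simp [edgeWeight, spinOf, ha, hb]
    rw [h1, h3]; ring

/-- The ratio of the weights of the configurations on `insert v S` in which `v` is blue and of
those in which `v` is green. -/
noncomputable def spinRatio (β γ : ℝ) (S : Finset (Fin n)) (v : Fin n) (w : Fin n → ℝ) : ℝ :=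
  w v * fieldZ G β γ S (mulOn (G.neighborFinset v) (fun _ => β) w) /
    (γ ^ (S.filter (G.Adj v)).card *
      fieldZ G β γ S (mulOn (G.neighborFinset v) (fun _ => γ⁻¹) w))

theorem spinRatio_congr {S : Finset (Fin n)} {v : Fin n} {w w' : Fin n → ℝ}
    (hv : w v = w' v) (h : ∀ u ∈ S, w u = w' u) :
    spinRatio G β γ S v w = spinRatio G β γ S v w' := by
  have h' : ∀ c : Fin n → ℝ, ∀ N, fieldZ G β γ S (mulOn N c w) = fieldZ G β γ S (mulOn N c w') :=
    fun c N => fieldZ_congr G fun u hu => by simp only [mulOn, h u hu]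
  unfold spinRatio
  rw [hv, h', h']

theorem spinRatio_nonneg (hβ : 0 ≤ β) (hγ : 0 < γ) (S : Finset (Fin n)) (v : Fin n)
    {w : Fin n → ℝ} (hw : ∀ u, 0 ≤ w u) : 0 ≤ spinRatio G β γ S v w := by
  have h1 := fieldZ_pos G hβ hγ S (mulOn_nonneg (N := G.neighborFinset v)
    (fun _ => hβ) hw)
  have h2 := fieldZ_pos G hβ hγ S (mulOn_nonneg (N := G.neighborFinset v)
    (fun _ => (inv_pos.2 hγ).le) hw)
  have := hw v
  unfold spinRatio
  positivity

theorem fieldZ_insert_eq (hβ : 0 ≤ β) (hγ : 0 < γ) {S : Finset (Fin n)} {v : Fin n} (hv : v ∉ S)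
    {w : Fin n → ℝ} (hw : ∀ u, 0 ≤ w u) :
    fieldZ G β γ (insert v S) w =
      γ ^ (S.filter (G.Adj v)).card *
          fieldZ G β γ S (mulOn (G.neighborFinset v) (fun _ => γ⁻¹) w) *
        (1 + spinRatio G β γ S v w) := by
  have h2 := fieldZ_pos G hβ hγ S (mulOn_nonneg (N := G.neighborFinset v)
    (fun _ => (inv_pos.2 hγ).le) hw)
  rw [fieldZ_insert G hγ hv, spinRatio, mul_add, mul_one, mul_div_cancel₀]
  positivity

/-- The effect of changing the field at one vertex. -/
theorem fieldZ_insert_mulOn (hβ : 0 ≤ β) (hγ : 0 < γ) {S : Finset (Fin n)} {v : Fin n}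
    (hv : v ∉ S) {w : Fin n → ℝ} (hw : ∀ u, 0 ≤ w u) {c : Fin n → ℝ} (hc : ∀ u, 0 ≤ c u) :
    fieldZ G β γ (insert v S) (mulOn {v} c w) =
      γ ^ (S.filter (G.Adj v)).card *
          fieldZ G β γ S (mulOn (G.neighborFinset v) (fun _ => γ⁻¹) w) *
        (1 + c v * spinRatio G β γ S v w) := by
  have key : ∀ a : Fin n → ℝ, ∀ N, fieldZ G β γ S (mulOn N a (mulOn {v} c w)) =
      fieldZ G β γ S (mulOn N a w) := fun a N => fieldZ_congr G fun u hu => by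
    have : u ≠ v := by rintro rfl; exact hv hu
    simp [mulOn, this]
  rw [fieldZ_insert_eq G hβ hγ hv (mulOn_nonneg hc hw), key]
  unfold spinRatio
  rw [key, key]
  simp only [mulOn, Finset.mem_singleton, if_true]
  ring

/-- The factor with which a removed vertex with threshold `s` enters the field of its neighbour
`x`: those below the threshold see a green vertex, those above a blue one. -/
noncomputable def pinFactor (β γ : ℝ) (x s : ℕ) : ℝ :=
  if x < s then γ⁻¹ else if x = s then 1 else β

theorem pinFactor_nonneg (hβ : 0 ≤ β) (hγ : 0 < γ) (x s : ℕ) : 0 ≤ pinFactor β γ x s := by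
  unfold pinFactor; split_ifs <;> positivity

/-- Change the fields on `N` one after the other from what a green vertex causes to what a blue
one causes. -/
theorem fieldZ_telescope (hβ : 0 ≤ β) (hγ : 0 < γ) (S N : Finset (Fin n)) (hN : N ⊆ S) :
    ∀ {w : Fin n → ℝ}, (∀ u, 0 ≤ w u) →
    fieldZ G β γ S (mulOn N (fun _ => β) w) =
      fieldZ G β γ S (mulOn N (fun _ => γ⁻¹) w) * (γ ^ N.card *
        ∏ u ∈ N, edgeFactor β γ (spinRatio G β γ (S.erase u) u
          (mulOn N (fun x => pinFactor β γ x u) w))) := by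
  induction N using Finset.induction_on_min with
  | empty =>
    intro w _
    have h : ∀ c : Fin n → ℝ, mulOn ∅ c w = w := fun c => by ext; simp [mulOn]
    simp [h]
  | insert m N hm ih =>
    intro w hw
    have hmN : m ∉ N := fun h => lt_irrefl _ (hm m h)
    have hmS : m ∈ S := hN (Finset.mem_insert_self m N)
    have hγ' : 0 ≤ γ⁻¹ := (inv_pos.2 hγ).le
    have hw' : ∀ u, 0 ≤ mulOn {m} (fun _ => γ⁻¹) w u := mulOn_nonneg (fun _ => hγ') hw
    have hwb : ∀ u, 0 ≤ mulOn N (fun _ => β) w u := mulOn_nonneg (fun _ => hβ) hw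
    have ih' := ih ((Finset.subset_insert m N).trans hN) hw'
    -- the vertices of `N` lie above `m`, so `m` looks green to all of their hybrids
    have e1 : ∀ c : Fin n → ℝ, mulOn {m} c (mulOn N (fun _ => β) w) =
        mulOn (insert m N) (fun u => if u = m then c m else β) w := by
      intro c; ext u
      by_cases hu : u = m
      · subst hu; simp [mulOn, hmN]
      · by_cases hu' : u ∈ N <;> simp [mulOn, hu, hu']
    have e2 : mulOn N (fun _ => β) (mulOn {m} (fun _ => γ⁻¹) w) =
        mulOn {m} (fun _ => γ⁻¹) (mulOn N (fun _ => β) w) := by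
      ext u
      by_cases hu : u = m
      · subst hu; simp [mulOn, hmN]
      · by_cases hu' : u ∈ N <;> simp [mulOn, hu, hu']
    have e3 : mulOn N (fun _ => γ⁻¹) (mulOn {m} (fun _ => γ⁻¹) w) =
        mulOn (insert m N) (fun _ => γ⁻¹) w := by
      ext u
      by_cases hu : u = m
      · subst hu; simp [mulOn, hmN]
      · by_cases hu' : u ∈ N <;> simp [mulOn, hu, hu']
    have e4 : ∀ u ∈ N, mulOn N (fun x => pinFactor β γ x u) (mulOn {m} (fun _ => γ⁻¹) w) =
        mulOn (insert m N) (fun x => pinFactor β γ x u) w := by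
      intro u hu; ext x
      by_cases hx : x = m
      · subst hx
        have : (x : ℕ) < u := hm u hu
        simp [mulOn, hmN, pinFactor, this]
      · by_cases hx' : x ∈ N <;> simp [mulOn, hx, hx']
    have e5 : mulOn (insert m N) (fun x => pinFactor β γ x m) w = mulOn N (fun _ => β) w := by
      ext x
      by_cases hx : x = m
      · subst hx; simp [mulOn, hmN, pinFactor]
      · by_cases hx' : x ∈ N
        · have : (m : ℕ) < x := hm x hx'
          have h1 : ¬ (x : ℕ) < m := by omega
          have h2 : ¬ (x : ℕ) = m := by omega
          simp [mulOn, hx, hx', pinFactor, h1, h2]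
        · simp [mulOn, hx, hx']
    have e6 : mulOn (insert m N) (fun _ => β) w = mulOn {m} (fun _ => β) (mulOn N (fun _ => β) w) := by
      rw [e1]; simp
    have s1 := fieldZ_insert_mulOn G hβ hγ (Finset.notMem_erase m S) hwb (c := fun _ => β)
      (fun _ => hβ)
    have s2 := fieldZ_insert_mulOn G hβ hγ (Finset.notMem_erase m S) hwb (c := fun _ => γ⁻¹)
      (fun _ => hγ')
    rw [Finset.insert_erase hmS] at s1 s2
    rw [e6, s1, Finset.prod_insert hmN, e5, Finset.card_insert_of_notMem hmN]
    rw [e2, s2, e3, Finset.prod_congr rfl fun u hu => by rw [e4 u hu]] at ih'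
    have hR := spinRatio_nonneg G hβ hγ (S.erase m) m hwb
    set R := spinRatio G β γ (S.erase m) m (mulOn N (fun _ => β) w)
    have hstep : 1 + β * R = (1 + γ⁻¹ * R) * (γ * edgeFactor β γ R) := by
      unfold edgeFactor; field_simp; ring
    rw [hstep, ← mul_assoc, ih']
    ring

/-- The tree recursion for the ratio. -/
theorem spinRatio_eq (hβ : 0 ≤ β) (hγ : 0 < γ) (S : Finset (Fin n)) (v : Fin n)
    {w : Fin n → ℝ} (hw : ∀ u, 0 ≤ w u) :
    spinRatio G β γ S v w = w v * ∏ u ∈ S.filter (G.Adj v), edgeFactor β γ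
      (spinRatio G β γ (S.erase u) u
        (mulOn (G.neighborFinset v) (fun x => pinFactor β γ x u) w)) := by
  have hcong : ∀ c : Fin n → ℝ, ∀ u ∈ S, mulOn (S.filter (G.Adj v)) c w u =
      mulOn (G.neighborFinset v) c w u := by
    intro c u hu
    simp [mulOn, hu]
  have h := fieldZ_telescope G hβ hγ S (S.filter (G.Adj v)) (Finset.filter_subset _ _) hw
  rw [fieldZ_congr G (hcong _), fieldZ_congr G (hcong fun _ => γ⁻¹)] at h
  have h2 := fieldZ_pos G hβ hγ S (mulOn_nonneg (N := G.neighborFinset v)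
    (fun _ => (inv_pos.2 hγ).le) hw)
  rw [Finset.prod_congr rfl fun u hu => by
    rw [spinRatio_congr G (hcong (fun x => pinFactor β γ x u) u (Finset.mem_filter.1 hu).1)
      fun x hx => hcong _ x (Finset.mem_of_mem_erase hx)]] at h
  conv_lhs => rw [spinRatio, h]
  generalize fieldZ G β γ S (mulOn (G.neighborFinset v) (fun _ => γ⁻¹) w) = Z at h2
  field_simp

theorem fieldZ_univ_eq (β γ lam : ℝ) :
    fieldZ G β γ Finset.univ (fun _ => lam) = partitionFunction G β γ lam := by
  unfold fieldZ partitionFunction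
  refine Finset.sum_bij' (fun T _ => spinOf T) (fun σ _ => Finset.univ.filter fun v => σ v = 0)
    (fun _ _ => Finset.mem_univ _) (fun _ _ => by simp) ?_ ?_ ?_
  · intro T _; ext v; simp [spinOf]
  · intro σ _; ext v
    simp only [spinOf, Finset.mem_filter, Finset.mem_univ, true_and]
    split_ifs with h
    · rw [h]
    · have : σ v = 1 := by omega
      rw [this]
  · intro T _
    unfold weight
    rw [mul_comm]
    congr 1
    · have : edgesIn G Finset.univ = G.edgeFinset := by
        ext e; simp [edgesIn]
      rw [this]; rfl
    · have : ∀ v, vertexWeight lam (spinOf T v) = if v ∈ T then lam else 1 := by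
        intro v; by_cases hv : v ∈ T <;> simp [spinOf, vertexWeight, hv]
      simp only [this, Finset.prod_ite_mem, Finset.univ_inter]

end Fields

end TwoSpin

namespace TwoSpin

/-! ### The recursion on self-avoiding walks -/

section Walks

variable {n : ℕ} (G : SimpleGraph (Fin n)) [DecidableRel G.Adj] {β γ lam : ℝ}

/-- The fields after the removal of the vertices in a list of pairs (vertex, threshold). -/
noncomputable def pinnedField (β γ lam : ℝ) : List (Fin n × ℕ) → Fin n → ℝ
  | [] => fun _ => lam
  | p :: ρ => mulOn (G.neighborFinset p.1) (fun x => pinFactor β γ x p.2) (pinnedField β γ lam ρ)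

/-- The vertices that have not been removed. -/
def remaining (ρ : List (Fin n × ℕ)) : Finset (Fin n) :=
  Finset.univ.filter fun u => ρ.lookup u = none

/-- The ratio at `v` after the removal of the vertices in `ρ`. -/
noncomputable def exactRatio (β γ lam : ℝ) (ρ : List (Fin n × ℕ)) (v : Fin n) : ℝ :=
  spinRatio G β γ ((remaining ρ).erase v) v (pinnedField G β γ lam ρ)

/-- The ratio at `v` computed from the ratios `f u` at its neighbours `u` that have not been
removed; a neighbour in `ρ` contributes according to its threshold. -/
noncomputable def nodeRatio (β γ lam : ℝ) (ρ : List (Fin n × ℕ)) (v : Fin n) (f : Fin n → ℝ) : ℝ :=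
  lam * ∏ u ∈ G.neighborFinset v, match ρ.lookup u with
    | some s => pinFactor β γ v s
    | none => edgeFactor β γ (f u)

/-- The truncated recursion. The budget `L` is divided among the children, so that the number of
calls is linear in `L`; a node without budget has the ratio `0`. -/
noncomputable def approxRatio (β γ lam : ℝ) (L : ℕ) (ρ : List (Fin n × ℕ)) (v : Fin n) : ℝ :=
  if h : L = 0 then 0 else
    nodeRatio G β γ lam ρ v fun u => approxRatio β γ lam (L / (G.degree v + 2)) ((v, u) :: ρ) u
termination_by L
decreasing_by exact Nat.div_lt_self (Nat.pos_of_ne_zero h) (by omega)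

theorem approxRatio_zero (ρ : List (Fin n × ℕ)) (v : Fin n) :
    approxRatio G β γ lam 0 ρ v = 0 := by
  rw [approxRatio]; simp

theorem approxRatio_of_pos {L : ℕ} (hL : 1 ≤ L) (ρ : List (Fin n × ℕ)) (v : Fin n) :
    approxRatio G β γ lam L ρ v = nodeRatio G β γ lam ρ v
      fun u => approxRatio G β γ lam (L / (G.degree v + 2)) ((v, u) :: ρ) u := by
  rw [approxRatio, dif_neg (by omega)]

theorem lookup_cons_eq (p : Fin n × ℕ) (ρ : List (Fin n × ℕ)) (u : Fin n) :
    (p :: ρ).lookup u = if u = p.1 then some p.2 else ρ.lookup u := by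
  obtain ⟨x, s⟩ := p
  rw [List.lookup_cons]
  by_cases h : u = x
  · simp [h]
  · have : (u == x) = false := by simpa using h
    simp [h, this]

theorem lookup_eq_none {ρ : List (Fin n × ℕ)} {u : Fin n} :
    ρ.lookup u = none ↔ u ∉ ρ.map Prod.fst := by
  induction ρ with
  | nil => simp
  | cons p ρ ih =>
    rw [lookup_cons_eq]
    by_cases h : u = p.1
    · simp [h]
    · rw [if_neg h, ih]; simp [h]

theorem mem_of_lookup {ρ : List (Fin n × ℕ)} {u : Fin n} {s : ℕ} (h : ρ.lookup u = some s) :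
    (u, s) ∈ ρ := by
  induction ρ with
  | nil => simp at h
  | cons p ρ ih =>
    rw [lookup_cons_eq] at h
    by_cases hu : u = p.1
    · rw [if_pos hu] at h
      simp only [Option.some.injEq] at h
      rw [hu, ← h]; exact List.mem_cons_self
    · rw [if_neg hu] at h
      exact List.mem_cons_of_mem _ (ih h)

theorem remaining_cons (p : Fin n × ℕ) (ρ : List (Fin n × ℕ)) :
    remaining (p :: ρ) = (remaining ρ).erase p.1 := by
  ext u
  simp only [remaining, Finset.mem_filter, Finset.mem_univ, true_and, Finset.mem_erase,
    lookup_cons_eq]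
  by_cases h : u = p.1 <;> simp [h]

theorem pinnedField_nonneg (hβ : 0 ≤ β) (hγ : 0 < γ) (hlam : 0 < lam) (ρ : List (Fin n × ℕ)) :
    ∀ u, 0 ≤ pinnedField G β γ lam ρ u := by
  induction ρ with
  | nil => exact fun _ => hlam.le
  | cons p ρ ih => exact mulOn_nonneg (fun x => pinFactor_nonneg hβ hγ x p.2) ih

theorem pinnedField_eq_prod {ρ : List (Fin n × ℕ)} (hρ : (ρ.map Prod.fst).Nodup) (v : Fin n) :
    pinnedField G β γ lam ρ v = lam * ∏ u ∈ G.neighborFinset v, match ρ.lookup u with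
      | some s => pinFactor β γ v s
      | none => 1 := by
  induction ρ with
  | nil => simp [pinnedField]
  | cons p ρ ih =>
    rw [List.map_cons, List.nodup_cons] at hρ
    have hp := lookup_eq_none.2 hρ.1
    rw [pinnedField, mulOn, ih hρ.2]
    split_ifs with hv
    · have hv' : p.1 ∈ G.neighborFinset v := by
        rw [SimpleGraph.mem_neighborFinset] at hv ⊢; exact hv.symm
      rw [← Finset.mul_prod_erase _ _ hv', ← Finset.mul_prod_erase _ _ hv', lookup_cons_eq, hp,
        if_pos rfl, one_mul]
      rw [mul_left_comm]
      congr 2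
      refine Finset.prod_congr rfl fun u hu => ?_
      rw [lookup_cons_eq, if_neg (Finset.ne_of_mem_erase hu)]
    · congr 1
      refine Finset.prod_congr rfl fun u hu => ?_
      have : u ≠ p.1 := by
        rintro rfl
        rw [SimpleGraph.mem_neighborFinset] at hv hu
        exact hv hu.symm
      rw [lookup_cons_eq, if_neg this]

theorem exactRatio_nonneg (hβ : 0 ≤ β) (hγ : 0 < γ) (hlam : 0 < lam) (ρ : List (Fin n × ℕ))
    (v : Fin n) : 0 ≤ exactRatio G β γ lam ρ v :=
  spinRatio_nonneg G hβ hγ _ _ (pinnedField_nonneg G hβ hγ hlam ρ)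

/-- The exact ratios satisfy the recursion without truncation. -/
theorem exactRatio_eq (hβ : 0 ≤ β) (hγ : 0 < γ) (hlam : 0 < lam) {ρ : List (Fin n × ℕ)}
    (hρ : (ρ.map Prod.fst).Nodup) (v : Fin n) :
    exactRatio G β γ lam ρ v =
      nodeRatio G β γ lam ρ v fun u => exactRatio G β γ lam ((v, (u : ℕ)) :: ρ) u := by
  have hfilter : ((remaining ρ).erase v).filter (G.Adj v) =
      (G.neighborFinset v).filter fun u => ρ.lookup u = none := by
    ext u
    simp only [Finset.mem_filter, Finset.mem_erase, remaining, Finset.mem_univ, true_and,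
      SimpleGraph.mem_neighborFinset]
    exact ⟨fun h => ⟨h.2, h.1.2⟩, fun h => ⟨⟨h.1.ne', h.2⟩, h.1⟩⟩
  have hchild : ∀ u, spinRatio G β γ (((remaining ρ).erase v).erase u) u
      (mulOn (G.neighborFinset v) (fun x => pinFactor β γ x u) (pinnedField G β γ lam ρ)) =
      exactRatio G β γ lam ((v, (u : ℕ)) :: ρ) u := by
    intro u
    rw [exactRatio, remaining_cons, pinnedField]
  rw [exactRatio, spinRatio_eq G hβ hγ _ _ (pinnedField_nonneg G hβ hγ hlam ρ), hfilter,
    pinnedField_eq_prod G hρ, nodeRatio, Finset.prod_filter, mul_assoc, ← Finset.prod_mul_distrib]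
  congr 1
  refine Finset.prod_congr rfl fun u _ => ?_
  rw [hchild]
  cases ρ.lookup u <;> simp

theorem pinFactor_le (hle : β ≤ 1 / γ) (x s : ℕ) : pinFactor β γ x s ≤ max 1 (1 / γ) := by
  unfold pinFactor
  split_ifs
  · rw [← one_div]; exact le_max_right _ _
  · exact le_max_left _ _
  · exact hle.trans (le_max_right _ _)

theorem nodeRatio_nonneg (hβ : 0 ≤ β) (hγ : 0 < γ) (hlam : 0 < lam) (ρ : List (Fin n × ℕ))
    (v : Fin n) {f : Fin n → ℝ} (hf : ∀ u, 0 ≤ f u) : 0 ≤ nodeRatio G β γ lam ρ v f := by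
  refine mul_nonneg hlam.le (Finset.prod_nonneg fun u _ => ?_)
  split
  · exact pinFactor_nonneg hβ hγ _ _
  · exact (edgeFactor_pos hβ hγ (hf u)).le

theorem nodeRatio_le (hβ : 0 ≤ β) (hγ : 0 < γ) (hβγ : β * γ < 1) (hlam : 0 < lam)
    (ρ : List (Fin n × ℕ)) (v : Fin n) {f : Fin n → ℝ} (hf : ∀ u, 0 ≤ f u) :
    nodeRatio G β γ lam ρ v f ≤ lam * max 1 (1 / γ) ^ G.degree v := by
  rw [← SimpleGraph.card_neighborFinset_eq_degree, ← Finset.prod_const]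
  refine mul_le_mul_of_nonneg_left (Finset.prod_le_prod (fun u _ => ?_) fun u _ => ?_) hlam.le
  · split
    · exact pinFactor_nonneg hβ hγ _ _
    · exact (edgeFactor_pos hβ hγ (hf u)).le
  · split
    · exact pinFactor_le (by rw [le_div_iff₀ hγ]; exact hβγ.le) _ _
    · exact (edgeFactor_le hγ hβγ (hf u)).trans (le_max_right _ _)

theorem approxRatio_nonneg (hβ : 0 ≤ β) (hγ : 0 < γ) (hlam : 0 < lam) (L : ℕ) :
    ∀ (ρ : List (Fin n × ℕ)) (v : Fin n), 0 ≤ approxRatio G β γ lam L ρ v := by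
  induction L using Nat.strong_induction_on with
  | _ L ih =>
    intro ρ v
    rcases Nat.eq_zero_or_pos L with rfl | hL
    · rw [approxRatio_zero]
    · rw [approxRatio_of_pos G hL]
      exact nodeRatio_nonneg G hβ hγ hlam ρ v fun u =>
        ih _ (Nat.div_lt_self hL (by omega)) _ _

theorem approxRatio_le (hβ : 0 ≤ β) (hγ : 0 < γ) (hβγ : β * γ < 1) (hlam : 0 < lam) (L : ℕ)
    (ρ : List (Fin n × ℕ)) (v : Fin n) :
    approxRatio G β γ lam L ρ v ≤ lam * max 1 (1 / γ) ^ G.degree v := by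
  rcases Nat.eq_zero_or_pos L with rfl | hL
  · rw [approxRatio_zero]; positivity
  · rw [approxRatio_of_pos G hL]
    exact nodeRatio_le G hβ hγ hβγ hlam ρ v fun u => approxRatio_nonneg G hβ hγ hlam _ _ _

/-! ### The truncation error -/

/-- Contraction at a node, in terms of a bound `a` for the decay rate. -/
theorem potential_nodeRatio_le (hβ : 0 ≤ β) (hγ : 0 < γ) (hβγ : β * γ < 1) (hlam : 0 < lam)
    (ρ : List (Fin n × ℕ)) (v : Fin n) {f g : Fin n → ℝ} (hf : ∀ u, 0 ≤ f u) (hg : ∀ u, 0 ≤ g u)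
    {a e : ℝ} (ha : 0 ≤ a) (he : 0 ≤ e)
    (hdecay : (∀ u ∈ G.neighborFinset v, ∀ s, ρ.lookup u = some s → 0 < pinFactor β γ v s) →
      ∀ x : Fin n → ℝ, (∀ u, 0 ≤ x u) →
      √(sens β γ (nodeRatio G β γ lam ρ v x)) *
        ∑ u ∈ (G.neighborFinset v).filter (fun u => ρ.lookup u = none), √(sens β γ (x u)) ≤ a)
    (hfg : ∀ u ∈ G.neighborFinset v, ρ.lookup u = none →
      |potential β γ (g u) - potential β γ (f u)| ≤ e) :
    |potential β γ (nodeRatio G β γ lam ρ v g) - potential β γ (nodeRatio G β γ lam ρ v f)| ≤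
      a * e := by
  set U := (G.neighborFinset v).filter (fun u => ρ.lookup u = none) with hU
  set pin : Fin n → ℝ := fun u => match ρ.lookup u with
    | some s => pinFactor β γ v s
    | none => 1 with hpin
  have hpin0 : ∀ u, 0 ≤ pin u := by
    intro u; simp only [hpin]; split
    · exact pinFactor_nonneg hβ hγ _ _
    · exact zero_le_one
  have hnode : ∀ x : Fin n → ℝ, nodeRatio G β γ lam ρ v x =
      (lam * ∏ u ∈ G.neighborFinset v, pin u) * ∏ u ∈ U, edgeFactor β γ (x u) := by
    intro x
    rw [nodeRatio, hU, Finset.prod_filter, mul_assoc, ← Finset.prod_mul_distrib]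
    congr 1
    refine Finset.prod_congr rfl fun u _ => ?_
    simp only [hpin]
    cases ρ.lookup u <;> simp
  rw [hnode, hnode]
  refine potential_contraction hβ hγ hβγ U
    (mul_nonneg hlam.le (Finset.prod_nonneg fun u _ => hpin0 u)) ha ?_ f g (fun u _ => hf u)
    (fun u _ => hg u) he fun u hu => hfg u (Finset.mem_filter.1 hu).1 (Finset.mem_filter.1 hu).2
  intro hw x hx
  have hpos : ∀ u ∈ G.neighborFinset v, ∀ s, ρ.lookup u = some s → 0 < pinFactor β γ v s := by
    intro u hu s hs
    refine (pinFactor_nonneg hβ hγ _ _).lt_of_ne' fun h0 => ?_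
    have : ∏ u ∈ G.neighborFinset v, pin u = 0 :=
      Finset.prod_eq_zero hu (by simp only [hpin, hs, h0])
    rw [this, mul_zero] at hw
    exact lt_irrefl _ hw
  have h := hdecay hpos (fun u => |x u|) fun u => abs_nonneg _
  rw [hnode, Finset.prod_congr (s₁ := U) rfl fun u hu => by rw [abs_of_nonneg (hx u hu)],
    Finset.sum_congr rfl fun u hu => by rw [abs_of_nonneg (hx u hu)]] at h
  exact h

/-- The thresholds of `ρ` are `n` or among the vertices in `A`. -/
def ThresholdsIn (ρ : List (Fin n × ℕ)) (A : List (Fin n)) : Prop :=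
  ∀ e ∈ ρ, e.2 = n ∨ ∃ a ∈ A, e.2 = (a : ℕ)

theorem degree_le_card (v : Fin n) : G.degree v ≤ n := by
  have := G.degree_lt_card_verts v
  rw [Fintype.card_fin] at this
  exact this.le

theorem div_add_one_ge (L m : ℕ) : ((L : ℝ) + 1) ≤ (m + 1 : ℕ) * ((L / (m + 1) : ℕ) + 1) := by
  have := Nat.lt_mul_div_succ L (Nat.succ_pos m)
  have h : L + 1 ≤ (m + 1) * (L / (m + 1) + 1) := this
  exact_mod_cast h

/-- Below the root of the recursion the error of the potential, raised to the power `k`, is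
inversely proportional to the budget. -/
theorem potential_approxRatio_pow_le (hβ : 0 ≤ β) (hγ : 0 < γ) (hβγ : β * γ < 1) (hlam : 0 < lam)
    {Δ : ℕ∞} {k : ℕ} (hk : 1 ≤ k)
    (hdecay : ∀ d : ℕ, 1 ≤ d → (d : ℕ∞) < Δ → ∃ a : ℝ, 0 ≤ a ∧ a ≤ 1 ∧
      a ^ k * (d + 3) ≤ 1 ∧ ∀ {ι : Type} (s : Finset ι) (y : ι → ℝ), s.card = d →
        (∀ i ∈ s, 0 < y i ∧ β ≤ y i ∧ y i ≤ 1 / γ) →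
        √(sens β γ (lam * ∏ i ∈ s, y i)) * ∑ i ∈ s, √(factorSens β γ (y i)) ≤ a)
    {B : ℝ} (hB : ∀ d : ℕ, (d : ℕ∞) ≤ Δ → lam * max 1 (1 / γ) ^ d ≤ B)
    (hG : ∀ v, (G.degree v : ℕ∞) ≤ Δ) (L : ℕ) :
    ∀ (ρ : List (Fin n × ℕ)) (p v : Fin n), (v :: p :: ρ.map Prod.fst).Nodup → G.Adj v p →
      ThresholdsIn ρ (p :: ρ.map Prod.fst) →
      |potential β γ (approxRatio G β γ lam L ((p, (v : ℕ)) :: ρ) v) -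
        potential β γ (exactRatio G β γ lam ((p, (v : ℕ)) :: ρ) v)| ^ k * (L + 1) ≤
        rootPotential β γ √B ^ k := by
  induction L using Nat.strong_induction_on with
  | _ L ih =>
  intro ρ p v hnd hadj hthr
  have hM := rootPotential_nonneg hβ hγ (Real.sqrt_nonneg B)
  set σ : List (Fin n × ℕ) := (p, (v : ℕ)) :: ρ with hσ
  have hσnd : (σ.map Prod.fst).Nodup := (List.nodup_cons.1 hnd).2
  have hex := exactRatio_eq G hβ hγ hlam hσnd v
  rcases Nat.eq_zero_or_pos L with rfl | hL
  · have h1 := potential_sub_le hβ hγ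
      ((hex.trans_le (nodeRatio_le G hβ hγ hβγ hlam σ v fun u =>
        exactRatio_nonneg G hβ hγ hlam _ _)).trans (hB _ (hG v)))
      ((approxRatio_le G hβ hγ hβγ hlam 0 σ v).trans (hB _ (hG v)))
    simpa using pow_le_pow_left₀ (abs_nonneg _) h1 k
  · set L' := L / (G.degree v + 2) with hL'
    have hL'lt : L' < L := Nat.div_lt_self hL (by omega)
    set N := G.neighborFinset v with hN
    have hpN : p ∈ N := by rw [hN, SimpleGraph.mem_neighborFinset]; exact hadj
    have hNc : (N.erase p).card + 1 = G.degree v := by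
      rw [Finset.card_erase_add_one hpN]; exact SimpleGraph.card_neighborFinset_eq_degree G v
    set C := rootPotential β γ √B ^ k with hC
    have hC0 : 0 ≤ C := pow_nonneg hM k
    -- `e` bounds the error at the children
    set e := (C / ((L' : ℝ) + 1)) ^ ((k : ℝ)⁻¹) with he
    have he0 : 0 ≤ e := by positivity
    have hek : e ^ k = C / ((L' : ℝ) + 1) := Real.rpow_inv_natCast_pow (by positivity) (by omega)
    have hchild : ∀ u ∈ N, σ.lookup u = none →
        |potential β γ (approxRatio G β γ lam L' ((v, (u : ℕ)) :: σ) u) -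
          potential β γ (exactRatio G β γ lam ((v, (u : ℕ)) :: σ) u)| ≤ e := by
      intro u hu hnone
      rw [hN, SimpleGraph.mem_neighborFinset] at hu
      have h := ih L' hL'lt σ v u (by
        rw [List.nodup_cons]
        refine ⟨?_, hnd⟩
        rw [List.mem_cons, not_or]
        exact ⟨hu.ne', lookup_eq_none.1 hnone⟩) hu.symm (by
        intro q hq
        rw [hσ, List.mem_cons] at hq
        rcases hq with rfl | hq
        · exact Or.inr ⟨v, List.mem_cons_self, rfl⟩
        · exact (hthr q hq).imp_right fun ⟨b, hb, hb'⟩ => ⟨b, List.mem_cons_of_mem _ hb, hb'⟩)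
      rw [← le_div_iff₀ (by positivity), ← hek] at h
      exact (pow_le_pow_iff_left₀ (abs_nonneg _) he0 (by omega)).1 h
    -- the decay rate at this node
    obtain ⟨a, ha0, hak, had⟩ : ∃ a : ℝ, 0 ≤ a ∧ a ^ k * ((N.erase p).card + 3) ≤ 1 ∧
        ((∀ u ∈ N, ∀ s, σ.lookup u = some s → 0 < pinFactor β γ v s) →
          ∀ x : Fin n → ℝ, (∀ u, 0 ≤ x u) →
          √(sens β γ (nodeRatio G β γ lam σ v x)) *
            ∑ u ∈ N.filter (fun u => σ.lookup u = none), √(sens β γ (x u)) ≤ a) := by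
      have hsub : N.filter (fun u => σ.lookup u = none) ⊆ N.erase p := by
        intro u hu
        rw [Finset.mem_filter] at hu
        refine Finset.mem_erase.2 ⟨?_, hu.1⟩
        rintro rfl
        rw [hσ, lookup_cons_eq] at hu
        simp at hu
      rcases Nat.eq_zero_or_pos (N.erase p).card with h0 | hpos
      · refine ⟨0, le_rfl, by rw [zero_pow (by omega)]; simp, fun _ x _ => ?_⟩
        rw [Finset.card_eq_zero.1 h0, Finset.subset_empty] at hsub
        rw [hsub]; simp
      · obtain ⟨a, h0, _, h1, h2⟩ := hdecay _ hpos (by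
          refine lt_of_lt_of_le ?_ (hG v)
          exact_mod_cast (by omega : (N.erase p).card < G.degree v))
        refine ⟨a, h0, h1, fun hpinpos x hx => ?_⟩
        set y : Fin n → ℝ := fun u => match σ.lookup u with
          | some s => pinFactor β γ v s
          | none => edgeFactor β γ (x u) with hy
        have hy_mem : ∀ u ∈ N.erase p, 0 < y u ∧ β ≤ y u ∧ y u ≤ 1 / γ := by
          intro u hu
          rw [Finset.mem_erase] at hu
          simp only [hy]
          split
          · rename_i s hs
            have hus : (u, s) ∈ ρ := by
              rw [hσ, lookup_cons_eq, if_neg hu.1] at hs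
              exact mem_of_lookup hs
            -- apart from the parent no removed vertex has the threshold `v`
            have hsv : (v : ℕ) ≠ s := by
              rcases hthr _ hus with h | ⟨b, hb, hb'⟩
              · exact fun hvs => v.2.ne (hvs.trans h)
              · intro hvs
                have : v = b := Fin.ext (hvs.trans hb')
                exact (List.nodup_cons.1 hnd).1 (this ▸ hb)
            refine ⟨hpinpos u hu.2 s hs, ?_⟩
            have hβγ' : β ≤ 1 / γ := by rw [le_div_iff₀ hγ]; exact hβγ.le
            unfold pinFactor
            rw [if_neg hsv]
            split_ifs
            · rw [← one_div]; exact ⟨hβγ', le_rfl⟩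
            · exact ⟨le_rfl, hβγ'⟩
          · exact ⟨edgeFactor_pos hβ hγ (hx u), le_edgeFactor hγ hβγ (hx u),
              edgeFactor_le hγ hβγ (hx u)⟩
        have hnode : nodeRatio G β γ lam σ v x = lam * ∏ u ∈ N.erase p, y u := by
          rw [nodeRatio, ← hN, ← Finset.mul_prod_erase N _ hpN]
          have : σ.lookup p = some (v : ℕ) := by rw [hσ, lookup_cons_eq]; simp
          rw [this]
          simp [pinFactor, hy]
        rw [hnode]
        refine le_trans (mul_le_mul_of_nonneg_left ?_ (Real.sqrt_nonneg _)) (h2 _ y rfl hy_mem)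
        refine le_trans (le_of_eq (Finset.sum_congr rfl fun u hu => ?_))
          (Finset.sum_le_sum_of_subset_of_nonneg hsub fun u _ _ => Real.sqrt_nonneg _)
        simp only [hy, (Finset.mem_filter.1 hu).2]
        rw [factorSens_edgeFactor hβ hγ hβγ (hx u)]
    have hmain := potential_nodeRatio_le G hβ hγ hβγ hlam σ v
      (fun u => exactRatio_nonneg G hβ hγ hlam ((v, (u : ℕ)) :: σ) u)
      (fun u => approxRatio_nonneg G hβ hγ hlam L' ((v, (u : ℕ)) :: σ) u) ha0 he0 had hchild
    rw [← hex, ← approxRatio_of_pos G hL] at hmain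
    have hdiv := div_add_one_ge L (G.degree v + 1)
    rw [show G.degree v + 1 + 1 = G.degree v + 2 from rfl, ← hL'] at hdiv
    calc _ ≤ (a * e) ^ k * (L + 1) := by gcongr
      _ ≤ (a * e) ^ k * ((G.degree v + 2 : ℕ) * (L' + 1)) := by gcongr
      _ = (a ^ k * ((N.erase p).card + 3)) * C := by
        rw [mul_pow, hek, ← hNc]
        push_cast
        field_simp
        ring
      _ ≤ 1 * C := mul_le_mul_of_nonneg_right hak hC0
      _ = C := one_mul C

end Walks

end TwoSpin

namespace TwoSpin

section Walks

variable {n : ℕ} (G : SimpleGraph (Fin n)) [DecidableRel G.Adj] {β γ lam : ℝ}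

/-- At the root all neighbours may be children, and the decay rate is only bounded by the degree;
this costs one more power of the number of vertices in the budget. -/
theorem exists_budget {Δ : ℕ∞} (hanti : AntiFerromagnetic β γ lam)
    (huniq : UpToUnique β γ lam Δ) :
    ∃ k c : ℕ, 1 ≤ c ∧ ∀ {n : ℕ} (G : SimpleGraph (Fin n)) [DecidableRel G.Adj],
      (∀ v, (G.degree v : ℕ∞) ≤ Δ) → ∀ M L : ℕ, 1 ≤ M → (c * (n + 2) * M) ^ k ≤ L →
      ∀ (ρ : List (Fin n × ℕ)) (v : Fin n), (v :: ρ.map Prod.fst).Nodup → ThresholdsIn ρ [] →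
        |approxRatio G β γ lam L ρ v - exactRatio G β γ lam ρ v| ≤ 1 / M := by
  obtain ⟨k, hk, hdecay⟩ := exists_decay_exponent hanti huniq
  obtain ⟨B, hB0, hB⟩ := exists_ratio_bound hanti huniq
  obtain ⟨hβ, -, hγ, hβγ, hlam⟩ := hanti
  obtain ⟨C', hC'0, hC'⟩ := exists_abs_sub_le_potential hβ hγ hB0
  set C := rootPotential β γ √B ^ k with hC
  have hC0 : 0 ≤ C := pow_nonneg (rootPotential_nonneg hβ hγ (Real.sqrt_nonneg B)) k
  obtain ⟨c, hc⟩ := exists_nat_ge (max C (max C' 1))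
  have hcC : C ≤ c := (le_max_left _ _).trans hc
  have hcC' : C' ≤ c := ((le_max_left _ _).trans (le_max_right _ _)).trans hc
  have hc1 : (1 : ℝ) ≤ c := ((le_max_right _ _).trans (le_max_right _ _)).trans hc
  have hc1' : 1 ≤ c := by exact_mod_cast hc1
  refine ⟨k + 1, c, hc1', fun {n} G _ hG M L hM hL ρ v hnd hthr => ?_⟩
  have hL1 : 1 ≤ L := le_trans (Nat.one_le_pow _ _ (by positivity)) hL
  have hM' : (1 : ℝ) ≤ M := by exact_mod_cast hM
  have hρ := (List.nodup_cons.1 hnd).2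
  have hex := exactRatio_eq G hβ hγ hlam hρ v
  set L' := L / (G.degree v + 2) with hL'
  have hdeg := degree_le_card G v
  have hdeg' : (G.degree v : ℝ) ≤ n := by exact_mod_cast hdeg
  set e : ℝ := 1 / (C' * (n + 1) * M) with he
  have he0 : 0 ≤ e := by positivity
  have hdiv := div_add_one_ge L (G.degree v + 1)
  rw [show G.degree v + 1 + 1 = G.degree v + 2 from rfl, ← hL'] at hdiv
  have hbudget : C ≤ e ^ k * ((L' : ℝ) + 1) := by
    have hLr : ((c : ℝ) * (n + 2) * M) ^ (k + 1) ≤ L := by exact_mod_cast hL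
    have h1 : C * (n + 2) * (C' * (n + 1) * M) ^ k ≤ L + 1 := by
      calc C * (n + 2) * (C' * (n + 1) * M) ^ k
          ≤ (c * (n + 2)) * (c * (n + 2) * M) ^ k := by gcongr; norm_num
        _ ≤ (c * (n + 2) * M) * (c * (n + 2) * M) ^ k := by
          exact mul_le_mul_of_nonneg_right (le_mul_of_one_le_right (by positivity) hM')
            (by positivity)
        _ = (c * (n + 2) * M) ^ (k + 1) := by ring
        _ ≤ L + 1 := by linarith
    have h2 : C * (n + 2) * (C' * (n + 1) * M) ^ k ≤ (n + 2) * ((L' : ℝ) + 1) := by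
      refine h1.trans (hdiv.trans ?_)
      push_cast
      gcongr
    rw [he, div_pow, one_pow, one_div_mul_eq_div, le_div_iff₀ (by positivity)]
    have h3 : (0 : ℝ) < n + 2 := by positivity
    nlinarith
  have hchild : ∀ u ∈ G.neighborFinset v, ρ.lookup u = none →
      |potential β γ (approxRatio G β γ lam L' ((v, (u : ℕ)) :: ρ) u) -
        potential β γ (exactRatio G β γ lam ((v, (u : ℕ)) :: ρ) u)| ≤ e := by
    intro u hu hnone
    rw [SimpleGraph.mem_neighborFinset] at hu
    have h := potential_approxRatio_pow_le G hβ hγ hβγ hlam hk hdecay hB hG L' ρ v u (by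
      rw [List.nodup_cons]
      refine ⟨?_, hnd⟩
      rw [List.mem_cons, not_or]
      exact ⟨hu.ne', lookup_eq_none.1 hnone⟩) hu.symm (fun q hq => by
        rcases hthr q hq with h | ⟨b, hb, _⟩
        · exact Or.inl h
        · exact absurd hb List.not_mem_nil)
    exact (pow_le_pow_iff_left₀ (abs_nonneg _) he0 (by omega)).1
      (le_of_mul_le_mul_right (h.trans hbudget) (by positivity))
  have hmain := potential_nodeRatio_le G hβ hγ hβγ hlam ρ v
    (fun u => exactRatio_nonneg G hβ hγ hlam ((v, (u : ℕ)) :: ρ) u)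
    (fun u => approxRatio_nonneg G hβ hγ hlam L' ((v, (u : ℕ)) :: ρ) u)
    (a := G.degree v) (by positivity) he0 (fun _ x hx => by
      have h1 : √(sens β γ (nodeRatio G β γ lam ρ v x)) ≤ 1 := by
        rw [Real.sqrt_le_one]
        exact sens_le_one hβ hγ (nodeRatio_nonneg G hβ hγ hlam ρ v hx)
      have h2 : ∑ u ∈ (G.neighborFinset v).filter (fun u => ρ.lookup u = none),
          √(sens β γ (x u)) ≤ G.degree v := by
        calc _ ≤ ∑ u ∈ (G.neighborFinset v).filter (fun u => ρ.lookup u = none), (1 : ℝ) :=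
              Finset.sum_le_sum fun u _ => by
                rw [Real.sqrt_le_one]; exact sens_le_one hβ hγ (hx u)
          _ ≤ G.degree v := by
            rw [Finset.sum_const, nsmul_eq_mul, mul_one, ← SimpleGraph.card_neighborFinset_eq_degree]
            exact_mod_cast Finset.card_filter_le _ _
      calc _ ≤ 1 * (G.degree v : ℝ) := mul_le_mul h1 h2
            (Finset.sum_nonneg fun _ _ => Real.sqrt_nonneg _) zero_le_one
        _ = _ := one_mul _) hchild
  rw [← hex, ← approxRatio_of_pos G hL1] at hmain
  refine (hC' _ _ (exactRatio_nonneg G hβ hγ hlam ρ v)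
    ((hex.trans_le (nodeRatio_le G hβ hγ hβγ hlam ρ v fun u =>
        exactRatio_nonneg G hβ hγ hlam _ _)).trans (hB _ (hG v)))
    (approxRatio_nonneg G hβ hγ hlam L ρ v)
    ((approxRatio_le G hβ hγ hβγ hlam L ρ v).trans (hB _ (hG v)))).trans ?_
  calc _ ≤ C' * (n * e) := by gcongr; exact hmain.trans (by gcongr)
    _ ≤ C' * ((n + 1) * e) := by gcongr; linarith
    _ = 1 / M := by rw [he]; field_simp

/-! ### Perturbation of the parameters -/

/-- Two numbers are equal up to a factor `exp (± δ)`. -/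
def LogClose (δ x y : ℝ) : Prop := x ≤ Real.exp δ * y ∧ y ≤ Real.exp δ * x

theorem LogClose.symm {δ x y : ℝ} (h : LogClose δ x y) : LogClose δ y x := ⟨h.2, h.1⟩

theorem LogClose.mono {δ δ' x y : ℝ} (h : LogClose δ x y) (hδ : δ ≤ δ') (hx : 0 ≤ x) (hy : 0 ≤ y) :
    LogClose δ' x y :=
  ⟨h.1.trans (mul_le_mul_of_nonneg_right (Real.exp_le_exp.2 hδ) hy),
    h.2.trans (mul_le_mul_of_nonneg_right (Real.exp_le_exp.2 hδ) hx)⟩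

theorem LogClose.refl {δ x : ℝ} (hδ : 0 ≤ δ) (hx : 0 ≤ x) : LogClose δ x x := by
  have := le_mul_of_one_le_left hx (Real.one_le_exp hδ)
  exact ⟨this, this⟩

theorem LogClose.trans {δ ε x y z : ℝ} (h : LogClose δ x y) (h' : LogClose ε y z) :
    LogClose (δ + ε) x z := by
  constructor
  · rw [Real.exp_add, mul_assoc]
    exact h.1.trans (mul_le_mul_of_nonneg_left h'.1 (Real.exp_pos _).le)
  · rw [add_comm, Real.exp_add, mul_assoc]
    exact h'.2.trans (mul_le_mul_of_nonneg_left h.2 (Real.exp_pos _).le)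

theorem LogClose.mul {δ ε x y a b : ℝ} (h : LogClose δ x y) (h' : LogClose ε a b) (hx : 0 ≤ x)
    (hy : 0 ≤ y) (ha : 0 ≤ a) (hb : 0 ≤ b) : LogClose (δ + ε) (x * a) (y * b) := by
  constructor
  · calc x * a ≤ (Real.exp δ * y) * (Real.exp ε * b) := mul_le_mul h.1 h'.1 ha (by positivity)
      _ = _ := by rw [Real.exp_add]; ring
  · calc y * b ≤ (Real.exp δ * x) * (Real.exp ε * a) := mul_le_mul h.2 h'.2 hb (by positivity)
      _ = _ := by rw [Real.exp_add]; ring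

theorem LogClose.inv {δ x y : ℝ} (h : LogClose δ x y) (hx : 0 < x) (hy : 0 < y) :
    LogClose δ x⁻¹ y⁻¹ := by
  constructor
  · rw [← div_eq_mul_inv, le_div_iff₀ hy, ← div_eq_inv_mul, div_le_iff₀ hx]
    exact h.2
  · rw [← div_eq_mul_inv, le_div_iff₀ hx, ← div_eq_inv_mul, div_le_iff₀ hy]
    exact h.1

theorem LogClose.prod {ι : Type*} {s : Finset ι} {f g : ι → ℝ} {δ : ℝ}
    (h : ∀ i ∈ s, LogClose δ (f i) (g i)) (hf : ∀ i ∈ s, 0 ≤ f i) (hg : ∀ i ∈ s, 0 ≤ g i) :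
    LogClose (s.card * δ) (∏ i ∈ s, f i) (∏ i ∈ s, g i) := by
  induction s using Finset.cons_induction with
  | empty => simp [LogClose]
  | cons a s ha ih =>
    simp only [Finset.mem_cons, forall_eq_or_imp] at h hf hg
    rw [Finset.prod_cons, Finset.prod_cons, Finset.card_cons]
    have := h.1.mul (ih h.2 hf.2 hg.2) hf.1 hg.1 (Finset.prod_nonneg hf.2)
      (Finset.prod_nonneg hg.2)
    convert this using 1
    push_cast; ring

theorem LogClose.pow {δ x y : ℝ} (h : LogClose δ x y) (hx : 0 ≤ x) (hy : 0 ≤ y) (m : ℕ) :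
    LogClose (m * δ) (x ^ m) (y ^ m) := by
  have := LogClose.prod (s := Finset.range m) (fun _ _ => h) (fun _ _ => hx) (fun _ _ => hy)
  simpa using this

theorem LogClose.one_add {δ x y : ℝ} (h : LogClose δ x y) (hδ : 0 ≤ δ) :
    LogClose δ (1 + x) (1 + y) := by
  have := Real.one_le_exp hδ
  exact ⟨by linarith [h.1], by linarith [h.2]⟩

theorem LogClose.one_add_of_abs_sub_le {δ x y : ℝ} (h : |x - y| ≤ δ) (hx : 0 ≤ x) (hy : 0 ≤ y) :
    LogClose δ (1 + x) (1 + y) := by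
  have h0 : 0 ≤ δ := (abs_nonneg _).trans h
  have h1 := Real.add_one_le_exp δ
  have h2 := abs_le.1 h
  constructor
  · have := mul_le_mul_of_nonneg_right h1 (by linarith : 0 ≤ 1 + y)
    nlinarith [mul_nonneg h0 hy]
  · have := mul_le_mul_of_nonneg_right h1 (by linarith : 0 ≤ 1 + x)
    nlinarith [mul_nonneg h0 hx]

/-- The edge factor is nonexpansive in the ratio, so that an error of the ratio is not amplified. -/
theorem edgeFactor_le_exp {β γ β' γ' η δ x x' : ℝ} (hβ' : 0 ≤ β') (hγ : 0 < γ) (hγ' : 0 < γ')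
    (hη : 0 ≤ η) (hδ : 0 ≤ δ) (hx : 0 ≤ x) (hx' : 0 ≤ x') (h1 : β ≤ Real.exp η * β')
    (h2 : γ' ≤ Real.exp η * γ) (h3 : x' ≤ Real.exp δ * x) (h4 : x ≤ Real.exp δ * x') :
    edgeFactor β γ x ≤ Real.exp (2 * η + δ) * edgeFactor β' γ' x' := by
  have e1 := Real.one_le_exp hη
  have e2 := Real.one_le_exp hδ
  have a1 : β * x + 1 ≤ Real.exp η * (β' * x + 1) := by nlinarith
  have a2 : x + γ' ≤ Real.exp η * (x + γ) := by nlinarith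
  have a3 : (β' * x + 1) * (x' + γ') ≤ Real.exp δ * ((β' * x' + 1) * (x + γ')) := by
    have b1 : x * γ' ≤ Real.exp δ * (x' * γ') := by nlinarith
    have b2 : β' * (x * γ') ≤ β' * (Real.exp δ * (x' * γ')) := mul_le_mul_of_nonneg_left b1 hβ'
    have b3 : β' * x * x' ≤ Real.exp δ * (β' * x * x') :=
      le_mul_of_one_le_left (by positivity) e2
    have b4 : γ' ≤ Real.exp δ * γ' := le_mul_of_one_le_left hγ'.le e2
    nlinarith
  unfold edgeFactor
  rw [div_le_iff₀ (by positivity), mul_div_assoc', div_mul_eq_mul_div, le_div_iff₀ (by positivity)]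
  calc (β * x + 1) * (x' + γ') ≤ Real.exp η * (β' * x + 1) * (x' + γ') := by gcongr
    _ = Real.exp η * ((β' * x + 1) * (x' + γ')) := by ring
    _ ≤ Real.exp η * (Real.exp δ * ((β' * x' + 1) * (x + γ'))) := by gcongr
    _ ≤ Real.exp η * (Real.exp δ * ((β' * x' + 1) * (Real.exp η * (x + γ)))) := by gcongr
    _ = _ := by rw [Real.exp_add, two_mul, Real.exp_add]; ring

theorem LogClose.edgeFactor {β γ β' γ' η δ x x' : ℝ} (hβ : 0 ≤ β) (hβ' : 0 ≤ β') (hγ : 0 < γ)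
    (hγ' : 0 < γ') (hη : 0 ≤ η) (hδ : 0 ≤ δ) (hx : 0 ≤ x) (hx' : 0 ≤ x') (h1 : LogClose η β β')
    (h2 : LogClose η γ γ') (h3 : LogClose δ x x') :
    LogClose (2 * η + δ) (edgeFactor β γ x) (TwoSpin.edgeFactor β' γ' x') :=
  ⟨edgeFactor_le_exp hβ' hγ hγ' hη hδ hx hx' h1.1 h2.2 h3.2 h3.1,
    edgeFactor_le_exp hβ hγ' hγ hη hδ hx' hx h1.2 h2.1 h3.1 h3.2⟩

/-- The inductive step of all the estimates that are linear in the budget. -/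
theorem budget_step {d m L : ℕ} (hd : d ≤ m) (hL : 1 ≤ L) :
    d * (2 + 2 * m * (L / (d + 2))) ≤ 2 * m * L := by
  have h := Nat.div_mul_le_self L (d + 2)
  set q := L / (d + 2)
  rcases Nat.eq_zero_or_pos q with hq | hq
  · rw [hq]; nlinarith
  · have h1 : 2 * m * (q * (d + 2)) ≤ 2 * m * L := Nat.mul_le_mul_left _ h
    have h2 : d ≤ m * q := hd.trans (Nat.le_mul_of_pos_right m hq)
    nlinarith

/-- The truncated recursion with perturbed parameters: the relative error is proportional to the
number of calls. -/
theorem approxRatio_logClose {β γ lam β' γ' lam' η : ℝ} (hβ : 0 ≤ β) (hβ' : 0 ≤ β') (hγ : 0 < γ)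
    (hγ' : 0 < γ') (hlam : 0 < lam) (hlam' : 0 < lam') (hη : 0 ≤ η) (h1 : LogClose η β β')
    (h2 : LogClose η γ γ') (h3 : LogClose η lam lam') (L : ℕ) :
    ∀ (ρ : List (Fin n × ℕ)) (v : Fin n), LogClose (2 * η * (1 + 2 * n * L))
      (approxRatio G β γ lam L ρ v) (approxRatio G β' γ' lam' L ρ v) := by
  induction L using Nat.strong_induction_on with
  | _ L ih =>
  intro ρ v
  rcases Nat.eq_zero_or_pos L with rfl | hL
  · rw [approxRatio_zero, approxRatio_zero]
    exact LogClose.refl (by positivity) le_rfl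
  · rw [approxRatio_of_pos G hL, approxRatio_of_pos G hL]
    set L' := L / (G.degree v + 2) with hL'
    have hδ : 0 ≤ 2 * η * (1 + 2 * n * L') := by positivity
    have hf : ∀ u ∈ G.neighborFinset v, LogClose (2 * η + 2 * η * (1 + 2 * n * L'))
        (match ρ.lookup u with
          | some s => pinFactor β γ v s
          | none => edgeFactor β γ (approxRatio G β γ lam L' ((v, (u : ℕ)) :: ρ) u))
        (match ρ.lookup u with
          | some s => pinFactor β' γ' v s
          | none => edgeFactor β' γ' (approxRatio G β' γ' lam' L' ((v, (u : ℕ)) :: ρ) u)) := by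
      intro u _
      cases ρ.lookup u with
      | some s =>
        refine LogClose.mono (δ := η) ?_ (by linarith) (pinFactor_nonneg hβ hγ _ _)
          (pinFactor_nonneg hβ' hγ' _ _)
        simp only [pinFactor]
        split_ifs
        · exact h2.inv hγ hγ'
        · exact LogClose.refl hη zero_le_one
        · exact h1
      | none =>
        exact LogClose.edgeFactor hβ hβ' hγ hγ' hη hδ (approxRatio_nonneg G hβ hγ hlam _ _ _)
          (approxRatio_nonneg G hβ' hγ' hlam' _ _ _) h1 h2
          (ih L' (Nat.div_lt_self hL (by omega)) _ _)
    have n1 : ∀ u ∈ G.neighborFinset v, 0 ≤ (match ρ.lookup u with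
          | some s => pinFactor β γ v s
          | none => edgeFactor β γ (approxRatio G β γ lam L' ((v, (u : ℕ)) :: ρ) u)) := by
      intro u _; split
      · exact pinFactor_nonneg hβ hγ _ _
      · exact (edgeFactor_pos hβ hγ (approxRatio_nonneg G hβ hγ hlam _ _ _)).le
    have n2 : ∀ u ∈ G.neighborFinset v, 0 ≤ (match ρ.lookup u with
          | some s => pinFactor β' γ' v s
          | none => edgeFactor β' γ' (approxRatio G β' γ' lam' L' ((v, (u : ℕ)) :: ρ) u)) := by
      intro u _; split
      · exact pinFactor_nonneg hβ' hγ' _ _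
      · exact (edgeFactor_pos hβ' hγ' (approxRatio_nonneg G hβ' hγ' hlam' _ _ _)).le
    refine (h3.mul (LogClose.prod hf n1 n2) hlam.le hlam'.le (Finset.prod_nonneg n1)
      (Finset.prod_nonneg n2)).mono ?_ (mul_nonneg hlam.le (Finset.prod_nonneg n1))
      (mul_nonneg hlam'.le (Finset.prod_nonneg n2))
    rw [SimpleGraph.card_neighborFinset_eq_degree]
    have hb := budget_step (degree_le_card G v) hL
    rw [← hL'] at hb
    have hb' : (G.degree v : ℝ) * (2 + 2 * n * L') ≤ 2 * n * L := by exact_mod_cast hb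
    have := mul_le_mul_of_nonneg_left hb' (by linarith : 0 ≤ 2 * η)
    nlinarith

/-! ### The partition function as a product of ratios -/

/-- The product of the numbers `1 + f ρ v` over the vertices `v = j - 1, …, 0`, where `ρ` contains
the vertices that come earlier, all of them seen as green. -/
noncomputable def ratioProduct (f : List (Fin n × ℕ) → Fin n → ℝ) :
    (j : ℕ) → j ≤ n → List (Fin n × ℕ) → ℝ
  | 0, _, _ => 1
  | j + 1, h, ρ => (1 + f ρ ⟨j, h⟩) * ratioProduct f j (Nat.le_of_succ_le h) ((⟨j, h⟩, n) :: ρ)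

theorem fieldZ_remaining (hβ : 0 ≤ β) (hγ : 0 < γ) (hlam : 0 < lam) :
    ∀ (j : ℕ) (hj : j ≤ n) (ρ : List (Fin n × ℕ)),
      remaining ρ = Finset.univ.filter (fun u : Fin n => (u : ℕ) < j) →
      fieldZ G β γ (remaining ρ) (pinnedField G β γ lam ρ) =
        γ ^ (edgesIn G (remaining ρ)).card *
          ratioProduct (exactRatio G β γ lam) j hj ρ := by
  intro j
  induction j with
  | zero =>
    intro hj ρ hρ
    have : remaining ρ = ∅ := by rw [hρ]; simp
    simp [this, fieldZ, edgesIn, ratioProduct]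
  | succ j ih =>
    intro hj ρ hρ
    set v : Fin n := ⟨j, hj⟩ with hv
    have hvmem : v ∈ remaining ρ := by rw [hρ]; simp [hv]
    have hrem : remaining ((v, n) :: ρ) = Finset.univ.filter (fun u : Fin n => (u : ℕ) < j) := by
      rw [remaining_cons, hρ]
      ext u
      simp only [Finset.mem_erase, Finset.mem_filter, Finset.mem_univ, true_and, Fin.ext_iff, hv,
        ne_eq]
      omega
    have hih := ih (Nat.le_of_succ_le hj) ((v, n) :: ρ) hrem
    have hpin : pinnedField G β γ lam ((v, n) :: ρ) =
        mulOn (G.neighborFinset v) (fun _ => γ⁻¹) (pinnedField G β γ lam ρ) := by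
      rw [pinnedField]
      congr 1
      funext x
      simp [pinFactor]
    have herase := remaining_cons (v, n) ρ
    have hins : insert v ((remaining ρ).erase v) = remaining ρ := Finset.insert_erase hvmem
    have hnot := Finset.notMem_erase v (remaining ρ)
    have h := fieldZ_insert_eq G hβ hγ hnot (pinnedField_nonneg G hβ hγ hlam ρ)
    have hcard := card_edgesIn_insert G hnot
    rw [hins] at h hcard
    rw [h, hcard, ← hpin, ← herase, hih, ratioProduct, exactRatio, herase]
    ring

theorem partitionFunction_eq (hβ : 0 ≤ β) (hγ : 0 < γ) (hlam : 0 < lam) :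
    partitionFunction G β γ lam =
      γ ^ G.edgeFinset.card * ratioProduct (exactRatio G β γ lam) n le_rfl [] := by
  have hrem : remaining ([] : List (Fin n × ℕ)) = Finset.univ := by simp [remaining]
  have h := fieldZ_remaining G hβ hγ hlam n le_rfl [] (by rw [hrem]; ext u; simp)
  have hedges : edgesIn G Finset.univ = G.edgeFinset := by ext e; simp [edgesIn]
  rw [hrem, hedges] at h
  rw [← h, ← fieldZ_univ_eq]
  rfl

theorem ratioProduct_nonneg {f : List (Fin n × ℕ) → Fin n → ℝ} (hf : ∀ ρ v, 0 ≤ f ρ v) :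
    ∀ (j : ℕ) (hj : j ≤ n) (ρ : List (Fin n × ℕ)), 0 ≤ ratioProduct f j hj ρ := by
  intro j
  induction j with
  | zero => intro _ _; exact zero_le_one
  | succ j ih =>
    intro hj ρ
    exact mul_nonneg (by linarith [hf ρ ⟨j, hj⟩]) (ih _ _)

theorem ratioProduct_logClose {f g : List (Fin n × ℕ) → Fin n → ℝ} (hf : ∀ ρ v, 0 ≤ f ρ v)
    (hg : ∀ ρ v, 0 ≤ g ρ v) {δ : ℝ}
    (h : ∀ ρ v, (v :: ρ.map Prod.fst).Nodup → ThresholdsIn ρ [] →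
      LogClose δ (1 + f ρ v) (1 + g ρ v)) :
    ∀ (j : ℕ) (hj : j ≤ n) (ρ : List (Fin n × ℕ)), (ρ.map Prod.fst).Nodup → ThresholdsIn ρ [] →
      (∀ u ∈ ρ.map Prod.fst, j ≤ (u : ℕ)) →
      LogClose (j * δ) (ratioProduct f j hj ρ) (ratioProduct g j hj ρ) := by
  intro j
  induction j with
  | zero => intro _ _ _ _ _; simp [ratioProduct, LogClose]
  | succ j ih =>
    intro hj ρ hnd hthr hlow
    have hnd' : ((⟨j, hj⟩ : Fin n) :: ρ.map Prod.fst).Nodup := by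
      refine List.nodup_cons.2 ⟨fun hmem => ?_, hnd⟩
      have := hlow _ hmem
      simp at this
    have h1 := h ρ ⟨j, hj⟩ hnd' hthr
    have h2 := ih (Nat.le_of_succ_le hj) ((⟨j, hj⟩, n) :: ρ) hnd' (by
      intro e he
      rcases List.mem_cons.1 he with rfl | he
      · exact Or.inl rfl
      · exact hthr e he) (by
      intro u hu
      rcases List.mem_cons.1 hu with rfl | hu
      · exact le_rfl
      · exact (Nat.le_succ j).trans (hlow u hu))
    have := h1.mul h2 (by linarith [hf ρ ⟨j, hj⟩]) (by linarith [hg ρ ⟨j, hj⟩])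
      (ratioProduct_nonneg hf _ _ _) (ratioProduct_nonneg hg _ _ _)
    rw [ratioProduct, ratioProduct]
    convert this using 1
    push_cast; ring

/-- The relative error of the product that the algorithm computes, from the precision `1 / M` of the
truncation and the precision `η` of the parameters. -/
theorem partitionFunction_logClose {β γ lam β' γ' lam' η : ℝ} (hβ : 0 ≤ β) (hβ' : 0 ≤ β')
    (hγ : 0 < γ) (hγ' : 0 < γ') (hlam : 0 < lam) (hlam' : 0 < lam') (hη : 0 ≤ η)
    (h1 : LogClose η β β') (h2 : LogClose η γ γ') (h3 : LogClose η lam lam') {L M : ℕ}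
    (htr : ∀ (ρ : List (Fin n × ℕ)) (v : Fin n), (v :: ρ.map Prod.fst).Nodup → ThresholdsIn ρ [] →
        |approxRatio G β γ lam L ρ v - exactRatio G β γ lam ρ v| ≤ 1 / M) :
    LogClose (n ^ 2 * η + n * (1 / M + 2 * η * (1 + 2 * n * L)))
      (γ' ^ G.edgeFinset.card * ratioProduct (approxRatio G β' γ' lam' L) n le_rfl [])
      (partitionFunction G β γ lam) := by
  have p1 := approxRatio_nonneg G hβ hγ hlam L
  have p2 := approxRatio_nonneg G hβ' hγ' hlam' L
  have p3 := exactRatio_nonneg G hβ hγ hlam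
  have hpert := approxRatio_logClose G hβ hβ' hγ hγ' hlam hlam' hη h1 h2 h3 L
  have hprod := ratioProduct_logClose p2 p3 (δ := 1 / M + 2 * η * (1 + 2 * n * L))
    (fun ρ v hnd hthr => by
      have a1 := ((hpert ρ v).symm.one_add (by positivity)).trans
        (LogClose.one_add_of_abs_sub_le (htr ρ v hnd hthr) (p1 ρ v) (p3 ρ v))
      rwa [add_comm] at a1) n le_rfl [] (by simp) (by intro e he; simp at he)
      (by intro u hu; simp at hu)
  have hm : (G.edgeFinset.card : ℝ) ≤ n ^ 2 := by
    have h := G.card_edgeFinset_le_card_choose_two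
    rw [Fintype.card_fin] at h
    have h' : n.choose 2 ≤ n ^ 2 := Nat.choose_le_pow n 2
    exact_mod_cast h.trans h'
  have q1 := ratioProduct_nonneg p2 n le_rfl []
  have q2 := ratioProduct_nonneg p3 n le_rfl []
  rw [partitionFunction_eq G hβ hγ hlam]
  refine ((h2.symm.pow hγ'.le hγ.le _).mul hprod (by positivity) (by positivity) q1 q2).mono ?_
    (by positivity) (by positivity)
  gcongr

end Walks

end TwoSpin

namespace TwoSpin

/-! ### Programs and their cost -/

/-- Evaluation with an upper bound for the cost. -/
def EvalLe (P : Program) (O : Oracle) (ρ : List Val) (a : Term) (v : Val) (T : ℕ) : Prop :=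
  ∃ t ≤ T, Eval P O ρ a v t

/-- The function number `f` of the program, applied to `v`, returns `w`, and the evaluation of its
body costs at most `T`. -/
def Returns (P : Program) (O : Oracle) (f : ℕ) (v w : Val) (T : ℕ) : Prop :=
  ∃ body, P[f]? = some body ∧ EvalLe P O [v] body w T

namespace EvalLe

variable {P : Program} {O : Oracle} {ρ : List Val} {a b c : Term} {u v w : Val} {S T W : ℕ}

theorem mono (h : EvalLe P O ρ a v S) (hST : S ≤ T) : EvalLe P O ρ a v T := by
  obtain ⟨t, ht, h⟩ := h
  exact ⟨t, ht.trans hST, h⟩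

theorem var (i : ℕ) (h : ρ.getD i (.num 0) = v) : EvalLe P O ρ (.var i) v 1 :=
  ⟨1, le_rfl, h ▸ .var ρ i⟩

theorem lit (n : ℕ) : EvalLe P O ρ (.lit n) (.num n) 1 := ⟨1, le_rfl, .lit ρ n⟩

theorem arith {o : Arith} {m n r : ℕ} (ha : EvalLe P O ρ a (.num m) S)
    (hb : EvalLe P O ρ b (.num n) T) (hr : o.apply m n = r) (hm : m.size ≤ W) (hn : n.size ≤ W) :
    EvalLe P O ρ (.arith o a b) (.num r) (S + T + 1 + 2 * W) := by
  obtain ⟨s, hs, ha⟩ := ha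
  obtain ⟨t, ht, hb⟩ := hb
  subst hr
  refine ⟨_, ?_, .arith o ha hb⟩
  simp only [Val.toNat]
  omega

theorem pair (ha : EvalLe P O ρ a v S) (hb : EvalLe P O ρ b w T) :
    EvalLe P O ρ (.pair a b) (.pair v w) (S + T + 1) := by
  obtain ⟨s, hs, ha⟩ := ha
  obtain ⟨t, ht, hb⟩ := hb
  exact ⟨_, by omega, .pair ha hb⟩

theorem fst (ha : EvalLe P O ρ a (.pair v w) S) : EvalLe P O ρ (.fst a) v (S + 1) := by
  obtain ⟨s, hs, ha⟩ := ha
  exact ⟨_, by omega, .fst ha⟩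

theorem snd (ha : EvalLe P O ρ a (.pair v w) S) : EvalLe P O ρ (.snd a) w (S + 1) := by
  obtain ⟨s, hs, ha⟩ := ha
  exact ⟨_, by omega, .snd ha⟩

theorem condTrue (hc : EvalLe P O ρ c u S) (hu : u ≠ .num 0) (ha : EvalLe P O ρ a v T) :
    EvalLe P O ρ (.cond c a b) v (S + T + 1) := by
  obtain ⟨s, hs, hc⟩ := hc
  obtain ⟨t, ht, ha⟩ := ha
  exact ⟨_, by omega, .condTrue hc hu ha⟩

theorem condFalse (hc : EvalLe P O ρ c (.num 0) S) (hb : EvalLe P O ρ b v T) :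
    EvalLe P O ρ (.cond c a b) v (S + T + 1) := by
  obtain ⟨s, hs, hc⟩ := hc
  obtain ⟨t, ht, hb⟩ := hb
  exact ⟨_, by omega, .condFalse hc (fun h => h rfl) hb⟩

theorem bind (ha : EvalLe P O ρ a v S) (hb : EvalLe P O (v :: ρ) b w T) :
    EvalLe P O ρ (.bind a b) w (S + T + 1) := by
  obtain ⟨s, hs, ha⟩ := ha
  obtain ⟨t, ht, hb⟩ := hb
  exact ⟨_, by omega, .bind ha hb⟩

theorem call {f : ℕ} (hf : Returns P O f v w T) (ha : EvalLe P O ρ a v S) :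
    EvalLe P O ρ (.call f a) w (S + T + 1) := by
  obtain ⟨s, hs, ha⟩ := ha
  obtain ⟨body, hP, t, ht, hb⟩ := hf
  exact ⟨_, by omega, .call hP ha hb⟩

theorem query (i : Fin 3) {k : ℕ} (ha : EvalLe P O ρ a (.num k) S) (hW : (O i k).size ≤ W) :
    EvalLe P O ρ (.query i a) (.num (O i k)) (S + 1 + k + W) := by
  obtain ⟨s, hs, ha⟩ := ha
  exact ⟨_, by simp only [Val.toNat]; omega, .query i ha⟩

end EvalLe

/-- Remove the first `k` entries of a list. -/
def Term.drop : ℕ → Term → Term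
  | 0, a => a
  | k + 1, a => .snd (Term.drop k a)

/-- The entry number `k` of a list. -/
def Term.item (k : ℕ) (a : Term) : Term := .fst (a.drop k)

/-- A list with given entries. -/
def Term.mkList : List Term → Term
  | [] => .lit 0
  | a :: l => .pair a (Term.mkList l)

namespace EvalLe

variable {P : Program} {O : Oracle} {ρ : List Val} {a : Term} {S : ℕ}

theorem drop (k : ℕ) {l : List Val} (h : EvalLe P O ρ a (Val.ofList l) S) (hk : k ≤ l.length) :
    EvalLe P O ρ (a.drop k) (Val.ofList (l.drop k)) (S + k) := by
  induction k with
  | zero => exact h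
  | succ k ih =>
    have ih := ih (by omega)
    have hl : l.drop k = l[k] :: l.drop (k + 1) := List.drop_eq_getElem_cons (by omega)
    rw [hl] at ih
    exact ih.snd

theorem item (k : ℕ) {l : List Val} {v : Val} (h : EvalLe P O ρ a (Val.ofList l) S)
    (hk : l[k]? = some v) : EvalLe P O ρ (a.item k) v (S + k + 1) := by
  obtain ⟨hlt, hv⟩ := List.getElem?_eq_some_iff.1 hk
  have h1 := h.drop k hlt.le
  rw [List.drop_eq_getElem_cons hlt, hv] at h1
  exact h1.fst

theorem nil : EvalLe P O ρ (Term.mkList []) (Val.ofList []) 1 := lit 0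

theorem cons {l : List Term} {v : Val} {vs : List Val} {T : ℕ} (ha : EvalLe P O ρ a v S)
    (hl : EvalLe P O ρ (Term.mkList l) (Val.ofList vs) T) :
    EvalLe P O ρ (Term.mkList (a :: l)) (Val.ofList (v :: vs)) (S + T + 1) := ha.pair hl

end EvalLe

theorem size_le_of_le {m X : ℕ} (h : m ≤ X) : m.size ≤ X :=
  Nat.size_le.2 (h.trans_lt Nat.lt_two_pow_self)

theorem size_mul_le (a b : ℕ) : (a * b).size ≤ a.size + b.size := by
  rw [Nat.size_le, pow_add]
  exact Nat.mul_lt_mul'' (Nat.lt_size_self a) (Nat.lt_size_self b)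

theorem size_add_le {a b s : ℕ} (ha : a.size ≤ s) (hb : b.size ≤ s) : (a + b).size ≤ s + 1 := by
  rw [Nat.size_le] at *
  rw [pow_succ]; omega

theorem size_pow_le (b e : ℕ) : (b ^ e).size ≤ e * b.size + 1 := by
  induction e with
  | zero => simp
  | succ e ih =>
    rw [pow_succ]
    have := size_mul_le (b ^ e) b
    rw [Nat.succ_mul]; omega

/-! ### The program -/

section Program

open Term

/-- `[l, i]` is mapped to the entry number `i` of the list `l`. -/
def nthBody : Term :=
  .cond (item 1 (.var 0))
    (.call 1 (mkList [.snd (item 0 (.var 0)), .arith .minus (item 1 (.var 0)) (.lit 1)]))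
    (.fst (item 0 (.var 0)))

/-- The length of a list. -/
def lengthBody : Term :=
  .cond (.var 0) (.arith .plus (.call 2 (.snd (.var 0))) (.lit 1)) (.lit 0)

/-- The sum of a list of numbers. -/
def sumBody : Term :=
  .cond (.var 0) (.arith .plus (.fst (.var 0)) (.call 3 (.snd (.var 0)))) (.lit 0)

/-- The sum of a list of lists of numbers. -/
def sumRowsBody : Term :=
  .cond (.var 0) (.arith .plus (.call 3 (.fst (.var 0))) (.call 4 (.snd (.var 0)))) (.lit 0)

/-- `[b, e]` is mapped to `b ^ e`. -/
def powBody : Term :=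
  .cond (item 1 (.var 0))
    (.arith .times (item 0 (.var 0))
      (.call 5 (mkList [item 0 (.var 0), .arith .minus (item 1 (.var 0)) (.lit 1)])))
    (.lit 1)

/-- `[ctx, u, v, ρ]` is mapped to the factor with which the removed vertex `u` enters the ratio at
`v`, a pair, or to `0` if `u` is not in `ρ`. Here and below `ctx` is the list of the graph, its
number of vertices, numerators for the three parameters and their common denominator. -/
def scanBody : Term :=
  .cond (item 3 (.var 0))
    (.bind (item 0 (item 3 (.var 0)))
      (.cond (.arith .plus (.arith .minus (.fst (.var 0)) (item 1 (.var 1)))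
          (.arith .minus (item 1 (.var 1)) (.fst (.var 0))))
        (.call 6 (mkList [item 0 (.var 1), item 1 (.var 1), item 2 (.var 1),
          .snd (item 3 (.var 1))]))
        (.cond (.arith .minus (.snd (.var 0)) (item 2 (.var 1)))
          (.pair (item 5 (item 0 (.var 1))) (item 3 (item 0 (.var 1))))
          (.cond (.arith .minus (item 2 (.var 1)) (.snd (.var 0)))
            (.pair (item 2 (item 0 (.var 1))) (item 5 (item 0 (.var 1))))
            (.pair (.lit 1) (.lit 1))))))
    (.lit 0)

/-- `[ctx, v, ρ, L]` is mapped to the ratio at `v`, computed with the budget `L`. -/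
def treeBody : Term :=
  .cond (item 3 (.var 0))
    (.bind (.call 1 (mkList [item 0 (item 0 (.var 0)), item 1 (.var 0)]))
      (.call 8 (mkList [item 0 (.var 1), item 1 (.var 1), item 2 (.var 1),
        .arith .quot (item 3 (.var 1)) (.arith .plus (.call 3 (.var 0)) (.lit 2)), .var 0,
        item 1 (item 0 (.var 1))])))
    (.pair (.lit 0) (.lit 1))

/-- `[ctx, v, ρ, L, row, j]` is mapped to the product of the external field and the contributions
of the neighbours of `v` below `j`; `L` is the budget of the children and `row` the row of the
adjacency matrix that belongs to `v`. -/
def loopBody : Term :=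
  .cond (item 5 (.var 0))
    (.bind (.arith .minus (item 5 (.var 0)) (.lit 1))
      (.bind (.call 8 (mkList [item 0 (.var 1), item 1 (.var 1), item 2 (.var 1), item 3 (.var 1),
          item 4 (.var 1), .var 0]))
        (.cond (.call 1 (mkList [item 4 (.var 2), .var 1]))
          (.bind
            (.bind (.call 6 (mkList [item 0 (.var 2), .var 1, item 1 (.var 2), item 2 (.var 2)]))
              (.cond (.var 0) (.var 0)
                (.call 10 (mkList [item 0 (.var 3), .call 7 (mkList [item 0 (.var 3), .var 2,
                  .pair (.pair (item 1 (.var 3)) (.var 2)) (item 2 (.var 3)),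
                  item 3 (.var 3)])]))))
            (.pair (.arith .times (.fst (.var 1)) (.fst (.var 0)))
              (.arith .times (.snd (.var 1)) (.snd (.var 0)))))
          (.var 0))))
    (.pair (item 4 (item 0 (.var 0))) (item 5 (item 0 (.var 0))))

/-- `[ctx, j, ρ, L]` is mapped to the product of `1 + R` over the ratios `R` at the vertices below
`j`, each of which is removed before the next one is considered. -/
def topBody : Term :=
  .cond (item 1 (.var 0))
    (.bind (.arith .minus (item 1 (.var 0)) (.lit 1))
      (.bind (.call 7 (mkList [item 0 (.var 1), .var 0, item 2 (.var 1), item 3 (.var 1)]))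
        (.bind (.call 9 (mkList [item 0 (.var 2), .var 1,
            .pair (.pair (.var 1) (item 1 (item 0 (.var 2)))) (item 2 (.var 2)), item 3 (.var 2)]))
          (.pair (.arith .times (.fst (.var 0)) (.arith .plus (.fst (.var 1)) (.snd (.var 1))))
            (.arith .times (.snd (.var 0)) (.snd (.var 1)))))))
    (.pair (.lit 1) (.lit 1))

/-- `[ctx, x]` is mapped to the edge factor at `x`. -/
def edgeBody : Term :=
  .pair
    (.arith .plus
      (.arith .times (item 2 (item 0 (.var 0))) (.fst (item 1 (.var 0))))
      (.arith .times (item 5 (item 0 (.var 0))) (.snd (item 1 (.var 0)))))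
    (.arith .plus
      (.arith .times (item 5 (item 0 (.var 0))) (.fst (item 1 (.var 0))))
      (.arith .times (item 3 (item 0 (.var 0))) (.snd (item 1 (.var 0)))))

/-- The main function. Its local variables are, in the order of their introduction, the number `n`
of vertices, a bound `N` for `1 / ε`, the budget `(c (n + 2) (4 (n + 1) N)) ^ k`, the precision, the
denominator of the parameters, the context, the number of edges and the product of the ratios. The
term `b` determines the numerator of the first parameter. -/
def mainBody (b : Term) (c k q : ℕ) : Term :=
  .bind (.call 2 (.fst (.var 0)))
  (.bind (.arith .plus (.arith .quot (.snd (.snd (.var 1))) (.fst (.snd (.var 1)))) (.lit 1))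
  (.bind (.call 5 (mkList [.arith .times
      (.arith .times (.lit c) (.arith .plus (.var 1) (.lit 2)))
      (.arith .times (.arith .times (.lit 4) (.arith .plus (.var 1) (.lit 1))) (.var 0)), .lit k]))
  (.bind (.arith .times
      (.arith .times (.arith .times (.lit q) (.var 1))
        (.arith .times (.arith .plus (.var 2) (.lit 1)) (.arith .plus (.var 2) (.lit 1))))
      (.arith .plus (.arith .times (.lit 4) (.var 0)) (.lit 1)))
  (.bind (.call 5 (mkList [.lit 2, .var 0]))
  (.bind (mkList [.fst (.var 5), .var 4, b, .query 1 (.var 1), .query 2 (.var 1), .var 0])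
  (.bind (.arith .quot (.call 4 (.fst (.var 6))) (.lit 2))
  (.bind (.call 9 (mkList [.var 1, .var 6, .lit 0, .var 4]))
    (.pair (.arith .times (.fst (.var 0)) (.call 5 (mkList [item 3 (.var 2), .var 1])))
      (.arith .times (.snd (.var 0)) (.call 5 (mkList [item 5 (.var 2), .var 1])))))))))))

/-- The program. -/
def program (b : Term) (c k q : ℕ) : Program :=
  [mainBody b c k q, nthBody, lengthBody, sumBody, sumRowsBody, powBody, scanBody, treeBody,
    loopBody, topBody, edgeBody]

end Program

section Lists

variable {b : Term} {c k q : ℕ} {O : Oracle}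

theorem Val.num_ne_zero {m : ℕ} (h : m ≠ 0) : Val.num m ≠ Val.num 0 := fun he => by
  injection he; contradiction

theorem returns_nth (l : List Val) (i X : ℕ) (hi : i < l.length) (hX : i ≤ X) :
    Returns (program b c k q) O 1 (Val.ofList [Val.ofList l, .num i]) l[i]
      ((i + 1) * (2 * X + 30)) := by
  induction i generalizing l with
  | zero =>
    refine ⟨nthBody, rfl, ?_⟩
    have hl : l = l[0] :: l.tail := by
      cases l with
      | nil => simp at hi
      | cons => rfl
    have h0 : EvalLe (program b c k q) O [Val.ofList [Val.ofList l, .num 0]]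
        (Term.item 0 (.var 0)) (Val.ofList (l[0] :: l.tail)) 2 := by
      rw [← hl]
      exact (EvalLe.var 0 rfl).item 0 rfl
    exact (EvalLe.condFalse ((EvalLe.var 0 rfl).item 1 rfl) h0.fst).mono (by omega)
  | succ i ih =>
    cases l with
    | nil => simp at hi
    | cons a l =>
      have hi' : i < l.length := by simpa using hi
      refine ⟨nthBody, rfl, ?_⟩
      have h0 : EvalLe (program b c k q) O [Val.ofList [Val.ofList (a :: l), .num (i + 1)]]
          (Term.item 0 (.var 0)) (Val.ofList (a :: l)) 2 := (EvalLe.var 0 rfl).item 0 rfl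
      have h1 : EvalLe (program b c k q) O [Val.ofList [Val.ofList (a :: l), .num (i + 1)]]
          (Term.item 1 (.var 0)) (.num (i + 1)) 3 := (EvalLe.var 0 rfl).item 1 rfl
      have h2 := EvalLe.arith (o := .minus) (r := i) (W := X + 1) h1 (EvalLe.lit 1) rfl
        (size_le_of_le (by omega)) (size_le_of_le (by omega))
      refine (EvalLe.condTrue h1 (Val.num_ne_zero (by omega))
        (EvalLe.call (ih l hi' (by omega)) (h0.snd.cons (h2.cons EvalLe.nil)))).mono ?_
      rw [Nat.succ_mul (i + 1)]
      omega

theorem returns_length (l : List Val) :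
    Returns (program b c k q) O 2 (Val.ofList l) (.num l.length)
      ((l.length + 1) * (2 * l.length + 20)) := by
  suffices h : ∀ X, l.length ≤ X → Returns (program b c k q) O 2 (Val.ofList l) (.num l.length)
      ((l.length + 1) * (2 * X + 20)) from h _ le_rfl
  intro X
  induction l with
  | nil => exact fun _ => ⟨lengthBody, rfl,
      (EvalLe.condFalse (EvalLe.var 0 rfl) (EvalLe.lit 0)).mono (by simp)⟩
  | cons a l ih =>
    intro hX
    rw [List.length_cons] at hX ⊢
    refine ⟨lengthBody, rfl, ?_⟩
    have h0 : EvalLe (program b c k q) O [Val.ofList (a :: l)] (.var 0)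
        (.pair a (Val.ofList l)) 1 := EvalLe.var 0 rfl
    refine (EvalLe.condTrue h0 (by simp) (EvalLe.arith (W := X + 1)
      (EvalLe.call (ih (by omega)) h0.snd) (EvalLe.lit 1) rfl
      (size_le_of_le (by omega)) (size_le_of_le (by omega)))).mono ?_
    rw [Nat.succ_mul (l.length + 1)]
    omega

theorem returns_sum (l : List ℕ) (X : ℕ) (hX : l.sum ≤ X) :
    Returns (program b c k q) O 3 (Val.ofList (l.map Val.num)) (.num l.sum)
      ((l.length + 1) * (2 * X + 20)) := by
  induction l with
  | nil => exact ⟨sumBody, rfl,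
      (EvalLe.condFalse (EvalLe.var 0 rfl) (EvalLe.lit 0)).mono (by simp)⟩
  | cons a l ih =>
    rw [List.sum_cons] at hX ⊢
    rw [List.length_cons]
    refine ⟨sumBody, rfl, ?_⟩
    have h0 : EvalLe (program b c k q) O [Val.ofList ((a :: l).map Val.num)] (.var 0)
        (.pair (.num a) (Val.ofList (l.map Val.num))) 1 := EvalLe.var 0 rfl
    refine (EvalLe.condTrue h0 (by simp) (EvalLe.arith (W := X) h0.fst
      (EvalLe.call (ih (by omega)) h0.snd) rfl
      (size_le_of_le (by omega)) (size_le_of_le (by omega)))).mono ?_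
    rw [Nat.succ_mul (l.length + 1)]
    omega

theorem returns_sumRows (l : List (List ℕ)) (X m : ℕ) (hX : (l.map List.sum).sum ≤ X)
    (hm : ∀ r ∈ l, r.length ≤ m) :
    Returns (program b c k q) O 4 (Val.ofList (l.map fun r => Val.ofList (r.map Val.num)))
      (.num (l.map List.sum).sum) ((l.length + 1) * ((m + 2) * (2 * X + 20))) := by
  induction l with
  | nil => exact ⟨sumRowsBody, rfl, (EvalLe.condFalse (EvalLe.var 0 rfl) (EvalLe.lit 0)).mono (by
      simp only [List.length_nil, zero_add, one_mul]
      nlinarith)⟩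
  | cons a l ih =>
    rw [List.map_cons, List.sum_cons] at hX
    rw [List.map_cons (f := List.sum), List.sum_cons, List.length_cons]
    refine ⟨sumRowsBody, rfl, ?_⟩
    have h0 : EvalLe (program b c k q) O [Val.ofList ((a :: l).map
        fun r => Val.ofList (r.map Val.num))] (.var 0) (.pair (Val.ofList (a.map Val.num))
        (Val.ofList (l.map fun r => Val.ofList (r.map Val.num)))) 1 := EvalLe.var 0 rfl
    refine (EvalLe.condTrue h0 (by simp) (EvalLe.arith (W := X)
      (EvalLe.call (returns_sum a X (by omega)) h0.fst)
      (EvalLe.call (ih (by omega) fun r hr => hm r (List.mem_cons_of_mem _ hr)) h0.snd) rfl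
      (size_le_of_le (by omega)) (size_le_of_le (by omega)))).mono ?_
    have ha := hm a List.mem_cons_self
    have h1 : (a.length + 1) * (2 * X + 20) ≤ (m + 1) * (2 * X + 20) :=
      Nat.mul_le_mul_right _ (by omega)
    have h2 : (m + 2) * (2 * X + 20) = (m + 1) * (2 * X + 20) + (2 * X + 20) := by ring
    rw [Nat.succ_mul (l.length + 1)]
    omega

theorem returns_pow (m e X : ℕ) (h1 : m.size ≤ X) (h2 : e ≤ X) :
    Returns (program b c k q) O 5 (Val.ofList [.num m, .num e]) (.num (m ^ e))
      ((e + 1) * (4 * (X * X + X + 1) + 30)) := by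
  induction e with
  | zero =>
    exact ⟨powBody, rfl, (EvalLe.condFalse ((EvalLe.var 0 rfl).item 1 rfl) (EvalLe.lit 1)).mono
      (by omega)⟩
  | succ e ih =>
    refine ⟨powBody, rfl, ?_⟩
    have a0 : EvalLe (program b c k q) O [Val.ofList [.num m, .num (e + 1)]]
        (Term.item 0 (.var 0)) (.num m) 2 := (EvalLe.var 0 rfl).item 0 rfl
    have a1 : EvalLe (program b c k q) O [Val.ofList [.num m, .num (e + 1)]]
        (Term.item 1 (.var 0)) (.num (e + 1)) 3 := (EvalLe.var 0 rfl).item 1 rfl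
    have a2 := EvalLe.arith (o := .minus) (r := e) (W := X) a1 (EvalLe.lit 1) rfl
      (size_le_of_le (by omega)) (size_le_of_le (by omega))
    have hs : (m ^ e).size ≤ X * X + 1 :=
      (size_pow_le m e).trans (by have := Nat.mul_le_mul (by omega : e ≤ X) h1; omega)
    refine (EvalLe.condTrue a1 (Val.num_ne_zero (by omega)) (EvalLe.arith (o := .times)
      (W := X * X + X + 1) a0
      (EvalLe.call (ih (by omega)) (a0.cons (a2.cons EvalLe.nil)))
      (by rw [Arith.apply, pow_succ, mul_comm])
      (by omega) (by omega))).mono ?_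
    rw [Nat.succ_mul (e + 1)]
    omega

end Lists

end TwoSpin

namespace TwoSpin

/-! ### Correctness and cost of the recursion -/

/-- The list of the graph, its number of vertices, numerators for the parameters and their common
denominator. -/
def ctxVal (g : Val) (n B Γ Λ K : ℕ) : Val :=
  Val.ofList [g, .num n, .num B, .num Γ, .num Λ, .num K]

/-- The code of a list of pairs (vertex, threshold). -/
def walkVal {n : ℕ} (ρ : List (Fin n × ℕ)) : Val :=
  Val.ofList (ρ.map fun p => Val.pair (.num p.1) (.num p.2))

/-- The value is a pair of a numerator and a positive denominator of at most `s` bits that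
represents `x`. -/
def IsFrac (v : Val) (x : ℝ) (s : ℕ) : Prop :=
  ∃ a d : ℕ, v = .pair (.num a) (.num d) ∧ 0 < d ∧ x = a / d ∧ a.size ≤ s ∧ d.size ≤ s

theorem IsFrac.mono {v : Val} {x : ℝ} {s t : ℕ} (h : IsFrac v x s) (hst : s ≤ t) :
    IsFrac v x t := by
  obtain ⟨a, d, hv, hd, hx, h1, h2⟩ := h
  exact ⟨a, d, hv, hd, hx, h1.trans hst, h2.trans hst⟩

/-- The result of the search for a vertex in the list of the removed vertices. -/
def scanVal (B Γ K v : ℕ) : Option ℕ → Val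
  | none => .num 0
  | some s => if v < s then .pair (.num K) (.num Γ) else
      if v = s then .pair (.num 1) (.num 1) else .pair (.num B) (.num K)

theorem isFrac_scanVal {B Γ K κ : ℕ} (hΓ : 0 < Γ) (hK : 0 < K) (hB' : B.size ≤ κ)
    (hΓ' : Γ.size ≤ κ) (hK' : K.size ≤ κ) (v s : ℕ) :
    IsFrac (scanVal B Γ K v (some s)) (pinFactor (B / K) (Γ / K) v s) κ := by
  have h1 : (1 : ℕ).size ≤ κ := by
    refine le_trans ?_ hK'
    exact Nat.size_le_size hK
  simp only [scanVal, pinFactor]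
  split_ifs
  · exact ⟨K, Γ, rfl, hΓ, by rw [inv_div], hK', hΓ'⟩
  · exact ⟨1, 1, rfl, one_pos, by simp, h1, h1⟩
  · exact ⟨B, K, rfl, hK, rfl, hB', hK'⟩

section Recursion

variable {b : Term} {c k q : ℕ} {O : Oracle} {n : ℕ}

theorem returns_scan (g : Val) (B Γ Λ K X : ℕ) (u v : Fin n) (hX : n ≤ X)
    (ρ : List (Fin n × ℕ)) (hρ : ∀ p ∈ ρ, p.2 ≤ n) :
    Returns (program b c k q) O 6
      (Val.ofList [ctxVal g n B Γ Λ K, .num u, .num v, walkVal ρ])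
      (scanVal B Γ K v (ρ.lookup u)) ((ρ.length + 1) * (12 * X + 120)) := by
  induction ρ with
  | nil => exact ⟨scanBody, rfl, (EvalLe.condFalse ((EvalLe.var 0 rfl).item 3 rfl)
      (EvalLe.lit 0)).mono (by simp)⟩
  | cons p ρ ih =>
    have ih := ih fun p hp => hρ p (List.mem_cons_of_mem _ hp)
    have hp2 := hρ p List.mem_cons_self
    have hu := u.2
    have hv := v.2
    have hp1 := p.1.2
    rw [lookup_cons_eq, List.length_cons, Nat.succ_mul (ρ.length + 1)]
    set C := ctxVal g n B Γ Λ K with hC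
    set arg := Val.ofList [C, .num u, .num v, walkVal (p :: ρ)] with harg
    set hd : Val := .pair (.num p.1) (.num p.2) with hhd
    refine ⟨scanBody, rfl, ?_⟩
    have a3 : EvalLe (program b c k q) O [arg] (Term.item 3 (.var 0))
        (Val.pair hd (walkVal ρ)) 5 := (EvalLe.var 0 rfl).item 3 rfl
    have a4 : EvalLe (program b c k q) O [arg] (Term.item 0 (Term.item 3 (.var 0))) hd 6 := a3.fst
    have b0 : EvalLe (program b c k q) O [hd, arg] (Term.fst (.var 0)) (.num p.1) 2 :=
      (EvalLe.var 0 rfl).fst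
    have b1 : EvalLe (program b c k q) O [hd, arg] (Term.snd (.var 0)) (.num p.2) 2 :=
      (EvalLe.var 0 rfl).snd
    have c0 : EvalLe (program b c k q) O [hd, arg] (Term.item 0 (.var 1)) C 2 :=
      (EvalLe.var 1 rfl).item 0 rfl
    have c1 : EvalLe (program b c k q) O [hd, arg] (Term.item 1 (.var 1)) (.num u) 3 :=
      (EvalLe.var 1 rfl).item 1 rfl
    have c2 : EvalLe (program b c k q) O [hd, arg] (Term.item 2 (.var 1)) (.num v) 4 :=
      (EvalLe.var 1 rfl).item 2 rfl
    have c3 : EvalLe (program b c k q) O [hd, arg] (Term.item 3 (.var 1))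
        (Val.pair hd (walkVal ρ)) 5 := (EvalLe.var 1 rfl).item 3 rfl
    have hne : Val.pair hd (walkVal ρ) ≠ .num 0 := by simp
    have e1 := EvalLe.arith (o := .minus) (W := X) b0 c1 rfl
      (size_le_of_le (by omega)) (size_le_of_le (by omega))
    have e2 := EvalLe.arith (o := .minus) (W := X) c1 b0 rfl
      (size_le_of_le (by omega)) (size_le_of_le (by omega))
    have e3 := EvalLe.arith (o := .plus) (W := X) e1 e2 rfl
      (size_le_of_le (by simp only [Arith.apply]; omega))
      (size_le_of_le (by simp only [Arith.apply]; omega))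
    by_cases hup : u = p.1
    · rw [if_pos hup]
      have hz : Arith.plus.apply (Arith.minus.apply p.1 u) (Arith.minus.apply u p.1) = 0 := by
        simp only [Arith.apply, hup]; omega
      rw [hz] at e3
      have f1 := EvalLe.arith (o := .minus) (W := X) b1 c2 rfl
        (size_le_of_le (by omega)) (size_le_of_le (by omega))
      have f2 := EvalLe.arith (o := .minus) (W := X) c2 b1 rfl
        (size_le_of_le (by omega)) (size_le_of_le (by omega))
      have k5 : EvalLe (program b c k q) O [hd, arg] (Term.item 5 (Term.item 0 (.var 1)))
        (.num K) 8 := EvalLe.item 5 c0 rfl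
      have k3 : EvalLe (program b c k q) O [hd, arg] (Term.item 3 (Term.item 0 (.var 1)))
        (.num Γ) 6 := EvalLe.item 3 c0 rfl
      have k2 : EvalLe (program b c k q) O [hd, arg] (Term.item 2 (Term.item 0 (.var 1)))
        (.num B) 5 := EvalLe.item 2 c0 rfl
      simp only [scanVal]
      rcases lt_trichotomy (v : ℕ) p.2 with h | h | h
      · rw [if_pos h]
        refine (EvalLe.condTrue a3 hne (EvalLe.bind a4 (EvalLe.condFalse e3
          (EvalLe.condTrue f1 (Val.num_ne_zero ?_) (k5.pair k3))))).mono (by omega)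
        simp only [Arith.apply]; omega
      · rw [if_neg (by omega), if_pos h]
        have z1 : Arith.minus.apply p.2 v = 0 := by simp only [Arith.apply]; omega
        have z2 : Arith.minus.apply v p.2 = 0 := by simp only [Arith.apply]; omega
        rw [z1] at f1
        rw [z2] at f2
        exact (EvalLe.condTrue a3 hne (EvalLe.bind a4 (EvalLe.condFalse e3
          (EvalLe.condFalse f1 (EvalLe.condFalse f2
            ((EvalLe.lit 1).pair (EvalLe.lit 1))))))).mono (by omega)
      · rw [if_neg (by omega), if_neg (by omega)]
        have z1 : Arith.minus.apply p.2 v = 0 := by simp only [Arith.apply]; omega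
        rw [z1] at f1
        refine (EvalLe.condTrue a3 hne (EvalLe.bind a4 (EvalLe.condFalse e3
          (EvalLe.condFalse f1 (EvalLe.condTrue f2 (Val.num_ne_zero ?_)
            (k2.pair k5)))))).mono (by omega)
        simp only [Arith.apply]; omega
    · rw [if_neg hup]
      have hup' : (u : ℕ) ≠ p.1 := fun h => hup (Fin.ext h)
      refine (EvalLe.condTrue a3 hne (EvalLe.bind a4 (EvalLe.condTrue e3 (Val.num_ne_zero ?_)
        (EvalLe.call ih (c0.cons (c1.cons (c2.cons (c3.snd.cons EvalLe.nil)))))))).mono (by omega)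
      simp only [Arith.apply]; omega

theorem returns_edge (g : Val) {B Γ Λ K κ s X : ℕ} (hΓ : 0 < Γ) (hK : 0 < K) (hB' : B.size ≤ κ)
    (hΓ' : Γ.size ≤ κ) (hK' : K.size ≤ κ) {t : Val} {x : ℝ} (ht : IsFrac t x s)
    (hX : κ + s + 1 ≤ X) :
    ∃ w, Returns (program b c k q) O 10 (Val.ofList [ctxVal g n B Γ Λ K, t]) w (12 * X + 80) ∧
      IsFrac w (edgeFactor (B / K) (Γ / K) x) (κ + s + 1) := by
  obtain ⟨a, d, rfl, hd, rfl, ha', hd'⟩ := ht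
  have s1 : (B * a).size ≤ κ + s := (size_mul_le B a).trans (by omega)
  have s2 : (K * d).size ≤ κ + s := (size_mul_le K d).trans (by omega)
  have s3 : (K * a).size ≤ κ + s := (size_mul_le K a).trans (by omega)
  have s4 : (Γ * d).size ≤ κ + s := (size_mul_le Γ d).trans (by omega)
  refine ⟨.pair (.num (B * a + K * d)) (.num (K * a + Γ * d)), ⟨edgeBody, rfl, ?_⟩,
    B * a + K * d, K * a + Γ * d, rfl, by positivity, ?_, size_add_le s1 s2, size_add_le s3 s4⟩
  · set arg := Val.ofList [ctxVal g n B Γ Λ K, .pair (.num a) (.num d)] with harg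
    have a0 : EvalLe (program b c k q) O [arg] (Term.item 0 (.var 0)) (ctxVal g n B Γ Λ K) 2 :=
      (EvalLe.var 0 rfl).item 0 rfl
    have a1 : EvalLe (program b c k q) O [arg] (Term.item 1 (.var 0)) (.pair (.num a) (.num d)) 3 :=
      (EvalLe.var 0 rfl).item 1 rfl
    have k5 : EvalLe (program b c k q) O [arg] (Term.item 5 (Term.item 0 (.var 0)))
      (.num K) 8 := EvalLe.item 5 a0 rfl
    have k3 : EvalLe (program b c k q) O [arg] (Term.item 3 (Term.item 0 (.var 0)))
      (.num Γ) 6 := EvalLe.item 3 a0 rfl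
    have k2 : EvalLe (program b c k q) O [arg] (Term.item 2 (Term.item 0 (.var 0)))
      (.num B) 5 := EvalLe.item 2 a0 rfl
    have m1 := EvalLe.arith (o := .times) (W := X) k2 a1.fst rfl (by omega) (by omega)
    have m2 := EvalLe.arith (o := .times) (W := X) k5 a1.snd rfl (by omega) (by omega)
    have m3 := EvalLe.arith (o := .times) (W := X) k5 a1.fst rfl (by omega) (by omega)
    have m4 := EvalLe.arith (o := .times) (W := X) k3 a1.snd rfl (by omega) (by omega)
    refine (EvalLe.pair (EvalLe.arith (o := .plus) (W := X) m1 m2 rfl ?_ ?_)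
      (EvalLe.arith (o := .plus) (W := X) m3 m4 rfl ?_ ?_)).mono (by omega) <;>
    simp only [Arith.apply] <;> omega
  · have hd0 : (0 : ℝ) < d := by exact_mod_cast hd
    have hK0 : (0 : ℝ) < K := by exact_mod_cast hK
    have hΓ0 : (0 : ℝ) < Γ := by exact_mod_cast hΓ
    unfold edgeFactor
    push_cast
    have e1 : (B : ℝ) / K * (a / d) + 1 = (B * a + K * d) / (K * d) := by field_simp
    have e2 : (a : ℝ) / d + Γ / K = (K * a + Γ * d) / (K * d) := by field_simp
    rw [e1, e2, div_div_div_cancel_right₀ (by positivity)]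

variable (G : SimpleGraph (Fin n)) [DecidableRel G.Adj]

/-- A row of the adjacency matrix. -/
def rowList (v : Fin n) : List ℕ := List.ofFn fun j : Fin n => if G.Adj v j then 1 else 0

theorem length_rowList (v : Fin n) : (rowList G v).length = n := by simp [rowList]

theorem sum_rowList (v : Fin n) : (rowList G v).sum = G.degree v := by
  rw [rowList, List.sum_ofFn, Finset.sum_boole, ← SimpleGraph.card_neighborFinset_eq_degree,
    SimpleGraph.neighborFinset_eq_filter]
  rfl

theorem encodeGraph_eq : encodeGraph G =
    Val.ofList ((List.ofFn (rowList G)).map fun r => Val.ofList (r.map Val.num)) := by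
  simp only [encodeGraph, rowList, List.map_ofFn, Function.comp_def]

/-- The contribution of the neighbour `u` to the ratio at `v`, computed with approximate parameters
and a budget `L` for `u`. -/
noncomputable def contribution (β γ lam : ℝ) (L : ℕ) (ρ : List (Fin n × ℕ)) (v u : Fin n) : ℝ :=
  match ρ.lookup u with
    | some s => pinFactor β γ v s
    | none => edgeFactor β γ (approxRatio G β γ lam L ((v, (u : ℕ)) :: ρ) u)

/-- The neighbours of `v` below `j`. -/
def nbrsBelow (v : Fin n) (j : ℕ) : Finset (Fin n) :=
  (G.neighborFinset v).filter fun u => (u : ℕ) < j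

theorem nbrsBelow_succ (v : Fin n) {j : ℕ} (hj : j < n) :
    nbrsBelow G v (j + 1) =
      if G.Adj v ⟨j, hj⟩ then insert ⟨j, hj⟩ (nbrsBelow G v j) else nbrsBelow G v j := by
  have hiff : ∀ u : Fin n, (u : ℕ) < j + 1 ↔ u = ⟨j, hj⟩ ∨ (u : ℕ) < j := fun u => by
    rw [Fin.ext_iff]; simp only; omega
  ext u
  split_ifs with h
  · simp only [nbrsBelow, Finset.mem_filter, SimpleGraph.mem_neighborFinset, Finset.mem_insert,
      hiff]
    constructor
    · rintro ⟨h1, h2 | h2⟩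
      · exact Or.inl h2
      · exact Or.inr ⟨h1, h2⟩
    · rintro (rfl | ⟨h1, h2⟩)
      · exact ⟨h, Or.inl rfl⟩
      · exact ⟨h1, Or.inr h2⟩
  · simp only [nbrsBelow, Finset.mem_filter, SimpleGraph.mem_neighborFinset, hiff]
    constructor
    · rintro ⟨h1, rfl | h2⟩
      · exact absurd h1 h
      · exact ⟨h1, h2⟩
    · exact fun h1 => ⟨h1.1, Or.inr h1.2⟩

theorem notMem_nbrsBelow (v : Fin n) {j : ℕ} (hj : j < n) : (⟨j, hj⟩ : Fin n) ∉ nbrsBelow G v j := by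
  simp [nbrsBelow]

theorem nbrsBelow_self (v : Fin n) : nbrsBelow G v n = G.neighborFinset v := by
  ext u; simp [nbrsBelow]

/-- The data that the functions for the recursion work with: approximate parameters `B / K`,
`Γ / K` and `Λ / K` of at most `κ` bits. -/
structure NumericParams (B Γ Λ K κ : ℕ) : Prop where
  posΓ : 0 < Γ
  posK : 0 < K
  sizeB : B.size + 1 ≤ κ
  sizeΓ : Γ.size + 1 ≤ κ
  sizeΛ : Λ.size + 1 ≤ κ
  sizeK : K.size + 1 ≤ κ

theorem returns_loop {B Γ Λ K κ X T L : ℕ} (hp : NumericParams B Γ Λ K κ) (ρ : List (Fin n × ℕ))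
    (v : Fin n) (hnX : n ≤ X) (hρ : ∀ p ∈ ρ, p.2 ≤ n) (hlen : ρ.length ≤ n)
    (hX : κ + G.degree v * (κ * (2 + 2 * n * L)) ≤ X)
    (htree : ∀ u : Fin n, G.Adj v u → ρ.lookup u = none → ∃ w,
      Returns (program b c k q) O 7 (Val.ofList [ctxVal (encodeGraph G) n B Γ Λ K, .num u,
        walkVal ((v, (u : ℕ)) :: ρ), .num L]) w T ∧
      IsFrac w (approxRatio G (B / K) (Γ / K) (Λ / K) L ((v, (u : ℕ)) :: ρ) u)
        (κ * (1 + 2 * n * L))) :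
    ∀ j, j ≤ n → ∃ w,
      Returns (program b c k q) O 8 (Val.ofList [ctxVal (encodeGraph G) n B Γ Λ K, .num v,
        walkVal ρ, .num L, Val.ofList ((rowList G v).map Val.num), .num j]) w
        ((j + 1) * (20 * (X + 15) ^ 2) + (nbrsBelow G v j).card * T) ∧
      IsFrac w (Λ / K * ∏ u ∈ nbrsBelow G v j, contribution G (B / K) (Γ / K) (Λ / K) L ρ v u)
        (κ + (nbrsBelow G v j).card * (κ * (2 + 2 * n * L))) := by
  intro j
  have hX2 : 20 * (X + 15) ^ 2 = 20 * (X * X) + 600 * X + 4500 := by ring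
  induction j with
  | zero =>
    intro _
    have h0 : nbrsBelow G v 0 = ∅ := by ext u; simp [nbrsBelow]
    refine ⟨.pair (.num Λ) (.num K), ⟨loopBody, rfl, (EvalLe.condFalse
      ((EvalLe.var 0 rfl).item 5 rfl) (EvalLe.pair
        (EvalLe.item 4 ((EvalLe.var 0 rfl).item 0 rfl) rfl)
        (EvalLe.item 5 ((EvalLe.var 0 rfl).item 0 rfl) rfl))).mono ?_⟩,
      Λ, K, rfl, hp.posK, by simp [h0], ?_, ?_⟩
    · omega
    · have := hp.sizeΛ; omega
    · have := hp.sizeK; omega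
  | succ j ih =>
    intro hj
    obtain ⟨acc, hacc, hfrac⟩ := ih (by omega)
    set C := ctxVal (encodeGraph G) n B Γ Λ K with hC
    set row := Val.ofList ((rowList G v).map Val.num) with hrow
    set arg := Val.ofList [C, .num v, walkVal ρ, .num L, row, .num (j + 1)] with harg
    set u : Fin n := ⟨j, hj⟩ with hu
    have a5 : EvalLe (program b c k q) O [arg] (Term.item 5 (.var 0)) (.num (j + 1)) 7 :=
      (EvalLe.var 0 rfl).item 5 rfl
    have au := EvalLe.arith (o := .minus) (r := j) (W := X + 1) a5 (EvalLe.lit 1) rfl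
      (size_le_of_le (by omega)) (size_le_of_le (by omega))
    have b0 : EvalLe (program b c k q) O [.num j, arg] (Term.item 0 (.var 1)) C 2 :=
      (EvalLe.var 1 rfl).item 0 rfl
    have b1 : EvalLe (program b c k q) O [.num j, arg] (Term.item 1 (.var 1)) (.num v) 3 :=
      (EvalLe.var 1 rfl).item 1 rfl
    have b2 : EvalLe (program b c k q) O [.num j, arg] (Term.item 2 (.var 1)) (walkVal ρ) 4 :=
      (EvalLe.var 1 rfl).item 2 rfl
    have b3 : EvalLe (program b c k q) O [.num j, arg] (Term.item 3 (.var 1)) (.num L) 5 :=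
      (EvalLe.var 1 rfl).item 3 rfl
    have b4 : EvalLe (program b c k q) O [.num j, arg] (Term.item 4 (.var 1)) row 6 :=
      (EvalLe.var 1 rfl).item 4 rfl
    have b5 : EvalLe (program b c k q) O [.num j, arg] (Term.var 0) (.num j) 1 :=
      EvalLe.var 0 rfl
    have bacc := EvalLe.call hacc
      (b0.cons (b1.cons (b2.cons (b3.cons (b4.cons (b5.cons EvalLe.nil))))))
    have c4 : EvalLe (program b c k q) O [acc, .num j, arg] (Term.item 4 (.var 2)) row 6 :=
      (EvalLe.var 2 rfl).item 4 rfl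
    have c5 : EvalLe (program b c k q) O [acc, .num j, arg] (Term.var 1) (.num j) 1 :=
      EvalLe.var 1 rfl
    have hlenrow : j < ((rowList G v).map Val.num).length := by
      rw [List.length_map, length_rowList]; exact hj
    have cnth := EvalLe.call (returns_nth (b := b) (c := c) (k := k) (q := q) (O := O)
      ((rowList G v).map Val.num) j X hlenrow (by omega)) (c4.cons (c5.cons EvalLe.nil))
    have hentry : ((rowList G v).map Val.num)[j] = .num (if G.Adj v u then 1 else 0) := by
      simp [rowList, hu]
    rw [hentry] at cnth
    have hnth : (j + 1) * (2 * X + 30) ≤ (X + 1) * (2 * X + 30) := Nat.mul_le_mul_right _ (by omega)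
    have hnth2 : (X + 1) * (2 * X + 30) = 2 * (X * X) + 32 * X + 30 := by ring
    rw [nbrsBelow_succ G v hj, Nat.succ_mul (j + 1)]
    by_cases hadj : G.Adj v u
    · rw [if_pos hadj] at cnth
      rw [if_pos hadj, Finset.prod_insert (notMem_nbrsBelow G v hj),
        Finset.card_insert_of_notMem (notMem_nbrsBelow G v hj)]
      -- the contribution of the neighbour `u`
      obtain ⟨f, hf, hff⟩ : ∃ f, EvalLe (program b c k q) O [acc, .num j, arg]
          (.bind (.call 6 (Term.mkList [Term.item 0 (.var 2), .var 1, Term.item 1 (.var 2),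
              Term.item 2 (.var 2)]))
            (.cond (.var 0) (.var 0)
              (.call 10 (Term.mkList [Term.item 0 (.var 3), .call 7 (Term.mkList
                [Term.item 0 (.var 3), .var 2,
                .pair (.pair (Term.item 1 (.var 3)) (.var 2)) (Term.item 2 (.var 3)),
                Term.item 3 (.var 3)])])))) f (12 * (X * X) + 200 * X + 500 + T) ∧
          IsFrac f (contribution G (B / K) (Γ / K) (Λ / K) L ρ v u) (κ * (2 + 2 * n * L)) := by
        have d0 : EvalLe (program b c k q) O [acc, .num j, arg] (Term.item 0 (.var 2)) C 2 :=
          (EvalLe.var 2 rfl).item 0 rfl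
        have d1 : EvalLe (program b c k q) O [acc, .num j, arg] (Term.item 1 (.var 2)) (.num v) 3 :=
          (EvalLe.var 2 rfl).item 1 rfl
        have d2 : EvalLe (program b c k q) O [acc, .num j, arg] (Term.item 2 (.var 2))
            (walkVal ρ) 4 := (EvalLe.var 2 rfl).item 2 rfl
        have hscan := returns_scan (b := b) (c := c) (k := k) (q := q) (O := O) (encodeGraph G)
          B Γ Λ K X u v hnX ρ hρ
        have dscan := EvalLe.call hscan (d0.cons (c5.cons (d1.cons (d2.cons EvalLe.nil))))
        have hs1 : (ρ.length + 1) * (12 * X + 120) ≤ (X + 1) * (12 * X + 120) :=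
          Nat.mul_le_mul_right _ (by omega)
        have hs2 : (X + 1) * (12 * X + 120) = 12 * (X * X) + 132 * X + 120 := by ring
        unfold contribution
        cases hlook : ρ.lookup u with
        | some s =>
          rw [hlook] at dscan
          refine ⟨_, (EvalLe.bind dscan (EvalLe.condTrue (EvalLe.var 0 rfl) ?_
            (EvalLe.var 0 rfl))).mono (by omega), ?_⟩
          · simp only [List.getD_cons_zero, scanVal]
            split_ifs <;> simp
          · refine (isFrac_scanVal hp.posΓ hp.posK (κ := κ) ?_ ?_ ?_ _ _).mono
              (Nat.le_mul_of_pos_right κ (by omega))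
            · have := hp.sizeB; omega
            · have := hp.sizeΓ; omega
            · have := hp.sizeK; omega
        | none =>
          rw [hlook] at dscan
          obtain ⟨t, ht, htf⟩ := htree u hadj hlook
          have e0 : EvalLe (program b c k q) O [.num 0, acc, .num j, arg]
            (Term.item 0 (.var 3)) C 2 := (EvalLe.var 3 rfl).item 0 rfl
          have e1 : EvalLe (program b c k q) O [.num 0, acc, .num j, arg]
            (Term.item 1 (.var 3)) (.num v) 3 := (EvalLe.var 3 rfl).item 1 rfl
          have e2 : EvalLe (program b c k q) O [.num 0, acc, .num j, arg]
            (Term.item 2 (.var 3)) (walkVal ρ) 4 := (EvalLe.var 3 rfl).item 2 rfl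
          have e3 : EvalLe (program b c k q) O [.num 0, acc, .num j, arg]
            (Term.item 3 (.var 3)) (.num L) 5 := (EvalLe.var 3 rfl).item 3 rfl
          have e4 : EvalLe (program b c k q) O [.num 0, acc, .num j, arg]
            (.var 2) (.num j) 1 := EvalLe.var 2 rfl
          have ew : EvalLe (program b c k q) O [.num 0, acc, .num j, arg]
            (.pair (.pair (Term.item 1 (.var 3)) (.var 2)) (Term.item 2 (.var 3)))
            (walkVal ((v, (u : ℕ)) :: ρ)) 10 := (e1.pair e4).pair e2
          have et := EvalLe.call ht (e0.cons (e4.cons (ew.cons (e3.cons EvalLe.nil))))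
          have hdpos : 0 < G.degree v := by
            rw [← SimpleGraph.card_neighborFinset_eq_degree]
            exact Finset.card_pos.2 ⟨u, by rwa [SimpleGraph.mem_neighborFinset]⟩
          have hκ : κ * (2 + 2 * n * L) = κ + κ * (1 + 2 * n * L) := by ring
          have hXd : κ * (2 + 2 * n * L) ≤ X := by
            have := Nat.le_mul_of_pos_left (κ * (2 + 2 * n * L)) hdpos
            omega
          have hκ1 := hp.sizeK
          have s1 := hp.sizeB
          have s2 := hp.sizeΓ
          obtain ⟨w, hw, hwf⟩ := returns_edge (b := b) (c := c) (k := k) (q := q) (O := O) (n := n)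
            (B := B) (Λ := Λ) (encodeGraph G) hp.posΓ hp.posK (κ := κ - 1) (X := X) (by omega) (by omega)
            (by omega) htf (by omega)
          have ee := EvalLe.call hw (e0.cons (et.cons EvalLe.nil))
          refine ⟨w, (EvalLe.bind dscan (EvalLe.condFalse (EvalLe.var 0 rfl) ee)).mono (by omega),
            hwf.mono (by omega)⟩
      obtain ⟨fa, fd, rfl, hfd, hfx, hfa', hfd'⟩ := hff
      obtain ⟨aa, ad, rfl, had, hax, haa', had'⟩ := hfrac
      have hcard : (nbrsBelow G v j).card + 1 ≤ G.degree v := by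
        rw [← Finset.card_insert_of_notMem (notMem_nbrsBelow G v hj),
          ← SimpleGraph.card_neighborFinset_eq_degree]
        refine Finset.card_le_card fun x hx => ?_
        rcases Finset.mem_insert.1 hx with rfl | hx
        · rwa [SimpleGraph.mem_neighborFinset]
        · exact (Finset.mem_filter.1 hx).1
      have hXc := Nat.mul_le_mul_right (κ * (2 + 2 * n * L)) hcard
      rw [Nat.succ_mul] at hXc
      refine ⟨.pair (.num (aa * fa)) (.num (ad * fd)), ⟨loopBody, rfl, ?_⟩,
        aa * fa, ad * fd, rfl, Nat.mul_pos had hfd, ?_, ?_, ?_⟩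
      · have g1 : ∀ o : Val, EvalLe (program b c k q) O [o, .pair (.num aa) (.num ad), .num j, arg]
            (.var 1) (.pair (.num aa) (.num ad)) 1 := fun o => EvalLe.var 1 rfl
        have g0 : EvalLe (program b c k q) O [.pair (.num fa) (.num fd),
            .pair (.num aa) (.num ad), .num j, arg]
            (.var 0) (.pair (.num fa) (.num fd)) 1 := EvalLe.var 0 rfl
        have m1 := EvalLe.arith (o := .times) (W := X) (g1 _).fst g0.fst rfl (by omega) (by omega)
        have m2 := EvalLe.arith (o := .times) (W := X) (g1 _).snd g0.snd rfl (by omega) (by omega)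
        refine (EvalLe.condTrue a5 (Val.num_ne_zero (by omega)) (EvalLe.bind au (EvalLe.bind bacc
          (EvalLe.condTrue cnth (Val.num_ne_zero one_ne_zero)
            (EvalLe.bind hf (m1.pair m2)))))).mono ?_
        rw [Nat.succ_mul (nbrsBelow G v j).card]
        omega
      · rw [hfx] at *
        rw [mul_left_comm, hax]
        push_cast
        rw [div_mul_div_comm, mul_comm (fa : ℝ), mul_comm (fd : ℝ)]
      · rw [Nat.succ_mul]; exact (size_mul_le _ _).trans (by omega)
      · rw [Nat.succ_mul]; exact (size_mul_le _ _).trans (by omega)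
    · rw [if_neg hadj] at cnth
      rw [if_neg hadj]
      refine ⟨acc, ⟨loopBody, rfl, (EvalLe.condTrue a5 (Val.num_ne_zero (by omega))
        (EvalLe.bind au (EvalLe.bind bacc (EvalLe.condFalse cnth (EvalLe.var 0 rfl))))).mono ?_⟩,
        hfrac⟩
      omega

theorem length_le_of_nodup {ρ : List (Fin n × ℕ)} {v : Fin n} (h : (v :: ρ.map Prod.fst).Nodup) :
    ρ.length ≤ n := by
  have := h.length_le_card
  simp at this
  omega

/-- The recursion is computed exactly for the approximate parameters; sizes and cost are linear in
the budget. -/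
theorem returns_tree {B Γ Λ K κ X : ℕ} (hp : NumericParams B Γ Λ K κ) (hnX : n ≤ X) (L : ℕ) :
    ∀ (ρ : List (Fin n × ℕ)) (v : Fin n), (v :: ρ.map Prod.fst).Nodup → (∀ p ∈ ρ, p.2 ≤ n) →
      κ * (1 + 2 * n * L) ≤ X → ∃ w,
      Returns (program b c k q) O 7 (Val.ofList [ctxVal (encodeGraph G) n B Γ Λ K, .num v,
        walkVal ρ, .num L]) w ((X + 3) * (20 * (X + 15) ^ 2) * (1 + 2 * n * L)) ∧
      IsFrac w (approxRatio G (B / K) (Γ / K) (Λ / K) L ρ v) (κ * (1 + 2 * n * L)) := by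
  induction L using Nat.strong_induction_on with
  | _ L ih =>
  intro ρ v hnd hρ hX
  have hX2 : 20 * (X + 15) ^ 2 = 20 * (X * X) + 600 * X + 4500 := by ring
  have hκ := hp.sizeK
  rcases Nat.eq_zero_or_pos L with rfl | hL
  · refine ⟨.pair (.num 0) (.num 1), ⟨treeBody, rfl, (EvalLe.condFalse
      ((EvalLe.var 0 rfl).item 3 rfl) (EvalLe.pair (EvalLe.lit 0) (EvalLe.lit 1))).mono ?_⟩,
      0, 1, rfl, one_pos, by rw [approxRatio_zero]; simp, by simp, ?_⟩
    · nlinarith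
    · simp only [Nat.size_one]; nlinarith
  · set C := ctxVal (encodeGraph G) n B Γ Λ K with hC
    set L' := L / (G.degree v + 2) with hL'
    have hL'lt : L' < L := Nat.div_lt_self hL (by omega)
    have hdn := degree_le_card G v
    have hstep := budget_step hdn hL
    rw [← hL'] at hstep
    have hn1 : 1 ≤ n := by have := v.2; omega
    have hLX : L ≤ X := by
      have h1 : 1 * L ≤ n * L := Nat.mul_le_mul_right _ hn1
      have h2 : 1 * (1 + 2 * n * L) ≤ κ * (1 + 2 * n * L) := Nat.mul_le_mul_right _ (by omega)
      nlinarith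
    have hsize : κ + G.degree v * (κ * (2 + 2 * n * L')) ≤ κ * (1 + 2 * n * L) := by
      have := Nat.mul_le_mul_left κ hstep
      nlinarith
    have hX' : κ * (1 + 2 * n * L') ≤ X := by
      refine le_trans (Nat.mul_le_mul_left κ ?_) hX
      have : 2 * n * L' ≤ 2 * n * L := Nat.mul_le_mul_left _ hL'lt.le
      omega
    have hloop := returns_loop (b := b) (c := c) (k := k) (q := q) (O := O) G hp ρ v hnX hρ
      (length_le_of_nodup hnd) (hsize.trans hX) (fun u hadj hlook =>
        ih L' hL'lt ((v, (u : ℕ)) :: ρ) u (by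
          refine List.nodup_cons.2 ⟨?_, hnd⟩
          rw [List.map_cons, List.mem_cons, not_or]
          exact ⟨hadj.ne', lookup_eq_none.1 hlook⟩) (by
          intro p hp
          rcases List.mem_cons.1 hp with rfl | hp
          · exact u.2.le
          · exact hρ p hp) hX') n le_rfl
    obtain ⟨w, hw, hwf⟩ := hloop
    rw [nbrsBelow_self, SimpleGraph.card_neighborFinset_eq_degree] at hw hwf
    refine ⟨w, ⟨treeBody, rfl, ?_⟩, ?_⟩
    · set row := Val.ofList ((rowList G v).map Val.num) with hrow
      set arg := Val.ofList [C, .num v, walkVal ρ, .num L] with harg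
      have a0 : EvalLe (program b c k q) O [arg] (Term.item 0 (.var 0)) C 2 :=
        (EvalLe.var 0 rfl).item 0 rfl
      have a1 : EvalLe (program b c k q) O [arg] (Term.item 1 (.var 0)) (.num v) 3 :=
        (EvalLe.var 0 rfl).item 1 rfl
      have a3 : EvalLe (program b c k q) O [arg] (Term.item 3 (.var 0)) (.num L) 5 :=
        (EvalLe.var 0 rfl).item 3 rfl
      have ag : EvalLe (program b c k q) O [arg] (Term.item 0 (Term.item 0 (.var 0)))
        (encodeGraph G) 3 := EvalLe.item 0 a0 rfl
      rw [encodeGraph_eq] at ag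
      have hlen : (v : ℕ) < ((List.ofFn (rowList G)).map
          fun r => Val.ofList (r.map Val.num)).length := by simp
      have hnth := returns_nth (b := b) (c := c) (k := k) (q := q) (O := O)
        ((List.ofFn (rowList G)).map fun r => Val.ofList (r.map Val.num)) v X hlen
        (v.2.le.trans hnX)
      have hentry : ((List.ofFn (rowList G)).map
          fun r => Val.ofList (r.map Val.num))[(v : ℕ)] = row := by simp [hrow]
      rw [hentry] at hnth
      have arow := EvalLe.call hnth (ag.cons (a1.cons EvalLe.nil))
      have b0 : EvalLe (program b c k q) O [row, arg] (Term.item 0 (.var 1)) C 2 :=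
        (EvalLe.var 1 rfl).item 0 rfl
      have b1 : EvalLe (program b c k q) O [row, arg] (Term.item 1 (.var 1)) (.num v) 3 :=
        (EvalLe.var 1 rfl).item 1 rfl
      have b2 : EvalLe (program b c k q) O [row, arg] (Term.item 2 (.var 1)) (walkVal ρ) 4 :=
        (EvalLe.var 1 rfl).item 2 rfl
      have b3 : EvalLe (program b c k q) O [row, arg] (Term.item 3 (.var 1)) (.num L) 5 :=
        (EvalLe.var 1 rfl).item 3 rfl
      have b4 : EvalLe (program b c k q) O [row, arg] (.var 0) row 1 := EvalLe.var 0 rfl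
      have b5 : EvalLe (program b c k q) O [row, arg] (Term.item 1 (Term.item 0 (.var 1)))
        (.num n) 4 := EvalLe.item 1 b0 rfl
      have hsum := returns_sum (b := b) (c := c) (k := k) (q := q) (O := O) (rowList G v) X (by
        rw [sum_rowList]; omega)
      rw [sum_rowList, length_rowList] at hsum
      have bsum := EvalLe.arith (o := .plus) (W := X + 2) (EvalLe.call hsum b4) (EvalLe.lit 2) rfl
        (size_le_of_le (by omega)) (size_le_of_le (by omega))
      have bdiv := EvalLe.arith (o := .quot) (W := X + 2) (r := L') b3 bsum rfl
        (size_le_of_le (by omega)) (size_le_of_le (by simp only [Arith.apply]; omega))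
      refine (EvalLe.condTrue a3 (Val.num_ne_zero (by omega)) (EvalLe.bind arow (EvalLe.call hw
        (b0.cons (b1.cons (b2.cons (bdiv.cons (b4.cons (b5.cons EvalLe.nil))))))))).mono ?_
      set Q := 20 * (X + 15) ^ 2 with hQ
      have h1 : ((v : ℕ) + 1) * (2 * X + 30) ≤ (X + 1) * (2 * X + 30) :=
        Nat.mul_le_mul_right _ (by have := v.2; omega)
      have h2 : (X + 1) * (2 * X + 30) = 2 * (X * X) + 32 * X + 30 := by ring
      have h3 : (n + 1) * (2 * X + 20) ≤ (X + 1) * (2 * X + 20) :=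
        Nat.mul_le_mul_right _ (by omega)
      have h4 : (X + 1) * (2 * X + 20) = 2 * (X * X) + 22 * X + 20 := by ring
      have h5 : (n + 1) * Q ≤ (X + 1) * Q := Nat.mul_le_mul_right _ (by omega)
      have h6 : (X + 3) * Q = (X + 1) * Q + 2 * Q := by ring
      have h7 : G.degree v * ((X + 3) * Q * (1 + 2 * n * L')) ≤ (X + 3) * Q * (2 * n * L) := by
        calc _ = (X + 3) * Q * (G.degree v * (1 + 2 * n * L')) := by ring
          _ ≤ (X + 3) * Q * (2 * n * L) := Nat.mul_le_mul_left _ (le_trans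
            (Nat.mul_le_mul_left _ (by omega)) hstep)
      have h8 : (X + 3) * Q * (1 + 2 * n * L) = (X + 3) * Q + (X + 3) * Q * (2 * n * L) := by ring
      omega
    · rw [approxRatio_of_pos G hL]
      exact hwf.mono hsize

end Recursion

end TwoSpin

namespace TwoSpin

section Main

variable {b : Term} {c k q : ℕ} {O : Oracle} {n : ℕ} (G : SimpleGraph (Fin n)) [DecidableRel G.Adj]

theorem returns_top {B Γ Λ K κ X L : ℕ} (hp : NumericParams B Γ Λ K κ) (hnX : n ≤ X)
    (hX : (n + 1) * (κ * (1 + 2 * n * L) + 1) ≤ X) :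
    ∀ (j : ℕ) (hj : j ≤ n) (ρ : List (Fin n × ℕ)), (ρ.map Prod.fst).Nodup → (∀ p ∈ ρ, p.2 ≤ n) →
      (∀ u ∈ ρ.map Prod.fst, j ≤ (u : ℕ)) → ∃ w,
      Returns (program b c k q) O 9 (Val.ofList [ctxVal (encodeGraph G) n B Γ Λ K, .num j,
        walkVal ρ, .num L]) w
        ((j + 1) * ((X + 3) * (20 * (X + 15) ^ 2) * (1 + 2 * n * L) + 10 * X + 100)) ∧
      IsFrac w (ratioProduct (approxRatio G (B / K) (Γ / K) (Λ / K) L) j hj ρ)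
        (1 + j * (κ * (1 + 2 * n * L) + 1)) := by
  set s := κ * (1 + 2 * n * L) with hs
  set T := (X + 3) * (20 * (X + 15) ^ 2) * (1 + 2 * n * L) with hT
  have hX1 : (n + 1) * (s + 1) = n * (s + 1) + (s + 1) := by ring
  intro j
  induction j with
  | zero =>
    intro _ ρ _ _ _
    refine ⟨.pair (.num 1) (.num 1), ⟨topBody, rfl, (EvalLe.condFalse
      ((EvalLe.var 0 rfl).item 1 rfl) (EvalLe.pair (EvalLe.lit 1) (EvalLe.lit 1))).mono
      (by omega)⟩, 1, 1, rfl, one_pos, by simp [ratioProduct], by simp, by simp⟩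
  | succ j ih =>
    intro hj ρ hnd hρ hlow
    set v : Fin n := ⟨j, hj⟩ with hv
    have hnd' : (v :: ρ.map Prod.fst).Nodup := by
      refine List.nodup_cons.2 ⟨fun hmem => ?_, hnd⟩
      have := hlow _ hmem
      simp [hv] at this
    obtain ⟨t, ht, hta, htd, rfl, htd0, htx, hta', htd'⟩ := returns_tree (b := b) (c := c) (k := k)
      (q := q) (O := O) G hp hnX L ρ v hnd' hρ (by omega)
    obtain ⟨y, hy, hya, hyd, rfl, hyd0, hyx, hya', hyd'⟩ := ih (Nat.le_of_succ_le hj)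
      ((v, n) :: ρ) hnd' (by
        intro p hp
        rcases List.mem_cons.1 hp with rfl | hp
        · exact le_rfl
        · exact hρ p hp) (by
        intro u hu
        rcases List.mem_cons.1 hu with rfl | hu
        · exact le_rfl
        · exact (Nat.le_succ j).trans (hlow u hu))
    have hjn : j * (s + 1) + (s + 1) ≤ n * (s + 1) := by
      rw [← Nat.succ_mul]; exact Nat.mul_le_mul_right _ hj
    have hadd := size_add_le hta' htd'
    refine ⟨.pair (.num (hya * (hta + htd))) (.num (hyd * htd)), ⟨topBody, rfl, ?_⟩,
      hya * (hta + htd), hyd * htd, rfl, Nat.mul_pos hyd0 htd0, ?_, ?_, ?_⟩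
    · set C := ctxVal (encodeGraph G) n B Γ Λ K with hC
      set arg := Val.ofList [C, .num (j + 1), walkVal ρ, .num L] with harg
      have a1 : EvalLe (program b c k q) O [arg] (Term.item 1 (.var 0)) (.num (j + 1)) 3 :=
        (EvalLe.var 0 rfl).item 1 rfl
      have av := EvalLe.arith (o := .minus) (r := j) (W := X + 1) a1 (EvalLe.lit 1) rfl
        (size_le_of_le (by omega)) (size_le_of_le (by omega))
      have b0 : EvalLe (program b c k q) O [.num j, arg] (Term.item 0 (.var 1)) C 2 :=
        (EvalLe.var 1 rfl).item 0 rfl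
      have b2 : EvalLe (program b c k q) O [.num j, arg] (Term.item 2 (.var 1)) (walkVal ρ) 4 :=
        (EvalLe.var 1 rfl).item 2 rfl
      have b3 : EvalLe (program b c k q) O [.num j, arg] (Term.item 3 (.var 1)) (.num L) 5 :=
        (EvalLe.var 1 rfl).item 3 rfl
      have b4 : EvalLe (program b c k q) O [.num j, arg] (.var 0) (.num j) 1 := EvalLe.var 0 rfl
      have bt := EvalLe.call ht (b0.cons (b4.cons (b2.cons (b3.cons EvalLe.nil))))
      set tv := Val.pair (.num hta) (.num htd) with htv
      have c0 : EvalLe (program b c k q) O [tv, .num j, arg] (Term.item 0 (.var 2)) C 2 :=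
        (EvalLe.var 2 rfl).item 0 rfl
      have c2 : EvalLe (program b c k q) O [tv, .num j, arg] (Term.item 2 (.var 2))
        (walkVal ρ) 4 := (EvalLe.var 2 rfl).item 2 rfl
      have c3 : EvalLe (program b c k q) O [tv, .num j, arg] (Term.item 3 (.var 2)) (.num L) 5 :=
        (EvalLe.var 2 rfl).item 3 rfl
      have c4 : EvalLe (program b c k q) O [tv, .num j, arg] (.var 1) (.num j) 1 :=
        EvalLe.var 1 rfl
      have cn : EvalLe (program b c k q) O [tv, .num j, arg] (Term.item 1 (Term.item 0 (.var 2)))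
        (.num n) 4 := EvalLe.item 1 c0 rfl
      have cw : EvalLe (program b c k q) O [tv, .num j, arg]
          (.pair (.pair (.var 1) (Term.item 1 (Term.item 0 (.var 2)))) (Term.item 2 (.var 2)))
          (walkVal ((v, n) :: ρ)) 11 := (c4.pair cn).pair c2
      have cy := EvalLe.call hy (c0.cons (c4.cons (cw.cons (c3.cons EvalLe.nil))))
      set yv := Val.pair (.num hya) (.num hyd) with hyv
      have d0 : EvalLe (program b c k q) O [yv, tv, .num j, arg] (.var 0) yv 1 := EvalLe.var 0 rfl
      have d1 : EvalLe (program b c k q) O [yv, tv, .num j, arg] (.var 1) tv 1 := EvalLe.var 1 rfl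
      have m0 := EvalLe.arith (o := .plus) (W := X) d1.fst d1.snd rfl (by omega) (by omega)
      have m1 := EvalLe.arith (o := .times) (W := X) d0.fst m0 rfl (by omega)
        (by simp only [Arith.apply]; omega)
      have m2 := EvalLe.arith (o := .times) (W := X) d0.snd d1.snd rfl (by omega) (by omega)
      refine (EvalLe.condTrue a1 (Val.num_ne_zero (by omega)) (EvalLe.bind av (EvalLe.bind bt
        (EvalLe.bind cy (m1.pair m2))))).mono ?_
      rw [Nat.succ_mul (j + 1)]
      omega
    · rw [ratioProduct]
      change (1 + approxRatio G _ _ _ L ρ v) * ratioProduct _ j _ ((v, n) :: ρ) = _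
      rw [hyx, htx]
      have h1 : (htd : ℝ) ≠ 0 := by exact_mod_cast htd0.ne'
      have h2 : (hyd : ℝ) ≠ 0 := by exact_mod_cast hyd0.ne'
      push_cast
      field_simp
      ring
    · rw [Nat.succ_mul]; exact (size_mul_le _ _).trans (by omega)
    · rw [Nat.succ_mul]; exact (size_mul_le _ _).trans (by omega)

/-- The whole computation. All numbers and numbers of bits that occur are bounded by `X`. -/
theorem runs_main {B κ X : ℕ} (ε : ℚ) (N A L p : ℕ)
    (hN : N = ε.den / ε.num.toNat + 1) (hA : A = c * (n + 2) * (4 * (n + 1) * N)) (hL : L = A ^ k)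
    (hp : p = q * N * ((n + 1) * (n + 1)) * (4 * L + 1))
    (hb : ∀ ρ : List Val, ρ.getD 1 (.num 0) = .num p →
      EvalLe (program b c k q) O ρ b (.num B) (2 * X + 10))
    (hnum : NumericParams B (O 1 p) (O 2 p) (2 ^ p) κ)
    (hX1 : (n + 1) * (κ * (1 + 2 * n * L) + 1) ≤ X) (hX2 : n * n ≤ X)
    (hX4 : N ≤ X) (hX5 : bitLength ε ≤ X) (hX6 : c ≤ X) (hX7 : k ≤ X) (hX8 : q ≤ X) (hX9 : A ≤ X)
    (hX10 : 4 * L ≤ X) (hX11 : p ≤ X) :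
    ∃ (out : Val) (t : ℕ), Runs (program b c k q) O (encodeInput G ε) out t ∧
      t ≤ 2000 * (X + 15) ^ 5 ∧
      out.toReal = ((O 1 p : ℝ) / (2 ^ p : ℕ)) ^ G.edgeFinset.card *
        ratioProduct (approxRatio G (B / (2 ^ p : ℕ)) ((O 1 p : ℝ) / (2 ^ p : ℕ))
          ((O 2 p : ℝ) / (2 ^ p : ℕ)) L) n le_rfl [] := by
  set Γ := O 1 p with hΓ
  set Λ := O 2 p with hΛ
  set K := 2 ^ p with hK
  set P := program b c k q with hP
  have hκ := hnum.sizeK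
  have hκΓ := hnum.sizeΓ
  have hκΛ := hnum.sizeΛ
  have hs1 : κ * 1 ≤ κ * (1 + 2 * n * L) := Nat.mul_le_mul_left _ (by omega)
  have hs2 : 1 * (1 + 2 * n * L) ≤ κ * (1 + 2 * n * L) := Nat.mul_le_mul_right _ (by omega)
  have hs3 : (n + 1) * (κ * (1 + 2 * n * L) + 1) =
    n * (κ * (1 + 2 * n * L)) + κ * (1 + 2 * n * L) + n + 1 := by ring
  have hnX : n + 1 ≤ X := by
    have := Nat.zero_le (n * (κ * (1 + 2 * n * L))); omega
  have hbud : 1 + 2 * n * L ≤ X := by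
    have := Nat.zero_le (n * (κ * (1 + 2 * n * L))); omega
  have hκX : κ ≤ X := by
    have := Nat.zero_le (n * (κ * (1 + 2 * n * L))); omega
  obtain ⟨y, hy, ya, yd, rfl, yd0, yx, ya', yd'⟩ := returns_top (b := b) (c := c) (k := k) (q := q)
    (O := O) G hnum (by omega : n ≤ X) hX1 n le_rfl [] (by simp) (by simp) (by simp)
  have hnn : n * (κ * (1 + 2 * n * L) + 1) = n * (κ * (1 + 2 * n * L)) + n := by ring
  set m := G.edgeFinset.card with hm
  -- the number of edges
  have hdeg : ((List.ofFn (rowList G)).map List.sum).sum = 2 * m := by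
    rw [List.map_ofFn, List.sum_ofFn, hm, ← SimpleGraph.sum_degrees_eq_twice_card_edges]
    exact Finset.sum_congr rfl fun v _ => sum_rowList G v
  have hm2 : 2 * m ≤ n * n := by
    rw [hm, ← SimpleGraph.sum_degrees_eq_twice_card_edges]
    calc _ ≤ ∑ _v : Fin n, n := Finset.sum_le_sum fun v _ => degree_le_card G v
      _ = n * n := by simp
  have hbl : ε.num.toNat.size ≤ X ∧ ε.den.size ≤ X := by
    unfold bitLength at hX5; omega
  set g := encodeGraph G with hg
  set inp := encodeInput G ε with hinp
  have hinp' : inp = .pair g (.pair (.num ε.num.toNat) (.num ε.den)) := rfl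
  -- the local variables, one after the other
  have e1 : EvalLe P O [inp] (.call 2 (.fst (.var 0))) (.num n)
      (4 + (n + 1) * (2 * n + 20)) := by
    have h := returns_length (b := b) (c := c) (k := k) (q := q) (O := O)
      ((List.ofFn (rowList G)).map fun r => Val.ofList (r.map Val.num))
    rw [← encodeGraph_eq] at h
    simp only [List.length_map, List.length_ofFn] at h
    exact (EvalLe.call h (EvalLe.var (v := .pair g _) 0 rfl).fst).mono (by omega)
  have e2 : EvalLe P O [.num n, inp] (.arith .plus (.arith .quot (.snd (.snd (.var 1)))
      (.fst (.snd (.var 1)))) (.lit 1)) (.num N) (4 * X + 20) := by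
    have h0 : EvalLe P O [.num n, inp] (.var 1) inp 1 := EvalLe.var 1 rfl
    have h1 := EvalLe.arith (o := .quot) (W := X) h0.snd.snd h0.snd.fst rfl hbl.2 hbl.1
    refine (EvalLe.arith (o := .plus) (W := X) h1 (EvalLe.lit 1) hN.symm
      (size_le_of_le ?_) (size_le_of_le (by omega))).mono (by omega)
    simp only [Arith.apply]; omega
  have hn2 := size_le_of_le (show n + 2 ≤ X + 1 by omega)
  have hn1 := size_le_of_le hnX
  have e3 : EvalLe P O [.num N, .num n, inp] (.call 5 (Term.mkList [.arith .times
      (.arith .times (.lit c) (.arith .plus (.var 1) (.lit 2)))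
      (.arith .times (.arith .times (.lit 4) (.arith .plus (.var 1) (.lit 1))) (.var 0)), .lit k]))
      (.num L) (60 * (X + 10) + (X + 1) * (4 * (X * X + X + 1) + 30)) := by
    have h1 : EvalLe P O [.num N, .num n, inp] (.var 1) (.num n) 1 := EvalLe.var 1 rfl
    have h0 : EvalLe P O [.num N, .num n, inp] (.var 0) (.num N) 1 := EvalLe.var 0 rfl
    have t1 := EvalLe.arith (o := .plus) (W := X + 10) h1 (EvalLe.lit 2) rfl
      (size_le_of_le (by omega)) (size_le_of_le (by omega))
    have t2 := EvalLe.arith (o := .plus) (W := X + 10) h1 (EvalLe.lit 1) rfl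
      (size_le_of_le (by omega)) (size_le_of_le (by omega))
    have t3 := EvalLe.arith (o := .times) (W := X + 10) (EvalLe.lit c) t1 rfl
      (size_le_of_le (by omega)) (size_le_of_le (by simp only [Arith.apply]; omega))
    have t4 := EvalLe.arith (o := .times) (W := X + 10) (EvalLe.lit 4) t2 rfl
      (size_le_of_le (by omega)) (size_le_of_le (by simp only [Arith.apply]; omega))
    have z4 : (4 : ℕ).size = 3 := by decide
    have z1 := size_mul_le 4 (n + 1)
    have z2 := size_mul_le (4 * (n + 1)) N
    have z3 := size_mul_le c (n + 2)
    have zN := size_le_of_le hX4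
    have zc := size_le_of_le hX6
    have t5 := EvalLe.arith (o := .times) (W := X + 10) t4 h0 rfl
      (by simp only [Arith.apply]; omega) (by omega)
    have t6 := EvalLe.arith (o := .times) (r := A) (W := 2 * X + 10) t3 t5
      (by simp only [Arith.apply]; exact hA.symm)
      (by simp only [Arith.apply]; omega) (by simp only [Arith.apply]; omega)
    have hpw := returns_pow (b := b) (c := c) (k := k) (q := q) (O := O) A k X
      (size_le_of_le hX9) hX7
    rw [← hL] at hpw
    have hk : (k + 1) * (4 * (X * X + X + 1) + 30) ≤ (X + 1) * (4 * (X * X + X + 1) + 30) :=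
      Nat.mul_le_mul_right _ (by omega)
    exact (EvalLe.call hpw (t6.cons ((EvalLe.lit k).cons EvalLe.nil))).mono (by omega)
  have e4 : EvalLe P O [.num L, .num N, .num n, inp] (.arith .times
      (.arith .times (.arith .times (.lit q) (.var 1))
        (.arith .times (.arith .plus (.var 2) (.lit 1)) (.arith .plus (.var 2) (.lit 1))))
      (.arith .plus (.arith .times (.lit 4) (.var 0)) (.lit 1))) (.num p) (60 * (X + 10)) := by
    have h2 : EvalLe P O [.num L, .num N, .num n, inp] (.var 2) (.num n) 1 := EvalLe.var 2 rfl
    have h1 : EvalLe P O [.num L, .num N, .num n, inp] (.var 1) (.num N) 1 := EvalLe.var 1 rfl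
    have h0 : EvalLe P O [.num L, .num N, .num n, inp] (.var 0) (.num L) 1 := EvalLe.var 0 rfl
    have t2 := EvalLe.arith (o := .plus) (W := X + 10) h2 (EvalLe.lit 1) rfl
      (size_le_of_le (by omega)) (size_le_of_le (by omega))
    have z1 := size_mul_le q N
    have z2 := size_mul_le (n + 1) (n + 1)
    have z3 := size_mul_le (q * N) ((n + 1) * (n + 1))
    have zN := size_le_of_le hX4
    have zq := size_le_of_le hX8
    have t3 := EvalLe.arith (o := .times) (W := X + 10) (EvalLe.lit q) h1 rfl
      (by omega) (by omega)
    have t4 := EvalLe.arith (o := .times) (W := X + 10) t2 t2 rfl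
      (by simp only [Arith.apply]; omega) (by simp only [Arith.apply]; omega)
    have t5 := EvalLe.arith (o := .times) (W := 2 * X + 10) t3 t4 rfl
      (by simp only [Arith.apply]; omega) (by simp only [Arith.apply]; omega)
    have t6 := EvalLe.arith (o := .times) (W := X + 10) (EvalLe.lit 4) h0 rfl
      (size_le_of_le (by omega)) (size_le_of_le (by omega))
    have t7 := EvalLe.arith (o := .plus) (W := X + 10) t6 (EvalLe.lit 1) rfl
      (size_le_of_le (by simp only [Arith.apply]; omega)) (size_le_of_le (by omega))
    refine (EvalLe.arith (o := .times) (r := p) (W := 4 * X + 10) t5 t7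
      (by simp only [Arith.apply]; exact hp.symm)
      (by simp only [Arith.apply]; omega)
      (size_le_of_le (by simp only [Arith.apply]; omega))).mono (by omega)
  have e5 : EvalLe P O [.num p, .num L, .num N, .num n, inp] (.call 5 (Term.mkList [.lit 2, .var 0]))
      (.num K) (10 + (X + 1) * (4 * (X * X + X + 1) + 30)) := by
    have h0 : EvalLe P O [.num p, .num L, .num N, .num n, inp] (.var 0) (.num p) 1 :=
      EvalLe.var 0 rfl
    have hpw := returns_pow (b := b) (c := c) (k := k) (q := q) (O := O) 2 p X (by
      have h2 : (2 : ℕ).size = 2 := by decide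
      have h3 : 2 ≤ K.size + 1 := by
        have := Nat.size_pos.2 hnum.posK; omega
      omega) hX11
    have hk : (p + 1) * (4 * (X * X + X + 1) + 30) ≤ (X + 1) * (4 * (X * X + X + 1) + 30) :=
      Nat.mul_le_mul_right _ (by omega)
    exact (EvalLe.call hpw ((EvalLe.lit 2).cons (h0.cons EvalLe.nil))).mono (by omega)
  set C := ctxVal g n B Γ Λ K with hC
  have e6 : EvalLe P O [.num K, .num p, .num L, .num N, .num n, inp]
      (Term.mkList [.fst (.var 5), .var 4, b, .query 1 (.var 1), .query 2 (.var 1), .var 0]) C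
      (8 * X + 50) := by
    have h0 : EvalLe P O [.num K, .num p, .num L, .num N, .num n, inp] (.var 0) (.num K) 1 :=
      EvalLe.var 0 rfl
    have h1 : EvalLe P O [.num K, .num p, .num L, .num N, .num n, inp] (.var 1) (.num p) 1 :=
      EvalLe.var 1 rfl
    have h4 : EvalLe P O [.num K, .num p, .num L, .num N, .num n, inp] (.var 4) (.num n) 1 :=
      EvalLe.var 4 rfl
    have h5 : EvalLe P O [.num K, .num p, .num L, .num N, .num n, inp] (.var 5)
      (.pair g (.pair (.num ε.num.toNat) (.num ε.den))) 1 := EvalLe.var 5 rfl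
    have q1 := EvalLe.query (W := X) 1 h1 (by rw [← hΓ]; omega)
    have q2 := EvalLe.query (W := X) 2 h1 (by rw [← hΛ]; omega)
    exact (h5.fst.cons (h4.cons ((hb _ rfl).cons (q1.cons (q2.cons (h0.cons EvalLe.nil)))))).mono
      (by omega)
  have e7 : EvalLe P O [C, .num K, .num p, .num L, .num N, .num n, inp]
      (.arith .quot (.call 4 (.fst (.var 6))) (.lit 2)) (.num m)
      (2 * X + 10 + (X + 1) * ((X + 2) * (2 * X + 20))) := by
    have h6 : EvalLe P O [C, .num K, .num p, .num L, .num N, .num n, inp] (.var 6)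
      (.pair g (.pair (.num ε.num.toNat) (.num ε.den))) 1 := EvalLe.var 6 rfl
    have h := returns_sumRows (b := b) (c := c) (k := k) (q := q) (O := O)
      (List.ofFn (rowList G)) X n (by rw [hdeg]; omega) (by
        intro r hr
        obtain ⟨v, rfl⟩ := (List.mem_ofFn' _ _).1 hr
        exact (length_rowList G v).le)
    rw [← encodeGraph_eq, hdeg, List.length_ofFn] at h
    have hc : (n + 1) * ((n + 2) * (2 * X + 20)) ≤ (X + 1) * ((X + 2) * (2 * X + 20)) := by
      gcongr <;> omega
    refine (EvalLe.arith (o := .quot) (r := m) (W := X + 1) (EvalLe.call h h6.fst) (EvalLe.lit 2)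
      (by simp only [Arith.apply]; omega) (size_le_of_le (by omega))
      (size_le_of_le (by omega))).mono (by omega)
  set TT := (X + 3) * (20 * (X + 15) ^ 2) * (1 + 2 * n * L) with hTT
  have e8 : EvalLe P O [.num m, C, .num K, .num p, .num L, .num N, .num n, inp]
      (.call 9 (Term.mkList [.var 1, .var 6, .lit 0, .var 4])) (.pair (.num ya) (.num yd))
      (10 + (n + 1) * (TT + 10 * X + 100)) := by
    have h1 : EvalLe P O [.num m, C, .num K, .num p, .num L, .num N, .num n, inp] (.var 1) C 1 :=
      EvalLe.var 1 rfl
    have h6 : EvalLe P O [.num m, C, .num K, .num p, .num L, .num N, .num n, inp] (.var 6)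
      (.num n) 1 := EvalLe.var 6 rfl
    have h4 : EvalLe P O [.num m, C, .num K, .num p, .num L, .num N, .num n, inp] (.var 4)
      (.num L) 1 := EvalLe.var 4 rfl
    exact (EvalLe.call hy (h1.cons (h6.cons ((EvalLe.lit 0).cons (h4.cons EvalLe.nil))))).mono
      (by omega)
  set yv := Val.pair (.num ya) (.num yd) with hyv
  have e9 : EvalLe P O [yv, .num m, C, .num K, .num p, .num L, .num N, .num n, inp]
      (.pair (.arith .times (.fst (.var 0)) (.call 5 (Term.mkList [Term.item 3 (.var 2), .var 1])))
        (.arith .times (.snd (.var 0)) (.call 5 (Term.mkList [Term.item 5 (.var 2), .var 1]))))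
      (.pair (.num (ya * Γ ^ m)) (.num (yd * K ^ m)))
      (50 + 4 * (X * X + X + 1) + 2 * ((X + 1) * (4 * (X * X + X + 1) + 30))) := by
    have h0 : EvalLe P O [yv, .num m, C, .num K, .num p, .num L, .num N, .num n, inp] (.var 0)
      yv 1 := EvalLe.var 0 rfl
    have h1 : EvalLe P O [yv, .num m, C, .num K, .num p, .num L, .num N, .num n, inp] (.var 1)
      (.num m) 1 := EvalLe.var 1 rfl
    have h3 : EvalLe P O [yv, .num m, C, .num K, .num p, .num L, .num N, .num n, inp]
      (Term.item 3 (.var 2)) (.num Γ) 5 := (EvalLe.var 2 rfl).item 3 rfl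
    have h5 : EvalLe P O [yv, .num m, C, .num K, .num p, .num L, .num N, .num n, inp]
      (Term.item 5 (.var 2)) (.num K) 7 := (EvalLe.var 2 rfl).item 5 rfl
    have hmX : m ≤ X := by omega
    have hpΓ := returns_pow (b := b) (c := c) (k := k) (q := q) (O := O) Γ m X (by omega) hmX
    have hpK := returns_pow (b := b) (c := c) (k := k) (q := q) (O := O) K m X (by omega) hmX
    have hk : (m + 1) * (4 * (X * X + X + 1) + 30) ≤ (X + 1) * (4 * (X * X + X + 1) + 30) :=
      Nat.mul_le_mul_right _ (by omega)
    have sz : ∀ z : ℕ, z.size ≤ X → (z ^ m).size ≤ X * X + X + 1 := fun z hz =>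
      (size_pow_le z m).trans (by have := Nat.mul_le_mul hmX hz; omega)
    have m1 := EvalLe.arith (o := .times) (W := X * X + X + 1) h0.fst
      (EvalLe.call hpΓ (h3.cons (h1.cons EvalLe.nil))) rfl (by omega) (sz Γ (by omega))
    have m2 := EvalLe.arith (o := .times) (W := X * X + X + 1) h0.snd
      (EvalLe.call hpK (h5.cons (h1.cons EvalLe.nil))) rfl (by omega) (sz K (by omega))
    exact (m1.pair m2).mono (by omega)
  have hmain : EvalLe P O [inp] (mainBody b c k q) (.pair (.num (ya * Γ ^ m)) (.num (yd * K ^ m)))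
      _ :=
    EvalLe.bind e1 (EvalLe.bind e2 (EvalLe.bind e3 (EvalLe.bind e4 (EvalLe.bind e5 (EvalLe.bind e6
      (EvalLe.bind e7 (EvalLe.bind e8 e9)))))))
  obtain ⟨t, ht, hrun⟩ := EvalLe.call (P := P) (f := 0) ⟨mainBody b c k q, rfl, hmain⟩
    (EvalLe.var (P := P) (O := O) (ρ := [inp]) 0 rfl)
  refine ⟨_, t, hrun, ht.trans ?_, ?_⟩
  · have b1 : (n + 1) * (2 * n + 20) ≤ X * (2 * X + 20) := by gcongr; omega
    have b2 : TT ≤ (X + 3) * (20 * (X + 15) ^ 2) * X := by rw [hTT]; gcongr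
    have b3 : (n + 1) * (TT + 10 * X + 100) ≤
        X * ((X + 3) * (20 * (X + 15) ^ 2) * X + 10 * X + 100) := by gcongr
    have b4 : 2000 * (X + 15) ^ 5 = 2000 * X ^ 5 + 150000 * X ^ 4 + 4500000 * X ^ 3 +
      67500000 * X ^ 2 + 506250000 * X + 1518750000 := by ring
    have b5 : X * ((X + 3) * (20 * (X + 15) ^ 2) * X + 10 * X + 100) =
      20 * X ^ 5 + 660 * X ^ 4 + 6300 * X ^ 3 + 13510 * X ^ 2 + 100 * X := by ring
    have b6 : (X + 1) * (4 * (X * X + X + 1) + 30) = 4 * X ^ 3 + 8 * X ^ 2 + 38 * X + 34 := by ring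
    have b7 : (X + 1) * ((X + 2) * (2 * X + 20)) = 2 * X ^ 3 + 26 * X ^ 2 + 64 * X + 40 := by ring
    have b8 : X * (2 * X + 20) = 2 * X ^ 2 + 20 * X := by ring
    have b9 : X * X = X ^ 2 := by ring
    omega
  · have h1 : (yd : ℝ) ≠ 0 := by exact_mod_cast yd0.ne'
    have h2 : (K : ℝ) ≠ 0 := by exact_mod_cast hnum.posK.ne'
    rw [yx]
    simp only [Val.toReal, Val.fst, Val.snd, Val.toNat]
    push_cast
    rw [div_pow]
    field_simp

end Main

end TwoSpin

namespace TwoSpin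

/-! ### The approximation scheme -/

/-- A function that is bounded by a power of `x + 2`; since the base is at least two, this class
contains the constants and is closed under sums, products and fixed powers. -/
def PolyBounded (f : ℕ → ℕ) : Prop := ∃ e : ℕ, ∀ x, f x ≤ (x + 2) ^ e

namespace PolyBounded

theorem const (a : ℕ) : PolyBounded fun _ => a :=
  ⟨a, fun x => Nat.lt_two_pow_self.le.trans (Nat.pow_le_pow_left (by omega) a)⟩

theorem id : PolyBounded fun x => x := ⟨1, fun x => by rw [pow_one]; exact Nat.le_add_right x 2⟩

theorem add {f g : ℕ → ℕ} (hf : PolyBounded f) (hg : PolyBounded g) :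
    PolyBounded fun x => f x + g x := by
  obtain ⟨e, he⟩ := hf
  obtain ⟨e', he'⟩ := hg
  refine ⟨max e e' + 1, fun x => ?_⟩
  have h1 : (x + 2) ^ e ≤ (x + 2) ^ max e e' := Nat.pow_le_pow_right (by omega) (le_max_left _ _)
  have h2 : (x + 2) ^ e' ≤ (x + 2) ^ max e e' := Nat.pow_le_pow_right (by omega) (le_max_right _ _)
  have h3 : (x + 2) ^ max e e' * 2 ≤ (x + 2) ^ max e e' * (x + 2) :=
    Nat.mul_le_mul_left _ (by omega)
  have h4 := he x
  have h5 := he' x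
  rw [pow_succ]
  dsimp only
  omega

theorem mul {f g : ℕ → ℕ} (hf : PolyBounded f) (hg : PolyBounded g) :
    PolyBounded fun x => f x * g x := by
  obtain ⟨e, he⟩ := hf
  obtain ⟨e', he'⟩ := hg
  exact ⟨e + e', fun x => by rw [pow_add]; exact Nat.mul_le_mul (he x) (he' x)⟩

theorem pow {f : ℕ → ℕ} (hf : PolyBounded f) (m : ℕ) : PolyBounded fun x => f x ^ m := by
  obtain ⟨e, he⟩ := hf
  exact ⟨e * m, fun x => by rw [pow_mul]; exact Nat.pow_le_pow_left (he x) m⟩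

end PolyBounded

/-- One bound `X`, polynomial in the number of vertices, the length of the error and its inverse,
for all the numbers and numbers of bits that occur in the computation. -/
theorem exists_size_bound (c k q a : ℕ) : ∃ e : ℕ, ∀ x n N ℓ A L p κ : ℕ, n ≤ x → N ≤ x → ℓ ≤ x →
    A = c * (n + 2) * (4 * (n + 1) * N) → L = A ^ k →
    p = q * N * ((n + 1) * (n + 1)) * (4 * L + 1) → κ = p + a → ∃ X : ℕ,
      (n + 1) * (κ * (1 + 2 * n * L) + 1) ≤ X ∧ n * n ≤ X ∧ N ≤ X ∧ ℓ ≤ X ∧ c ≤ X ∧ k ≤ X ∧ q ≤ X ∧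
      A ≤ X ∧ 4 * L ≤ X ∧ p ≤ X ∧ 2000 * (X + 15) ^ 5 ≤ (x + 2) ^ e := by
  let Af : ℕ → ℕ := fun x => c * (x + 2) * (4 * (x + 1) * x)
  let Lf : ℕ → ℕ := fun x => Af x ^ k
  let pf : ℕ → ℕ := fun x => q * x * ((x + 1) * (x + 1)) * (4 * Lf x + 1)
  let Sf : ℕ → ℕ := fun x => (x + 1) * ((pf x + a) * (1 + 2 * x * Lf x) + 1)
  let Xf : ℕ → ℕ := fun x => Sf x + x * x + x + (c + k + q) + Af x + 4 * Lf x + pf x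
  have hx := PolyBounded.id
  have hc := PolyBounded.const
  have hA : PolyBounded Af := ((hc c).mul (hx.add (hc 2))).mul (((hc 4).mul (hx.add (hc 1))).mul hx)
  have hL : PolyBounded Lf := hA.pow k
  have hp : PolyBounded pf := (((hc q).mul hx).mul ((hx.add (hc 1)).mul (hx.add (hc 1)))).mul
    (((hc 4).mul hL).add (hc 1))
  have hS : PolyBounded Sf := (hx.add (hc 1)).mul
    (((hp.add (hc a)).mul ((hc 1).add (((hc 2).mul hx).mul hL))).add (hc 1))
  have hX : PolyBounded Xf :=
    (((((hS.add (hx.mul hx)).add hx).add (hc (c + k + q))).add hA).add ((hc 4).mul hL)).add hp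
  obtain ⟨e, he⟩ := (hc 2000).mul ((hX.add (hc 15)).pow 5)
  refine ⟨e, fun x n N ℓ A L p κ hn hN hℓ hA hL hp hκ => ⟨Xf x, ?_⟩⟩
  have h1 : A ≤ Af x := by rw [hA]; dsimp only [Af]; gcongr
  have h2 : L ≤ Lf x := by rw [hL]; exact Nat.pow_le_pow_left h1 k
  have h3 : p ≤ pf x := by rw [hp]; dsimp only [pf]; gcongr
  have h4 : (n + 1) * (κ * (1 + 2 * n * L) + 1) ≤ Sf x := by rw [hκ]; dsimp only [Sf]; gcongr
  have h5 : n * n ≤ x * x := Nat.mul_le_mul hn hn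
  have hXx : Xf x = Sf x + x * x + x + (c + k + q) + Af x + 4 * Lf x + pf x := rfl
  refine ⟨?_, ?_, ?_, ?_, ?_, ?_, ?_, ?_, ?_, ?_, he x⟩ <;> omega

/-- An absolute error that is small compared with a positive parameter is a small relative error. -/
theorem LogClose.of_dyadic {K θ η o : ℝ} (hK : 0 < K) (hθ : 0 < θ) (hη : 0 ≤ η) (hη1 : η ≤ 1)
    (hKη : 2 ≤ K * θ * η) (ho : |o - K * θ| ≤ 1) : 0 < o ∧ LogClose η θ (o / K) := by
  obtain ⟨h1, h2⟩ := abs_le.1 ho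
  have hexp := Real.add_one_le_exp η
  have hKθ : 0 < K * θ := mul_pos hK hθ
  have hlow : K * θ * (1 - η / 2) ≤ o := by nlinarith
  have hpos : 0 < o := lt_of_lt_of_le (mul_pos hKθ (by linarith)) hlow
  refine ⟨hpos, ?_, ?_⟩
  · rw [mul_div_assoc', le_div_iff₀ hK]
    calc θ * K ≤ (η + 1) * (K * θ * (1 - η / 2)) := by
          have : 0 ≤ K * θ * (η * (1 - η)) :=
            mul_nonneg hKθ.le (mul_nonneg hη (by linarith))
          nlinarith
      _ ≤ Real.exp η * o := mul_le_mul hexp hlow (mul_nonneg hKθ.le (by linarith))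
          (Real.exp_pos η).le
  · rw [div_le_iff₀ hK]
    calc o ≤ (η + 1) * (θ * K) := by nlinarith
      _ ≤ Real.exp η * (θ * K) := by gcongr
      _ = Real.exp η * θ * K := by ring

theorem LogClose.one_sub_mul_le {δ ε x y : ℝ} (h : LogClose δ x y) (hδ : 2 * δ ≤ ε)
    (hδ0 : 0 ≤ δ) (hδ1 : δ ≤ 1 / 2) (hy : 0 ≤ y) :
    (1 - ε) * y ≤ x ∧ x ≤ (1 + ε) * y := by
  -- The inequality `exp δ ≤ 1 + 2 * δ` on the interval `[0, 1 / 2]`, from `exp (-δ) ≥ 1 - δ`.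
  have hneg := Real.add_one_le_exp (-δ)
  have hprod : Real.exp (-δ) * Real.exp δ = 1 := by rw [← Real.exp_add]; simp
  have hE := Real.exp_pos δ
  have hle : Real.exp δ ≤ 1 + 2 * δ := by
    have h1 : (1 - δ) * Real.exp δ ≤ 1 := by nlinarith
    have h2 : 1 ≤ (1 - δ) * (1 + 2 * δ) := by nlinarith
    exact le_of_mul_le_mul_left (h1.trans h2) (by linarith)
  constructor
  · have h1 : (1 - δ) * y ≤ Real.exp (-δ) * (Real.exp δ * x) :=
      (mul_le_mul_of_nonneg_right (by linarith) hy).trans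
        (mul_le_mul_of_nonneg_left h.2 (Real.exp_pos _).le)
    rw [← mul_assoc, hprod, one_mul] at h1
    nlinarith
  · exact h.1.trans (by gcongr; linarith)

/-- The total relative error for the precisions chosen in `mainBody`. -/
theorem total_error_le {n N L : ℕ} (hN : 1 ≤ N) {η : ℝ}
    (hη : η = 1 / (4 * N * ((n + 1) * (n + 1)) * (4 * L + 1))) :
    (n : ℝ) ^ 2 * η + n * (1 / ((4 * (n + 1) * N : ℕ) : ℝ) + 2 * η * (1 + 2 * n * L)) ≤
      1 / (2 * N) := by
  have hN' : (0 : ℝ) < N := by exact_mod_cast hN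
  have h1 : (n : ℝ) * (1 / ((4 * (n + 1) * N : ℕ) : ℝ)) ≤ 1 / (4 * N) := by
    push_cast
    rw [mul_one_div, div_le_div_iff₀ (by positivity) (by positivity)]
    nlinarith
  have h2 : ((n : ℝ) ^ 2 + 2 * n + 4 * n ^ 2 * L) * η ≤ 1 / (4 * N) := by
    rw [hη, mul_one_div, div_le_div_iff₀ (by positivity) (by positivity)]
    have h : (n : ℝ) ^ 2 + 2 * n + 4 * n ^ 2 * L ≤ ((n + 1) * (n + 1)) * (4 * L + 1) := by
      have : (0 : ℝ) ≤ n * L := by positivity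
      have : (0 : ℝ) ≤ (L : ℝ) := by positivity
      nlinarith
    nlinarith
  have h3 : (1 : ℝ) / (2 * N) = 1 / (4 * N) + 1 / (4 * N) := by field_simp; norm_num
  rw [h3]
  nlinarith

theorem partitionFunction_nonneg {n : ℕ} (G : SimpleGraph (Fin n)) [DecidableRel G.Adj]
    {β γ lam : ℝ} (hβ : 0 ≤ β) (hγ : 0 < γ) (hlam : 0 < lam) : 0 ≤ partitionFunction G β γ lam := by
  rw [← fieldZ_univ_eq]
  exact (fieldZ_pos G hβ hγ _ fun _ => hlam.le).le

/-- The integer part of the inverse of the error, plus one. -/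
theorem inverse_error_bounds {ε : ℚ} (hε : 0 < ε) {N : ℕ} (hN : N = ε.den / ε.num.toNat + 1) :
    1 ≤ (N : ℝ) * ε ∧ (N : ℝ) ≤ 1 / ε + 1 := by
  have hnum : 0 < ε.num := Rat.num_pos.2 hε
  set m := ε.num.toNat with hm
  have hm0 : 0 < m := by omega
  have hεm : (ε : ℝ) = m / ε.den := by
    rw [Rat.cast_def]
    congr 1
    exact_mod_cast (Int.toNat_of_nonneg hnum.le).symm
  have hd : (0 : ℝ) < ε.den := by exact_mod_cast ε.den_pos
  have hmr : (0 : ℝ) < m := by exact_mod_cast hm0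
  have h1 : ε.den < N * m := by
    have := Nat.lt_div_mul_add (a := ε.den) hm0
    rw [hN, Nat.add_mul, one_mul]
    exact this
  constructor
  · rw [hεm, mul_div_assoc', le_div_iff₀ hd, one_mul]
    exact_mod_cast h1.le
  · rw [hεm, one_div_div, hN]
    push_cast
    have := @Nat.cast_div_le ℝ _ _ _ ε.den m
    linarith

/-- A running time that is polynomial in the integer data is polynomial in the quantities that
`HasFPTAS` refers to. -/
theorem size_bound_le_rpow {n e : ℕ} {ε : ℚ} (hε : 0 < ε) {N : ℕ}
    (hN : N = ε.den / ε.num.toNat + 1) :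
    (((n + bitLength ε + N + 2) ^ e : ℕ) : ℝ) ≤
      ((n : ℝ) + bitLength ε + 1 / ε) ^ (3 * e) := by
  have hε' : (0 : ℝ) < ε := by exact_mod_cast hε
  have hinv : (0 : ℝ) < 1 / ε := by positivity
  have hnum : 0 < ε.num := Rat.num_pos.2 hε
  have hbit : 2 ≤ bitLength ε := by
    have h1 : 0 < ε.num.toNat.size := Nat.size_pos.2 (by omega)
    have h2 : 0 < ε.den.size := Nat.size_pos.2 ε.den_pos
    unfold bitLength
    omega
  have hbit' : (2 : ℝ) ≤ bitLength ε := by exact_mod_cast hbit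
  have hn0 : (0 : ℝ) ≤ n := Nat.cast_nonneg n
  have hNle := (inverse_error_bounds hε hN).2
  set y : ℝ := (n : ℝ) + bitLength ε + 1 / ε with hy
  have hy2 : 2 ≤ y := by linarith
  push_cast
  rw [pow_mul]
  refine pow_le_pow_left₀ (by positivity) ?_ e
  calc (n : ℝ) + bitLength ε + N + 2 ≤ y + 3 := by linarith
    _ ≤ y ^ 3 := by nlinarith [mul_nonneg (by linarith : 0 ≤ y) (by linarith : 0 ≤ y - 2)]

/-- Integer constants for the program: a scale `q` that is large compared with the inverses of the
nonzero parameters, and a bound `a` for the parameters. -/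
theorem exists_scale (β γ lam : ℝ) : ∃ q a : ℕ, (∀ θ ∈ [β, γ, lam], 0 < θ → 8 ≤ (q : ℝ) * θ) ∧
    ∀ θ ∈ [β, γ, lam], θ + 1 ≤ a := by
  have key : ∀ θ : ℝ, ∃ m : ℕ, (0 < θ → 8 ≤ (m : ℝ) * θ) ∧ θ + 1 ≤ m := fun θ => by
    obtain ⟨m, hm⟩ := exists_nat_ge (max (8 / θ) (θ + 1))
    refine ⟨m, fun h => ?_, (le_max_right _ _).trans hm⟩
    exact (div_le_iff₀ h).1 ((le_max_left _ _).trans hm)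
  obtain ⟨m₁, h₁, h₁'⟩ := key β
  obtain ⟨m₂, h₂, h₂'⟩ := key γ
  obtain ⟨m₃, h₃, h₃'⟩ := key lam
  have r₁ : (0 : ℝ) ≤ m₁ := Nat.cast_nonneg _
  have r₂ : (0 : ℝ) ≤ m₂ := Nat.cast_nonneg _
  have r₃ : (0 : ℝ) ≤ m₃ := Nat.cast_nonneg _
  refine ⟨m₁ + m₂ + m₃, m₁ + m₂ + m₃, fun θ hθ h0 => ?_, fun θ hθ => ?_⟩ <;>
  · simp only [List.mem_cons, List.not_mem_nil, or_false] at hθ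
    push_cast
    rcases hθ with rfl | rfl | rfl
    · first | nlinarith [h₁ h0] | linarith
    · first | nlinarith [h₂ h0] | linarith
    · first | nlinarith [h₃ h0] | linarith

/-- The number of bits of an answer of the oracle. -/
theorem size_answer_le {o p a : ℕ} {θ : ℝ} (ho : |(o : ℝ) - 2 ^ p * θ| ≤ 1) (hθ : θ + 1 ≤ a) :
    o.size ≤ p + a := by
  rw [Nat.size_le]
  have h1 : (1 : ℝ) ≤ 2 ^ p := one_le_pow₀ (by norm_num)
  have h2 : (o : ℝ) ≤ 2 ^ p * a := by
    have := (abs_le.1 ho).2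
    nlinarith
  have h3 : o ≤ 2 ^ p * a := by exact_mod_cast h2
  rw [pow_add]
  exact h3.trans_lt (Nat.mul_lt_mul_of_pos_left Nat.lt_two_pow_self (by positivity))

open Classical in
/-- A parameter `β` that vanishes has to be treated exactly, since its approximations may be
positive; whether it vanishes is built into the program. -/
noncomputable def betaTerm (β : ℝ) : Term := if β = 0 then .lit 0 else .query 0 (.var 1)

theorem hasFPTAS_of_uniqueness {Δ : ℕ∞} {β γ lam : ℝ} (hanti : AntiFerromagnetic β γ lam)
    (huniq : UpToUnique β γ lam Δ) : HasFPTAS β γ lam Δ := by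
  obtain ⟨k, c, hc, hbudget⟩ := exists_budget hanti huniq
  obtain ⟨hβ, -, hγ, -, hlam⟩ := hanti
  obtain ⟨q, a, hq, ha⟩ := exists_scale β γ lam
  obtain ⟨e, hcaps⟩ := exists_size_bound c k q (a + 2)
  refine ⟨program (betaTerm β) c k q, 3 * e + 1, fun O hO n G _ hdeg ε hε => ?_⟩
  obtain ⟨N, hN⟩ : ∃ N, N = ε.den / ε.num.toNat + 1 := ⟨_, rfl⟩
  obtain ⟨A, hA⟩ : ∃ A, A = c * (n + 2) * (4 * (n + 1) * N) := ⟨_, rfl⟩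
  obtain ⟨L, hL⟩ : ∃ L, L = A ^ k := ⟨_, rfl⟩
  obtain ⟨p, hp⟩ : ∃ p, p = q * N * ((n + 1) * (n + 1)) * (4 * L + 1) := ⟨_, rfl⟩
  obtain ⟨X, hX1, hX2, hX4, hX5, hX6, hX7, hX8, hX9, hX10, hX11, hXe⟩ :=
    hcaps (n + bitLength ε + N) n N (bitLength ε) A L p (p + (a + 2)) (by omega) (by omega)
      (by omega) hA hL hp rfl
  have hN1 : 1 ≤ N := hN.symm ▸ Nat.le_add_left 1 _
  have hN' : (1 : ℝ) ≤ N := by exact_mod_cast hN1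
  have hO0 : |(O 0 p : ℝ) - 2 ^ p * β| ≤ 1 := hO 0 p
  have hO1 : |(O 1 p : ℝ) - 2 ^ p * γ| ≤ 1 := hO 1 p
  have hO2 : |(O 2 p : ℝ) - 2 ^ p * lam| ≤ 1 := hO 2 p
  have hs0 := size_answer_le hO0 (ha β (by simp))
  have hs1 := size_answer_le hO1 (ha γ (by simp))
  have hs2 := size_answer_le hO2 (ha lam (by simp))
  -- The precision `η` of the parameters, relative to their size.
  set η : ℝ := 1 / (4 * N * ((n + 1) * (n + 1)) * (4 * L + 1)) with hη
  have hη0 : 0 < η := by positivity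
  have hη1 : η ≤ 1 := by
    rw [hη, div_le_one (by positivity)]
    exact one_le_mul_of_one_le_of_one_le (one_le_mul_of_one_le_of_one_le (by linarith)
      (one_le_mul_of_one_le_of_one_le (by linarith [(Nat.cast_nonneg n : (0 : ℝ) ≤ n)])
        (by linarith [(Nat.cast_nonneg n : (0 : ℝ) ≤ n)])))
      (by linarith [(Nat.cast_nonneg L : (0 : ℝ) ≤ L)])
  have hpη : (p : ℝ) * η = q / 4 := by
    rw [hη, hp]
    push_cast
    field_simp
  have hKp : (p : ℝ) ≤ 2 ^ p := by exact_mod_cast Nat.lt_two_pow_self.le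
  have hK0 : (0 : ℝ) < 2 ^ p := by positivity
  have hclose : ∀ (o : ℕ) (θ : ℝ), θ ∈ [β, γ, lam] → 0 < θ → |(o : ℝ) - 2 ^ p * θ| ≤ 1 →
      (0 : ℝ) < o ∧ LogClose η θ (o / 2 ^ p) := fun o θ hmem hθ ho => by
    refine LogClose.of_dyadic hK0 hθ hη0.le hη1 ?_ ho
    have h1 := hq θ hmem hθ
    have h2 : (p : ℝ) * (θ * η) ≤ 2 ^ p * (θ * η) :=
      mul_le_mul_of_nonneg_right hKp (by positivity)
    nlinarith
  obtain ⟨hΓ0, hΓ⟩ := hclose (O 1 p) γ (by simp) hγ hO1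
  obtain ⟨hΛ0, hΛ⟩ := hclose (O 2 p) lam (by simp) hlam hO2
  obtain ⟨B, hBsize, hBclose, hb⟩ : ∃ B : ℕ, B.size ≤ p + a ∧ LogClose η β (B / 2 ^ p) ∧
      ∀ ρ : List Val, ρ.getD 1 (.num 0) = .num p →
        EvalLe (program (betaTerm β) c k q) O ρ (betaTerm β) (.num B) (2 * X + 10) := by
    by_cases h0 : β = 0
    · refine ⟨0, by simp, ?_, fun ρ _ => ?_⟩
      · rw [h0]; simp [LogClose]
      · rw [show betaTerm β = .lit 0 from if_pos h0]
        exact (EvalLe.lit 0).mono (by omega)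
    · refine ⟨O 0 p, hs0, (hclose _ β (by simp) (lt_of_le_of_ne hβ (Ne.symm h0)) hO0).2,
        fun ρ hρ => ?_⟩
      rw [show betaTerm β = .query 0 (.var 1) from if_neg h0]
      have hpa : p + (a + 2) ≤ X := by
        refine le_trans ?_ hX1
        calc p + (a + 2) = 1 * ((p + (a + 2)) * 1) := by ring
          _ ≤ (n + 1) * ((p + (a + 2)) * (1 + 2 * n * L) + 1) :=
            Nat.mul_le_mul (Nat.le_add_left 1 n)
              ((Nat.mul_le_mul_left _ (Nat.le_add_right 1 _)).trans (Nat.le_succ _))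
      exact (EvalLe.query 0 (EvalLe.var 1 hρ) hs0).mono (by omega)
  have hnum : NumericParams B (O 1 p) (O 2 p) (2 ^ p) (p + (a + 2)) :=
    ⟨by exact_mod_cast hΓ0, by positivity, by omega, by omega, by omega, by
      rw [Nat.size_pow]; omega⟩
  obtain ⟨out, t, hrun, ht, hout⟩ := runs_main G ε N A L p hN hA hL hp hb hnum hX1 hX2 hX4 hX5
    hX6 hX7 hX8 hX9 hX10 hX11
  have hZ := partitionFunction_nonneg G hβ hγ hlam
  have hcl := partitionFunction_logClose G hβ (by positivity) hγ (div_pos hΓ0 hK0) hlam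
    (div_pos hΛ0 hK0) hη0.le hBclose hΓ hΛ
    (hbudget G hdeg (4 * (n + 1) * N) L (Nat.mul_pos (by omega) hN1) (by rw [hL, hA]))
  have hout' : out.toReal = ((O 1 p : ℝ) / 2 ^ p) ^ G.edgeFinset.card *
      ratioProduct (approxRatio G (B / 2 ^ p) (O 1 p / 2 ^ p) (O 2 p / 2 ^ p) L) n le_rfl [] := by
    rw [hout]; push_cast; rfl
  have hout0 : 0 ≤ out.toReal := by unfold Val.toReal; positivity
  rw [← hout'] at hcl
  have hε1 := (inverse_error_bounds hε hN).1
  have hfin := (hcl.mono (total_error_le hN1 hη) hout0 hZ).one_sub_mul_le (ε := ε)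
    (by rw [mul_one_div, div_le_iff₀ (by positivity)]; linarith) (by positivity)
    (by rw [div_le_div_iff₀ (by positivity) (by norm_num)]; linarith) hZ
  refine ⟨out, t, hrun, ?_, hfin⟩
  have htime : (t : ℝ) ≤ ((n : ℝ) + bitLength ε + 1 / ε) ^ (3 * e) :=
    le_trans (by exact_mod_cast ht.trans hXe) (size_bound_le_rpow hε hN)
  have hε' : (0 : ℝ) < ε := by exact_mod_cast hε
  have hy1 : 1 ≤ (n : ℝ) + bitLength ε + 1 / ε := by
    have h1 : 0 < ε.den.size := Nat.size_pos.2 ε.den_pos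
    have h2 : (1 : ℝ) ≤ bitLength ε := by exact_mod_cast (by unfold bitLength; omega)
    have h3 : (0 : ℝ) < 1 / ε := by positivity
    linarith [(Nat.cast_nonneg n : (0 : ℝ) ≤ n)]
  refine htime.trans ((pow_le_pow_right₀ hy1 (Nat.le_succ (3 * e))).trans
    (le_mul_of_one_le_left (by positivity) ?_))
  push_cast
  linarith [(Nat.cast_nonneg e : (0 : ℝ) ≤ e)]

end TwoSpin

theorem theorem2 (Δ : ℕ∞) (hΔ : 3 ≤ Δ) (β γ lam : ℝ)
    (hanti : TwoSpin.AntiFerromagnetic β γ lam)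
    (huniq : TwoSpin.UpToUnique β γ lam Δ) :
    TwoSpin.HasFPTAS β γ lam Δ :=
  TwoSpin.hasFPTAS_of_uniqueness hanti huniq
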